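/- **Conventions.** Graphs are finite directed graphs $G=(V,E,w)$ with $n\ge 1$ vertices and integer edge weights $w:E\to\mathbb{Z}$ (self-loops are allowed). A path $u_0u_1\cdots u_\ell$ (vertices may repeat) satisfies $(u_i,u_{i+1})\in E$ for all $i<\ell$, and its weight is $\sum_{j<\ell}w(u_j,u_{j+1})$. It is a *nonnegative prefix path* if $\sum_{j=0}^{i-1}w(u_j,u_{j+1})\ge 0$ for all $1\le i\le \ell$. *All-Pairs Nonnegative Prefix Paths (APNP)*: given $G$, decide for every pair $(u,v)\in V\times V$ whether there is a nonnegative prefix path with at least one edge from $u$ to $v$. *All-Pairs Shortest Paths (APSP)*: given $G$ without negative cycles, compute for every pair $(u,v)\in V\times V$ whether $v$ is reachable from $u$ and, if so, the minimum weight of a path from $u$ to $v$. Algorithms are deterministic programs for a random access machine with words of $O(\log n)$ bits (signed integers) and unit-cost word operations (arithmetic, bit operations, comparison, reading and writing memory); the input is given as an adjacency matrix and a weight matrix. As usual, a problem is *solvable in time $O(n^{3-\epsilon})$* if for every constant $c$ there is such a program which solves it in $O(n^{3-\epsilon})$ steps on all $n$-vertex inputs with edge weights in $\{-n^c,\dots,n^c\}$,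 where the program and the constants hidden in the time bound and in the word length may depend on $c$ (and $\epsilon$) but not on the input. *APSP Hypothesis*: for no $\epsilon>0$ is APSP solvable in time $O(n^{3-\epsilon})$. **Theorem.** If the APSP Hypothesis holds, then for no $\epsilon>0$ is All-Pairs Nonnegative Prefix Paths solvable in time $O(n^{3-\epsilon})$. -/

import Mathlib

/-! ## Weighted directed graphs, paths, and the two graph problems -/

/-- A directed graph (self-loops allowed, at most one edge per ordered pair) with integer edge
weights.  Only the weights of edges matter. -/
structure WDigraph (V : Type*) extends Digraph V where
  weight : V → V → ℤ

namespace WDigraph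

variable {V : Type*}

/-- `p 0, p 1, …, p ℓ` is a path with `ℓ` edges (vertices may repeat). -/
def IsPath (G : WDigraph V) (p : ℕ → V) (ℓ : ℕ) : Prop :=
  ∀ i < ℓ, G.Adj (p i) (p (i + 1))

/-- The total weight of the first `i` edges of `p`. -/
def prefixWeight (G : WDigraph V) (p : ℕ → V) (i : ℕ) : ℤ :=
  ∑ j ∈ Finset.range i, G.weight (p j) (p (j + 1))

/-- A path all of whose prefixes have nonnegative weight. -/
def IsNonnegPrefixPath (G : WDigraph V) (p : ℕ → V) (ℓ : ℕ) : Prop :=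
  G.IsPath p ℓ ∧ ∀ i, 1 ≤ i → i ≤ ℓ → 0 ≤ G.prefixWeight p i

/-- There is a nonnegative prefix path, with at least one edge, from `u` to `v`. -/
def HasNonnegPrefixPath (G : WDigraph V) (u v : V) : Prop :=
  ∃ (p : ℕ → V) (ℓ : ℕ), 1 ≤ ℓ ∧ p 0 = u ∧ p ℓ = v ∧ G.IsNonnegPrefixPath p ℓ

/-- There is a path (possibly without edges) from `u` to `v`. -/
def Reachable (G : WDigraph V) (u v : V) : Prop :=
  ∃ (p : ℕ → V) (ℓ : ℕ), p 0 = u ∧ p ℓ = v ∧ G.IsPath p ℓ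

/-- The set of all weights of paths (possibly without edges) from `u` to `v`. -/
def pathWeights (G : WDigraph V) (u v : V) : Set ℤ :=
  {x | ∃ (p : ℕ → V) (ℓ : ℕ), p 0 = u ∧ p ℓ = v ∧ G.IsPath p ℓ ∧ G.prefixWeight p ℓ = x}

/-- Every closed path has nonnegative weight. -/
def NoNegativeCycle (G : WDigraph V) : Prop :=
  ∀ (p : ℕ → V) (ℓ : ℕ), G.IsPath p ℓ → p ℓ = p 0 → 0 ≤ G.prefixWeight p ℓ

/-- All edge weights lie in `{-M, …, M}`. -/
def WeightsBoundedBy (G : WDigraph V) (M : ℕ) : Prop :=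
  ∀ u v, G.Adj u v → |G.weight u v| ≤ (M : ℤ)

end WDigraph

/-! ## The random access machine

A machine has registers and a random access memory.  The memory is divided into banks; each bank is
an array indexed by words.  A program is a finite text, so it mentions only finitely many registers
and banks.  Words are signed integers; every basic operation takes one time step.  The word length
is limited: a run in which some instruction produces a word of absolute value above the word bound
`B` is not a legal run. -/

namespace RAM

/-- A memory configuration. -/
structure State where
  reg : ℕ → ℤ
  mem : ℕ → ℤ → ℤ

/-- Write `x` into register `r`. -/
def State.setReg (s : State) (r : ℕ) (x : ℤ) : State :=
  { s with reg := Function.update s.reg r x }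

/-- Write `x` into cell `a` of bank `b`. -/
def State.setMem (s : State) (b : ℕ) (a x : ℤ) : State :=
  { s with mem := Function.update s.mem b (Function.update (s.mem b) a x) }

/-- The word operations. -/
inductive BinOp where
  | add | sub | mul | div | mod
  | and | or | xor | shiftLeft | shiftRight

/-- Meaning of the word operations; division rounds, bit operations are two's complement. -/
def BinOp.eval : BinOp → ℤ → ℤ → ℤ
  | add, x, y => x + y
  | sub, x, y => x - y
  | mul, x, y => x * y
  | div, x, y => x / y
  | mod, x, y => x % y
  | and, x, y => Int.land x y
  | or, x, y => Int.lor x y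
  | xor, x, y => Int.xor x y
  | shiftLeft, x, y => x * 2 ^ y.toNat
  | shiftRight, x, y => x / 2 ^ y.toNat

/-- Programs.  In `load r b a` and `store b a r` the register `a` holds the address. -/
inductive Prog where
  | skip : Prog
  | const (r : ℕ) (x : ℤ) : Prog
  | op (o : BinOp) (r r₁ r₂ : ℕ) : Prog
  | load (r b a : ℕ) : Prog
  | store (b a r : ℕ) : Prog
  | seq (P Q : Prog) : Prog
  | ifPos (r : ℕ) (P Q : Prog) : Prog
  | whilePos (r : ℕ) (P : Prog) : Prog

/-- `Exec B P s t s₁`: started in configuration `s`, the program `P` halts in configuration `s₁`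
after exactly `t` steps, and no instruction of the run produces a word outside `[-B, B]`. -/
inductive Exec (B : ℕ) : Prog → State → ℕ → State → Prop
  | skip (s : State) : Exec B .skip s 1 s
  | const (r : ℕ) (x : ℤ) (s : State) (h : |x| ≤ (B : ℤ)) :
      Exec B (.const r x) s 1 (s.setReg r x)
  | op (o : BinOp) (r r₁ r₂ : ℕ) (s : State)
      (h : |o.eval (s.reg r₁) (s.reg r₂)| ≤ (B : ℤ)) :
      Exec B (.op o r r₁ r₂) s 1 (s.setReg r (o.eval (s.reg r₁) (s.reg r₂)))
  | load (r b a : ℕ) (s : State) (h : |s.mem b (s.reg a)| ≤ (B : ℤ)) :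
      Exec B (.load r b a) s 1 (s.setReg r (s.mem b (s.reg a)))
  | store (b a r : ℕ) (s : State) (h : |s.reg r| ≤ (B : ℤ)) :
      Exec B (.store b a r) s 1 (s.setMem b (s.reg a) (s.reg r))
  | seq {P Q : Prog} {s s₁ s₂ : State} {t₁ t₂ : ℕ}
      (h₁ : Exec B P s t₁ s₁) (h₂ : Exec B Q s₁ t₂ s₂) :
      Exec B (.seq P Q) s (t₁ + t₂) s₂
  | ifPos_true {r : ℕ} {P Q : Prog} {s s₁ : State} {t : ℕ}
      (hr : 0 < s.reg r) (h : Exec B P s t s₁) :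
      Exec B (.ifPos r P Q) s (t + 1) s₁
  | ifPos_false {r : ℕ} {P Q : Prog} {s s₁ : State} {t : ℕ}
      (hr : s.reg r ≤ 0) (h : Exec B Q s t s₁) :
      Exec B (.ifPos r P Q) s (t + 1) s₁
  | whilePos_true {r : ℕ} {P : Prog} {s s₁ s₂ : State} {t₁ t₂ : ℕ}
      (hr : 0 < s.reg r) (h₁ : Exec B P s t₁ s₁) (h₂ : Exec B (.whilePos r P) s₁ t₂ s₂) :
      Exec B (.whilePos r P) s (t₁ + t₂ + 1) s₂
  | whilePos_false {r : ℕ} {P : Prog} {s : State} (hr : s.reg r ≤ 0) :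
      Exec B (.whilePos r P) s 1 s

open scoped Classical in
/-- The initial configuration for an `n`-vertex input graph: register `0` holds `n`; cell `u * n + v`
of bank `0` holds `1` if `(u, v)` is an edge and `0` otherwise, and the same cell of bank `1` holds
the weight of that edge; everything else is `0`. -/
noncomputable def initState {n : ℕ} (G : WDigraph (Fin n)) : State where
  reg := fun r => if r = 0 then (n : ℤ) else 0
  mem := fun b a => ∑ u : Fin n, ∑ v : Fin n,
    if a = (u : ℤ) * n + v ∧ G.Adj u v then
      (if b = 0 then 1 else if b = 1 then G.weight u v else 0)
    else 0

open scoped Classical in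
/-- The layout of the input: the sum in `initState` has at most one nonzero term. -/
theorem initState_mem {n : ℕ} (G : WDigraph (Fin n)) (b : ℕ) (u v : Fin n) :
    (initState G).mem b ((u : ℤ) * n + v) =
      if G.Adj u v then (if b = 0 then 1 else if b = 1 then G.weight u v else 0) else 0 := by
  have key : ∀ x y : Fin n, (u : ℤ) * n + v = (x : ℤ) * n + y → x = u ∧ y = v := by
    intro x y h
    have h' : (v : ℕ) + n * u = y + n * x := by zify; linarith
    have hn : 0 < n := u.pos
    have hd := congrArg (· / n) h'
    have hm := congrArg (· % n) h'
    simp only [Nat.add_mul_div_left _ _ hn, Nat.div_eq_of_lt v.2, Nat.div_eq_of_lt y.2,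
      Nat.add_mul_mod_self_left, Nat.mod_eq_of_lt v.2, Nat.mod_eq_of_lt y.2, zero_add] at hd hm
    exact ⟨Fin.ext hd.symm, Fin.ext hm.symm⟩
  simp only [initState]
  rw [Finset.sum_eq_single u, Finset.sum_eq_single v]
  · simp
  · intro y _ hy
    exact if_neg fun h => hy (key u y h.1).2
  · simp
  · intro x _ hx
    exact Finset.sum_eq_zero fun y _ => if_neg fun h => hx (key x y h.1).1
  · simp

/-- The content, on halting, of the output matrix stored row by row in bank `b`. -/
def State.matrix (s : State) (n b : ℕ) (u v : Fin n) : ℤ :=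
  s.mem b ((u : ℤ) * n + v)

end RAM

/-- A computational problem on weighted directed graphs: the admissible inputs, and the acceptable
final configurations of a machine for each input. -/
structure GraphProblem where
  Valid : ∀ {n : ℕ}, WDigraph (Fin n) → Prop
  Correct : ∀ {n : ℕ}, WDigraph (Fin n) → RAM.State → Prop

/-- The problem is solvable in time `O(T n)` on `n`-vertex graphs with polynomially bounded weights:
for every `c` some program solves it on all admissible graphs with `n ≥ 1` vertices and edge
weights in `{-n^c, …, n^c}`, in at most `C * T n` steps, with words of at most
`k * log₂ (n + 2)` bits (and a sign), where the constants `k` and `C` do not depend on the input. -/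
def GraphProblem.SolvableInTime (Q : GraphProblem) (T : ℕ → ℝ) : Prop :=
  ∀ c : ℕ, ∃ (P : RAM.Prog) (k : ℕ) (C : ℝ),
    ∀ (n : ℕ), 1 ≤ n → ∀ G : WDigraph (Fin n), Q.Valid G → G.WeightsBoundedBy (n ^ c) →
      ∃ (t : ℕ) (s : RAM.State),
        RAM.Exec ((n + 2) ^ k) P (RAM.initState G) t s ∧ (t : ℝ) ≤ C * T n ∧ Q.Correct G s

open scoped Classical in
/-- All-Pairs Nonnegative Prefix Paths: decide for every pair `(u, v)` whether there is a nonnegative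
prefix path from `u` to `v`; the answers are the 0-1 matrix in bank `2`. -/
def APNP : GraphProblem where
  Valid := fun _ => True
  Correct := fun {n} G s => ∀ u v : Fin n,
    s.matrix n 2 u v = if G.HasNonnegPrefixPath u v then 1 else 0

/-- All-Pairs Shortest Paths: in a graph without negative cycles, compute for every pair `(u, v)`
whether `v` is reachable from `u` (0-1 matrix in bank `2`) and, if so, the minimum weight of a path
from `u` to `v` (matrix in bank `3`). -/
def APSP : GraphProblem where
  Valid := fun G => G.NoNegativeCycle
  Correct := fun {n} G s => ∀ u v : Fin n,
    (G.Reachable u v → s.matrix n 2 u v = 1 ∧ IsLeast (G.pathWeights u v) (s.matrix n 3 u v)) ∧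
    (¬ G.Reachable u v → s.matrix n 2 u v = 0)

/-- The APSP Hypothesis: for no `ε > 0` can APSP be solved in time `O(n^(3 - ε))`. -/
def APSPHypothesis : Prop :=
  ∀ ε : ℝ, 0 < ε → ¬ APSP.SolvableInTime (fun n => (n : ℝ) ^ (3 - ε))

/-!
A truly subcubic algorithm for nonnegative prefix paths is turned into one for shortest paths.  The
reduction is a program of the random access machine, whose correctness, running time and word
length are verified.

Mathematically, shortest paths reduce to `O(log n)` (min,+) squarings of a distance matrix `D`
(`WDigraph.IsApproxDist.sq`, `WDigraph.IsApproxDist.correct`), a large number `M` playing the role of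
infinity.  A square is computed by a binary search for all entries at once (`RAM.run_square`).  One
round of the search has to decide for all pairs `(i, k)` whether `D i j + D j k < U i k` for some
`j`; call such a pair violated (`RAM.run_round`).

The indices, `N = s ^ 3 = O(n)` many after padding, are cut into `s ^ 2` blocks of size `s`.  For a
triple of blocks, a layered graph with `4 * s` vertices has a nonnegative prefix path from `i` in the
first layer to its copy in the last one exactly if some pair `(i, k)` is violated within the triple
(`WDigraph.gadget_hasNonnegPrefixPath`).  If the oracle reports such an `i`, exhaustive search in
time `O(s ^ 2)` finds the pair, which is marked and never reported again; otherwise the triple is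
finished (`RAM.run_iter`).  There are `s ^ 6` triples and `N ^ 2 = s ^ 6` pairs, so a round makes at
most `2 * s ^ 6` calls, each of cost `O(s ^ (3 - δ))`, in total `O(n ^ (3 - δ / 3))`; the logarithmic
number of rounds costs at most half of the gain (`time_le`).

On the machine, each call of the oracle must find blank memory.  The oracle only uses addresses
within its word bound, so it suffices to rename its registers and banks and to shift its
addresses by an offset that moves on with every call (`RAM.Exec.embed`, `RAM.Run.call`); the offset
stays polynomial in `n`.  The rest of the program is written with a small compiler for arithmetic
expressions (`RAM.Expr.exec_comp`) and verified in a program logic with time bounds (`RAM.Run`).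
There, all words are bounded by a fixed polynomial `X`, and `X ^ 100` bounds all intermediate
results (`RAM.Expr.abs_eval_le`).

Register allocation: `0` holds `n`, `1` holds `s`, `2` and `3` hold `N` and `N ^ 2`, `4` holds `M`,
`5` the distance of consecutive windows, `6` the number of edges covered by the distance matrix, `7`
the width of the search brackets, `8` the number of the block triple, `9` the offset of the window,
`10` to `13` serve in loops; registers from `100` on are scratch space.  Banks `4`, `5` and `6` hold
the distances, the lower ends of the brackets, and the thresholds `U`; the banks from `10` on belong
to the oracle.
-/

/-! ### Arithmetic expressions and their compilation -/

namespace RAM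

/-- Arithmetic expressions over registers and memory.  `cond e a b` is `a` if `e` is positive and
`b` otherwise. -/
inductive Expr where
  | const (x : ℤ)
  | reg (r : ℕ)
  | bin (o : BinOp) (a b : Expr)
  | ld (b : ℕ) (a : Expr)
  | cond (e a b : Expr)

namespace Expr

instance : Add Expr := ⟨bin .add⟩
instance : Sub Expr := ⟨bin .sub⟩
instance : Mul Expr := ⟨bin .mul⟩
instance : Div Expr := ⟨bin .div⟩
instance : Mod Expr := ⟨bin .mod⟩

/-- The value of an expression in a configuration. -/
def eval (s : State) : Expr → ℤ
  | const x => x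
  | reg r => s.reg r
  | bin o a b => o.eval (a.eval s) (b.eval s)
  | ld b a => s.mem b (a.eval s)
  | cond e a b => if 0 < e.eval s then a.eval s else b.eval s

section
variable (s : State) (a b : Expr)
@[simp] theorem eval_const (x : ℤ) : (const x).eval s = x := rfl
@[simp] theorem eval_reg (r : ℕ) : (reg r).eval s = s.reg r := rfl
@[simp] theorem eval_add : (a + b).eval s = a.eval s + b.eval s := rfl
@[simp] theorem eval_sub : (a - b).eval s = a.eval s - b.eval s := rfl
@[simp] theorem eval_mul : (a * b).eval s = a.eval s * b.eval s := rfl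
@[simp] theorem eval_div : (a / b).eval s = a.eval s / b.eval s := rfl
@[simp] theorem eval_mod : (a % b).eval s = a.eval s % b.eval s := rfl
@[simp] theorem eval_ld (k : ℕ) : (ld k a).eval s = s.mem k (a.eval s) := rfl
@[simp] theorem eval_cond (e : Expr) :
    (cond e a b).eval s = if 0 < e.eval s then a.eval s else b.eval s := rfl
end

/-- Number of leaves and loads. -/
def size : Expr → ℕ
  | const _ => 1
  | reg _ => 1
  | bin _ a b => a.size + b.size
  | ld _ a => a.size + 1
  | cond e a b => e.size + a.size + b.size

/-- Running time of the compiled expression. -/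
def cost : Expr → ℕ
  | const _ => 1
  | reg _ => 2
  | bin _ a b => a.cost + b.cost + 1
  | ld _ a => a.cost + 1
  | cond e a b => e.cost + a.cost + b.cost + 1

/-- The expression uses only the five arithmetic operations, the visible registers `0, …, 99`, and
constants of absolute value at most `100`. -/
def good : Expr → Bool
  | const x => decide (|x| ≤ 100)
  | reg r => decide (r < 100)
  | bin .add a b => a.good && b.good
  | bin .sub a b => a.good && b.good
  | bin .mul a b => a.good && b.good
  | bin .div a b => a.good && b.good
  | bin .mod a b => a.good && b.good
  | bin _ _ _ => false
  | ld _ a => a.good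
  | cond e a b => e.good && a.good && b.good

/-- Code that evaluates an expression into register `t`, using only the registers from `t` on. -/
def comp : Expr → ℕ → Prog
  | const x, t => .const t x
  | reg r, t => .seq (.const t 0) (.op .add t t r)
  | bin o a b, t => .seq (a.comp t) (.seq (b.comp (t + 1)) (.op o t t (t + 1)))
  | ld b a, t => .seq (a.comp t) (.load t b t)
  | cond e a b, t => .seq (e.comp t) (.ifPos t (a.comp t) (b.comp t))

theorem good_bin {o : BinOp} {a b : Expr} (h : (bin o a b).good = true) :
    (o = .add ∨ o = .sub ∨ o = .mul ∨ o = .div ∨ o = .mod) ∧ a.good = true ∧ b.good = true := by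
  cases o <;> simp_all [good]

theorem one_le_size (e : Expr) : 1 ≤ e.size := by
  induction e <;> simp only [size] <;> omega

end Expr

/-- Two configurations agree on memory and on the registers `0, …, 99`; the other registers are
scratch space. -/
def Vis (σ τ : State) : Prop := (∀ r < 100, σ.reg r = τ.reg r) ∧ σ.mem = τ.mem

theorem Vis.refl (σ : State) : Vis σ σ := ⟨fun _ _ => rfl, rfl⟩

theorem Vis.trans {σ τ ρ : State} (h : Vis σ τ) (h' : Vis τ ρ) : Vis σ ρ :=
  ⟨fun r hr => (h.1 r hr).trans (h'.1 r hr), h.2.trans h'.2⟩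

/-- All visible words are at most `X` in absolute value. -/
structure Bounded (X : ℕ) (σ : State) : Prop where
  reg : ∀ r < 100, |σ.reg r| ≤ (X : ℤ)
  mem : ∀ b a, |σ.mem b a| ≤ (X : ℤ)

theorem Vis.bounded {X : ℕ} {σ τ : State} (h : Vis σ τ) (hb : Bounded X τ) : Bounded X σ :=
  ⟨fun r hr => by rw [h.1 r hr]; exact hb.reg r hr, by rw [h.2]; exact hb.mem⟩

theorem Expr.eval_congr {σ τ : State} (h : Vis σ τ) (e : Expr) (he : e.good = true) :
    e.eval σ = e.eval τ := by
  induction e with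
  | const x => rfl
  | reg r => exact h.1 r (by simpa [good] using he)
  | bin o a b iha ihb =>
    obtain ⟨-, ha, hb⟩ := good_bin he
    simp only [eval, iha ha, ihb hb]
  | ld b a iha => simp only [eval, iha (by simpa [good] using he), h.2]
  | cond e a b ihe iha ihb =>
    simp only [good, Bool.and_eq_true] at he
    simp only [eval, ihe he.1.1, iha he.1.2, ihb he.2]

theorem abs_add_le_pow {X : ℕ} (hX : 2 ≤ X) {x y : ℤ} {p q : ℕ} (hp : 1 ≤ p) (hq : 1 ≤ q)
    (hx : |x| ≤ (X : ℤ) ^ p) (hy : |y| ≤ (X : ℤ) ^ q) : |x| + |y| ≤ (X : ℤ) ^ (p + q) := by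
  have h2 : (2 : ℤ) ≤ X := by exact_mod_cast hX
  have h1 : ∀ m, 1 ≤ m → (2 : ℤ) ≤ (X : ℤ) ^ m := fun m hm =>
    h2.trans (le_self_pow₀ (by linarith) (by omega))
  rw [pow_add]
  nlinarith [h1 p hp, h1 q hq]

/-- A single size bound for all intermediate results: an expression with `m` leaves and loads over
words bounded by `X` has a value bounded by `X ^ m`. -/
theorem Expr.abs_eval_le {X : ℕ} (hX : 100 ≤ X) {σ : State} (hb : Bounded X σ) (e : Expr)
    (he : e.good = true) : |e.eval σ| ≤ (X : ℤ) ^ e.size := by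
  have hX1 : (1 : ℤ) ≤ X := by exact_mod_cast (by omega : 1 ≤ X)
  induction e with
  | const x =>
    have : |x| ≤ 100 := by simpa [good] using he
    simp only [eval, size, pow_one]
    exact this.trans (by exact_mod_cast hX)
  | reg r =>
    simp only [eval, size, pow_one]
    exact hb.reg r (by simpa [good] using he)
  | bin o a b iha ihb =>
    obtain ⟨ho, ha, hb'⟩ := good_bin he
    have h1 := iha ha
    have h2 := ihb hb'
    have h3 := abs_add_le_pow (by omega) a.one_le_size b.one_le_size h1 h2
    simp only [eval, size]
    rcases ho with rfl | rfl | rfl | rfl | rfl <;> simp only [BinOp.eval]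
    · exact (abs_add_le _ _).trans h3
    · exact (abs_sub _ _).trans h3
    · rw [abs_mul, pow_add]
      exact mul_le_mul h1 h2 (abs_nonneg _) (by positivity)
    · have : |a.eval σ / b.eval σ| ≤ |a.eval σ| := by
        exact Int.abs_ediv_le_abs _ _
      linarith [abs_nonneg (b.eval σ)]
    · have : |a.eval σ % b.eval σ| ≤ |a.eval σ| + |b.eval σ| := by
        rcases eq_or_ne (b.eval σ) 0 with h0 | h0
        · simp [h0]
        · rw [abs_of_nonneg (Int.emod_nonneg _ h0)]
          have := Int.emod_lt_abs (a.eval σ) h0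
          linarith [abs_nonneg (a.eval σ)]
      linarith
  | ld b a iha =>
    simp only [eval, size]
    exact (hb.mem _ _).trans (le_self_pow₀ hX1 (by omega))
  | cond e a b ihe iha ihb =>
    simp only [good, Bool.and_eq_true] at he
    simp only [eval, size]
    split_ifs
    · exact (iha he.1.2).trans (pow_le_pow_right₀ hX1 (by omega))
    · exact (ihb he.2).trans (pow_le_pow_right₀ hX1 (by omega))

/-- Correctness of the compiled code of an expression. -/
theorem Expr.exec_comp {B X : ℕ} (hX : 100 ≤ X) (e : Expr) (he : e.good = true) (t : ℕ)
    (ht : 100 ≤ t) (σ : State) (hb : Bounded X σ) (hB : X ^ e.size ≤ B) :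
    ∃ tm σ', Exec B (e.comp t) σ tm σ' ∧ tm ≤ e.cost ∧ σ'.mem = σ.mem ∧
      (∀ r < t, σ'.reg r = σ.reg r) ∧ σ'.reg t = e.eval σ := by
  have hle : ∀ e' : Expr, e'.good = true → X ^ e'.size ≤ B → |e'.eval σ| ≤ (B : ℤ) :=
    fun e' h h' => (e'.abs_eval_le hX hb h).trans (by exact_mod_cast h')
  have hpw : ∀ m, m ≤ e.size → X ^ m ≤ B := fun m hm =>
    (Nat.pow_le_pow_right (by omega) hm).trans hB
  induction e generalizing t σ with
  | const x =>
    refine ⟨1, _, .const t x σ (hle _ he hB), le_rfl, rfl, fun r hr => ?_, ?_⟩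
    · simp [State.setReg, hr.ne]
    · simp [State.setReg]
  | reg r =>
    have hr : r < 100 := by simpa [good] using he
    have hrt : r ≠ t := by omega
    refine ⟨2, _, .seq (.const t 0 σ (by simp)) (.op .add t t r _ ?_), le_rfl, rfl,
      fun r' hr' => ?_, ?_⟩
    · simpa [State.setReg, BinOp.eval, hrt] using hle _ he hB
    · simp [State.setReg, hr'.ne]
    · simp [State.setReg, BinOp.eval, hrt]
  | bin o a b iha ihb =>
    obtain ⟨-, ha, hb'⟩ := good_bin he
    have hsa : a.size ≤ (bin o a b).size := by simp [size]
    have hsb : b.size ≤ (bin o a b).size := by simp [size]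
    obtain ⟨t1, σ1, e1, c1, m1, r1, v1⟩ := iha ha t ht σ hb (hpw _ hsa) hle
      (fun m hm => hpw m (hm.trans hsa))
    have hv1 : Vis σ1 σ := ⟨fun r hr => r1 r (by omega), m1⟩
    obtain ⟨t2, σ2, e2, c2, m2, r2, v2⟩ := ihb hb' (t + 1) (by omega) σ1 (hv1.bounded hb)
      (hpw _ hsb) (fun e' h h' => by rw [eval_congr hv1 e' h]; exact hle e' h h')
      (fun m hm => hpw m (hm.trans hsb))
    rw [eval_congr hv1 b hb'] at v2
    have hva : σ2.reg t = a.eval σ := (r2 t (by omega)).trans v1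
    refine ⟨t1 + (t2 + 1), _, .seq e1 (.seq e2 (.op o t t (t + 1) σ2 ?_)), ?_, ?_,
      fun r hr => ?_, ?_⟩
    · rw [hva, v2]; exact hle _ he hB
    · simp only [cost]; omega
    · exact m2.trans m1
    · simp only [State.setReg, Function.update_of_ne hr.ne]
      exact (r2 r (by omega)).trans (r1 r hr)
    · simp only [State.setReg, Function.update_self, hva, v2, eval]
  | ld b a iha =>
    have ha : a.good = true := by simpa [good] using he
    have hsa : a.size ≤ (ld b a).size := by simp [size]
    obtain ⟨t1, σ1, e1, c1, m1, r1, v1⟩ := iha ha t ht σ hb (hpw _ hsa) hle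
      (fun m hm => hpw m (hm.trans hsa))
    refine ⟨t1 + 1, _, .seq e1 (.load t b t σ1 ?_), ?_, ?_, fun r hr => ?_, ?_⟩
    · rw [v1, m1]; exact hle _ he hB
    · simp only [cost]; omega
    · exact m1
    · simp only [State.setReg, Function.update_of_ne hr.ne]; exact r1 r hr
    · simp only [State.setReg, Function.update_self, v1, m1, eval]
  | cond e a b ihe iha ihb =>
    simp only [good, Bool.and_eq_true] at he
    have hse : e.size ≤ (cond e a b).size := by simp only [size]; omega
    have hsa : a.size ≤ (cond e a b).size := by simp only [size]; omega
    have hsb : b.size ≤ (cond e a b).size := by simp only [size]; omega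
    obtain ⟨t1, σ1, e1, c1, m1, r1, v1⟩ := ihe he.1.1 t ht σ hb (hpw _ hse) hle
      (fun m hm => hpw m (hm.trans hse))
    have hv1 : Vis σ1 σ := ⟨fun r hr => r1 r (by omega), m1⟩
    have hle1 : ∀ e' : Expr, e'.good = true → X ^ e'.size ≤ B → |e'.eval σ1| ≤ (B : ℤ) :=
      fun e' h h' => by rw [eval_congr hv1 e' h]; exact hle e' h h'
    by_cases hp : 0 < e.eval σ
    · obtain ⟨t2, σ2, e2, c2, m2, r2, v2⟩ := iha he.1.2 t ht σ1 (hv1.bounded hb) (hpw _ hsa) hle1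
        (fun m hm => hpw m (hm.trans hsa))
      refine ⟨t1 + (t2 + 1), σ2, .seq e1 (.ifPos_true (by rwa [v1]) e2), ?_, m2.trans m1,
        fun r hr => (r2 r hr).trans (r1 r hr), ?_⟩
      · simp only [cost]; omega
      · rw [v2, eval_congr hv1 a he.1.2]; simp [eval, hp]
    · obtain ⟨t2, σ2, e2, c2, m2, r2, v2⟩ := ihb he.2 t ht σ1 (hv1.bounded hb) (hpw _ hsb) hle1
        (fun m hm => hpw m (hm.trans hsb))
      refine ⟨t1 + (t2 + 1), σ2, .seq e1 (.ifPos_false (by rw [v1]; omega) e2), ?_, m2.trans m1,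
        fun r hr => (r2 r hr).trans (r1 r hr), ?_⟩
      · simp only [cost]; omega
      · rw [v2, eval_congr hv1 b he.2]; simp [eval, hp]

/-! ### Program logic with time bounds -/

/-- `Run B P T σ Q`: from every configuration that looks like `σ`, the program `P` halts within `T`
steps, in a configuration that looks like one satisfying `Q`. -/
def Run (B : ℕ) (P : Prog) (T : ℕ) (σ : State) (Q : State → Prop) : Prop :=
  ∀ τ, Vis τ σ → ∃ t τ' σ', Exec B P τ t τ' ∧ t ≤ T ∧ Vis τ' σ' ∧ Q σ'

variable {B X : ℕ}

theorem Run.mono {P : Prog} {T T' : ℕ} {σ : State} {Q Q' : State → Prop} (h : Run B P T σ Q)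
    (hT : T ≤ T') (hQ : ∀ σ', Q σ' → Q' σ') : Run B P T' σ Q' := fun τ hτ =>
  let ⟨t, τ', σ', h1, h2, h3, h4⟩ := h τ hτ
  ⟨t, τ', σ', h1, h2.trans hT, h3, hQ _ h4⟩

theorem Run.seq {P P' : Prog} {T T' : ℕ} {σ : State} {Q : State → Prop}
    (h : Run B P T σ fun σ' => Run B P' T' σ' Q) : Run B (.seq P P') (T + T') σ Q := by
  intro τ hτ
  obtain ⟨t, τ', σ', h1, h2, h3, h4⟩ := h τ hτ
  obtain ⟨t', τ'', σ'', h1', h2', h3', h4'⟩ := h4 τ' h3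
  exact ⟨_, _, _, .seq h1 h1', by omega, h3', h4'⟩

theorem Run.ifPos {P P' : Prog} {T : ℕ} {r : ℕ} (hr : r < 100) {σ : State} {Q : State → Prop}
    (h : 0 < σ.reg r → Run B P T σ Q) (h' : σ.reg r ≤ 0 → Run B P' T σ Q) :
    Run B (.ifPos r P P') (T + 1) σ Q := by
  intro τ hτ
  rcases lt_or_ge 0 (σ.reg r) with h0 | h0
  · obtain ⟨t, τ', σ', h1, h2, h3, h4⟩ := h h0 τ hτ
    exact ⟨_, _, _, .ifPos_true (by rwa [hτ.1 r hr]) h1, by omega, h3, h4⟩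
  · obtain ⟨t, τ', σ', h1, h2, h3, h4⟩ := h' h0 τ hτ
    exact ⟨_, _, _, .ifPos_false (by rwa [hτ.1 r hr]) h1, by omega, h3, h4⟩

/-- The loop rule: `I m` is the invariant with at most `m` iterations to go. -/
theorem Run.whilePos {P : Prog} {T : ℕ} {r : ℕ} (hr : r < 100) {I : ℕ → State → Prop}
    {Q : State → Prop}
    (hbody : ∀ m σ, I m σ → 0 < σ.reg r → Run B P T σ fun σ' => ∃ m' < m, I m' σ')
    (hend : ∀ m σ, I m σ → σ.reg r ≤ 0 → Q σ) (m : ℕ) (σ : State) (hI : I m σ) :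
    Run B (.whilePos r P) (m * (T + 1) + 1) σ Q := by
  induction m using Nat.strong_induction_on generalizing σ with
  | _ m ih =>
    intro τ hτ
    rcases lt_or_ge 0 (σ.reg r) with h0 | h0
    · obtain ⟨t, τ', σ', h1, h2, h3, m', hm, h4⟩ := hbody m σ hI h0 τ hτ
      obtain ⟨t2, τ2, σ2, g1, g2, g3, g4⟩ := ih m' hm σ' h4 τ' h3
      refine ⟨_, _, _, .whilePos_true (by rwa [hτ.1 r hr]) h1 g1, ?_, g3, g4⟩
      have : (m' + 1) * (T + 1) ≤ m * (T + 1) := Nat.mul_le_mul_right _ hm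
      rw [add_mul] at this
      omega
    · exact ⟨1, τ, σ, .whilePos_false (by rwa [hτ.1 r hr]), by omega, hτ, hend m σ hI h0⟩

/-- Assign the value of an expression to a register. -/
def assign (r : ℕ) (e : Expr) : Prog :=
  .seq (e.comp 100) (.seq (.const r 0) (.op .add r r 100))

/-- Write the value of `e` into the cell of bank `b` addressed by `a`. -/
def put (b : ℕ) (a e : Expr) : Prog :=
  .seq (e.comp 100) (.seq (a.comp 101) (.store b 101 100))

theorem Run.assign (hX : 100 ≤ X) (hB : X ^ 100 ≤ B) {r : ℕ} (hr : r < 100) {e : Expr}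
    (he : (e.good && decide (e.size ≤ 100)) = true) {σ : State} (hb : Bounded X σ)
    {Q : State → Prop}
    (hQ : Q (σ.setReg r (e.eval σ))) : Run B (RAM.assign r e) (e.cost + 2) σ Q := by
  simp only [Bool.and_eq_true, decide_eq_true_eq] at he
  intro τ hτ
  have hB' : X ^ e.size ≤ B := (Nat.pow_le_pow_right (by omega) he.2).trans hB
  obtain ⟨t, τ', h1, h2, h3, h4, h5⟩ := e.exec_comp hX he.1 100 le_rfl τ (hτ.bounded hb) hB'
  rw [Expr.eval_congr hτ e he.1] at h5
  have hr100 : (100 : ℕ) ≠ r := by omega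
  have hval : |e.eval σ| ≤ (B : ℤ) :=
    (e.abs_eval_le hX hb he.1).trans (by exact_mod_cast hB')
  refine ⟨_, _, _, .seq h1 (.seq (.const r 0 τ' (by simp)) (.op .add r r 100 _ ?_)), ?_, ?_, hQ⟩
  · simpa [State.setReg, BinOp.eval, hr100, h5] using hval
  · omega
  · refine ⟨fun r' hr' => ?_, ?_⟩
    · by_cases h : r' = r
      · subst h
        simp [State.setReg, BinOp.eval, hr100, h5]
      · simp [State.setReg, h, h4 r' hr', hτ.1 r' hr']
    · simp [State.setReg, h3, hτ.2]

theorem Run.put (hX : 100 ≤ X) (hB : X ^ 100 ≤ B) {b : ℕ} {a e : Expr}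
    (ha : (a.good && decide (a.size ≤ 100)) = true)
    (he : (e.good && decide (e.size ≤ 100)) = true) {σ : State} (hb : Bounded X σ)
    {Q : State → Prop} (hQ : Q (σ.setMem b (a.eval σ) (e.eval σ))) :
    Run B (RAM.put b a e) (a.cost + e.cost + 1) σ Q := by
  simp only [Bool.and_eq_true, decide_eq_true_eq] at he ha
  intro τ hτ
  have hB' : ∀ m ≤ 100, X ^ m ≤ B := fun m hm => (Nat.pow_le_pow_right (by omega) hm).trans hB
  obtain ⟨t, τ', h1, h2, h3, h4, h5⟩ := e.exec_comp hX he.1 100 le_rfl τ (hτ.bounded hb)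
    (hB' _ he.2)
  have hv : Vis τ' σ := Vis.trans ⟨h4, h3⟩ hτ
  obtain ⟨t2, τ2, g1, g2, g3, g4, g5⟩ := a.exec_comp hX ha.1 101 (by omega) τ' (hv.bounded hb)
    (hB' _ ha.2)
  rw [Expr.eval_congr hτ e he.1] at h5
  rw [Expr.eval_congr hv a ha.1] at g5
  rw [← g4 100 (by omega)] at h5
  have hval : |e.eval σ| ≤ (B : ℤ) :=
    (e.abs_eval_le hX hb he.1).trans (by exact_mod_cast hB' _ he.2)
  refine ⟨_, _, _, .seq h1 (.seq g1 (.store b 101 100 τ2 (by rwa [h5]))), by omega, ?_, hQ⟩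
  refine ⟨fun r' hr' => ?_, ?_⟩
  · exact (g4 r' (by omega)).trans (hv.1 r' hr')
  · simp only [State.setMem, h5, g5, g3, hv.2]

theorem Bounded.setReg {σ : State} (hb : Bounded X σ) (r : ℕ) {x : ℤ} (hx : |x| ≤ (X : ℤ)) :
    Bounded X (σ.setReg r x) := by
  refine ⟨fun r' hr' => ?_, hb.mem⟩
  by_cases h : r' = r
  · subst h; simpa [State.setReg] using hx
  · simpa [State.setReg, h] using hb.reg r' hr'

theorem Bounded.setMem {σ : State} (hb : Bounded X σ) (b : ℕ) (a : ℤ) {x : ℤ}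
    (hx : |x| ≤ (X : ℤ)) : Bounded X (σ.setMem b a x) := by
  refine ⟨hb.reg, fun b' a' => ?_⟩
  simp only [State.setMem]
  by_cases h : b' = b
  · subst h
    by_cases h' : a' = a
    · subst h'; simpa using hx
    · simpa [h'] using hb.mem b' a'
  · simpa [h] using hb.mem b' a'

/-- `while e is positive do P`, keeping the value of `e` in register `r`. -/
def whileExpr (r : ℕ) (e : Expr) (P : Prog) : Prog :=
  .seq (assign r e) (.whilePos r (.seq P (assign r e)))

/-- The loop rule for `whileExpr`.  The invariant must survive the write to the loop register. -/
theorem Run.whileExpr (hX : 100 ≤ X) (hB : X ^ 100 ≤ B) {P : Prog} {T : ℕ} {r : ℕ} (hr : r < 100)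
    {e : Expr} (he : (e.good && decide (e.size ≤ 100)) = true) {I : ℕ → State → Prop}
    {Q : State → Prop}
    (hI : ∀ m σ, I m σ → Bounded X σ ∧ |e.eval σ| ≤ (X : ℤ) ∧
      I m (σ.setReg r (e.eval σ)) ∧ e.eval (σ.setReg r (e.eval σ)) = e.eval σ)
    (hbody : ∀ m σ, I m σ → Bounded X σ → 0 < e.eval σ →
      Run B P T σ fun σ' => ∃ m' < m, I m' σ')
    (hend : ∀ m σ, I m σ → Bounded X σ → e.eval σ ≤ 0 → Q σ) (m : ℕ) (σ : State)
    (h0 : I m σ) :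
    Run B (RAM.whileExpr r e P) (e.cost + 2 + (m * (T + (e.cost + 2) + 1) + 1)) σ Q := by
  refine Run.seq (Run.assign hX hB hr he (hI _ _ h0).1 ?_)
  refine Run.whilePos hr (I := fun m σ => I m σ ∧ Bounded X σ ∧ σ.reg r = e.eval σ)
    (fun m σ h hp => ?_) (fun m σ h hp => hend m σ h.1 h.2.1 (by rw [← h.2.2]; exact hp)) m _ ?_
  · refine Run.seq ((hbody m σ h.1 h.2.1 (by rwa [← h.2.2])).mono le_rfl ?_)
    rintro σ' ⟨m', hm, h'⟩
    obtain ⟨h1, h2, h3, h4⟩ := hI _ _ h'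
    refine Run.assign hX hB hr he h1 ⟨m', hm, h3, h1.setReg _ h2, ?_⟩
    rw [h4]; simp [State.setReg]
  · obtain ⟨h1, h2, h3, h4⟩ := hI _ _ h0
    refine ⟨h3, h1.setReg _ h2, ?_⟩
    rw [h4]; simp [State.setReg]

/-! ### Filling an array, and searching -/

/-- For `y` from `lim - 1` down to `0`, kept in register `c`: cell `base + y` of bank `b` receives
the value of `e`. -/
def fill (c b : ℕ) (base lim e : Expr) : Prog :=
  .seq (assign c lim)
    (.whilePos c (.seq (assign c (.reg c - .const 1)) (put b (base + .reg c) e)))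

/-- The rule for `fill`.  Cells below `base + y` still hold their old values when cell `base + y` is
computed, so an array may be updated in place. -/
theorem Run.fill (hX : 100 ≤ X) (hB : X ^ 100 ≤ B) {c b : ℕ} (hc : c < 100)
    {base lim e : Expr} (hbase : (base.good && decide (base.size ≤ 99)) = true)
    (hlim : (lim.good && decide (lim.size ≤ 100)) = true)
    (he : (e.good && decide (e.size ≤ 100)) = true) {σ : State} (hb : Bounded X σ)
    {Q : State → Prop} (Y : ℕ) (hY : lim.eval σ = Y) (hYX : Y ≤ X) (z : ℤ)
    (hz : ∀ μ x, base.eval ⟨Function.update σ.reg c x, Function.update σ.mem b μ⟩ = z)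
    (f : ℕ → ℤ) (hfX : ∀ y < Y, |f y| ≤ (X : ℤ))
    (hf : ∀ y : ℕ, y < Y → ∀ μ : ℤ → ℤ, (∀ a ≤ z + y, μ a = σ.mem b a) →
      e.eval ⟨Function.update σ.reg c (y : ℤ), Function.update σ.mem b μ⟩ = f y)
    (hQ : ∀ μ : ℤ → ℤ, (∀ y : ℕ, y < Y → μ (z + y) = f y) →
      (∀ a, (∀ y : ℕ, y < Y → a ≠ z + y) → μ a = σ.mem b a) →
      Bounded X ⟨Function.update σ.reg c 0, Function.update σ.mem b μ⟩ →
      Q ⟨Function.update σ.reg c 0, Function.update σ.mem b μ⟩) :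
    Run B (RAM.fill c b base lim e)
      (lim.cost + 3 + Y * (base.cost + e.cost + 11)) σ Q := by
  have hT : lim.cost + 3 + Y * (base.cost + e.cost + 11) =
    (lim.cost + 2) + (Y * (((4 + 2) + ((base + .reg c).cost + e.cost + 1)) + 1) + 1) := by
    have : (base + .reg c).cost = base.cost + 3 := rfl
    rw [this]; ring
  rw [hT]
  refine Run.seq (Run.assign hX hB hc hlim hb ?_)
  rw [hY]
  let I : ℕ → State → Prop := fun m σ' => m ≤ Y ∧ ∃ μ : ℤ → ℤ,
    (∀ y : ℕ, m ≤ y → y < Y → μ (z + y) = f y) ∧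
    (∀ a, (∀ y : ℕ, m ≤ y → y < Y → a ≠ z + y) → μ a = σ.mem b a) ∧
    σ' = ⟨Function.update σ.reg c (m : ℤ), Function.update σ.mem b μ⟩ ∧ Bounded X σ'
  refine Run.whilePos hc (I := I) ?_ ?_ Y _ ?_
  · rintro m σ' ⟨hm, μ, h1, h2, rfl, hb'⟩ hp
    simp only [Function.update_self, Nat.cast_pos] at hp
    have hm1 : ((m : ℤ) - 1) = ((m - 1 : ℕ) : ℤ) := by push_cast [hp]; ring
    refine Run.seq (Run.assign hX hB hc (by simp [Expr.good, Expr.size, HSub.hSub, Sub.sub, hc])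
      hb' ?_)
    simp only [Expr.eval_sub, Expr.eval_reg, Expr.eval_const, Function.update_self, State.setReg,
      Function.update_idem, hm1]
    have hb2 : Bounded X ⟨Function.update σ.reg c ((m - 1 : ℕ) : ℤ), Function.update σ.mem b μ⟩ := by
      have := hb'.setReg c (x := ((m - 1 : ℕ) : ℤ)) (by
        rw [Nat.abs_cast]; exact_mod_cast (by omega : m - 1 ≤ X))
      simpa [State.setReg] using this
    have hev := hf (m - 1) (by omega) μ (fun a ha => h2 a fun y hy hy' => by push_cast [hp] at ha; omega)
    refine Run.put hX hB ?_ he hb2 ?_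
    · simp only [Bool.and_eq_true, decide_eq_true_eq] at hbase ⊢
      refine ⟨?_, ?_⟩
      · simp [Expr.good, hc, hbase.1]
      · have : (base + .reg c).size = base.size + 1 := rfl
        omega
    · rw [hev]
      simp only [Expr.eval_add, hz, Expr.eval_reg, Function.update_self]
      refine ⟨m - 1, by omega, by omega, Function.update μ (z + ((m - 1 : ℕ) : ℤ)) (f (m - 1)),
        ?_, ?_, ?_, ?_⟩
      · intro y hy hy'
        by_cases h : y = m - 1
        · subst h; simp
        · rw [Function.update_of_ne (by omega)]
          exact h1 y (by omega) hy'
      · intro a ha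
        rw [Function.update_of_ne (ha (m - 1) le_rfl (by omega))]
        exact h2 a fun y hy hy' => ha y (by omega) hy'
      · simp [State.setMem]
      · exact hb2.setMem _ _ (hfX _ (by omega))
  · rintro m σ' ⟨hm, μ, h1, h2, rfl, hb'⟩ hp
    simp only [Function.update_self] at hp
    obtain rfl : m = 0 := by omega
    exact hQ μ (fun y hy => h1 y (by omega) hy) (fun a ha => h2 a fun y _ hy => ha y hy) hb'
  · refine ⟨le_rfl, σ.mem b, fun y _ _ => by omega, fun _ _ => rfl, ?_, ?_⟩
    · simp [State.setReg]
    · exact hb.setReg c (by rw [Nat.abs_cast]; exact_mod_cast hYX)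

/-- Register `o` receives `y + 1` for some `y < lim` such that `e` is positive when register `c`
holds `y`, and `0` if there is none. -/
def search (c o : ℕ) (lim e : Expr) : Prog :=
  .seq (assign o (.const 0)) (.seq (assign c lim)
    (.whilePos c (.seq (assign c (.reg c - .const 1))
      (assign o (.cond e (.reg c + .const 1) (.reg o))))))

theorem Run.search (hX : 100 ≤ X) (hB : X ^ 100 ≤ B) {c o : ℕ} (hc : c < 100) (ho : o < 100)
    (hco : c ≠ o) {lim e : Expr}
    (hlim : (lim.good && decide (lim.size ≤ 100)) = true)
    (he : (e.good && decide (e.size ≤ 97)) = true) {σ : State} (hb : Bounded X σ)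
    {Q : State → Prop} (Y : ℕ) (hY : ∀ x, lim.eval (σ.setReg o x) = Y) (hYX : Y ≤ X)
    (f : ℕ → ℤ)
    (hf : ∀ (y : ℕ) (x : ℤ), y < Y → e.eval ((σ.setReg o x).setReg c (y : ℤ)) = f y)
    (hQ : ∀ x : ℕ, x ≤ Y → (x = 0 → ∀ y < Y, f y ≤ 0) → (0 < x → 0 < f (x - 1)) →
      Bounded X ((σ.setReg o x).setReg c 0) → Q ((σ.setReg o x).setReg c 0)) :
    Run B (RAM.search c o lim e) (lim.cost + 6 + Y * (e.cost + 20)) σ Q := by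
  have hT : lim.cost + 6 + Y * (e.cost + 20) ≥
    (1 + 2) + ((lim.cost + 2) +
      (Y * (((4 + 2) + ((Expr.cond e (.reg c + .const 1) (.reg o)).cost + 2)) + 1) + 1)) := by
    have : (Expr.cond e (.reg c + .const 1) (.reg o)).cost = e.cost + 4 + 2 + 1 := rfl
    rw [this]
    have : Y * (4 + 2 + (e.cost + 4 + 2 + 1 + 2) + 1) ≤ Y * (e.cost + 20) :=
      Nat.mul_le_mul_left _ (by omega)
    omega
  refine Run.mono ?_ hT (fun _ h => h)
  refine Run.seq (Run.assign hX hB ho (by decide) hb ?_)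
  have hb1 : Bounded X (σ.setReg o 0) := hb.setReg o (by simp)
  refine Run.seq (Run.assign hX hB hc hlim hb1 ?_)
  simp only [hY]
  let I : ℕ → State → Prop := fun m σ' => m ≤ Y ∧ ∃ x : ℕ, x ≤ Y ∧
    (x = 0 → ∀ y, m ≤ y → y < Y → f y ≤ 0) ∧ (0 < x → 0 < f (x - 1)) ∧
    σ' = (σ.setReg o x).setReg c (m : ℤ) ∧ Bounded X σ'
  refine Run.whilePos hc (I := I) ?_ ?_ Y _ ?_
  · rintro m σ' ⟨hm, x, hxY, h1, h2, rfl, hb'⟩ hp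
    simp only [State.setReg, Function.update_self, Nat.cast_pos] at hp
    have hm1 : ((m : ℤ) - 1) = ((m - 1 : ℕ) : ℤ) := by push_cast [hp]; ring
    refine Run.seq (Run.assign hX hB hc (by simp [Expr.good, Expr.size, HSub.hSub, Sub.sub, hc])
      hb' ?_)
    have hb2 := hb'.setReg c (x := ((m - 1 : ℕ) : ℤ)) (by
        rw [Nat.abs_cast]; exact_mod_cast (by omega : m - 1 ≤ X))
    have hst : ((σ.setReg o x).setReg c (m : ℤ)).setReg c ((m - 1 : ℕ) : ℤ) =
      (σ.setReg o x).setReg c ((m - 1 : ℕ) : ℤ) := by simp [State.setReg]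
    have hev : (Expr.reg c - Expr.const 1).eval ((σ.setReg o x).setReg c (m : ℤ)) =
        ((m - 1 : ℕ) : ℤ) := by
      simp only [Expr.eval_sub, Expr.eval_reg, Expr.eval_const, Function.update_self, State.setReg,
        hm1]
    rw [hev]
    rw [hst] at hb2 ⊢
    refine Run.assign hX hB ho ?_ hb2 ?_
    · simp only [Bool.and_eq_true, decide_eq_true_eq] at he ⊢
      refine ⟨by simp [Expr.good, hc, ho, he.1], ?_⟩
      have : (Expr.cond e (.reg c + .const 1) (.reg o)).size = e.size + (1 + 1) + 1 := rfl
      omega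
    · have hv := hf (m - 1) x (by omega)
      simp only [Expr.eval_cond, hv, Expr.eval_add, Expr.eval_reg, Expr.eval_const]
      have hro : ((σ.setReg o x).setReg c ((m - 1 : ℕ) : ℤ)).reg o = (x : ℤ) := by
        simp [State.setReg, hco.symm]
      have hrc : ((σ.setReg o x).setReg c ((m - 1 : ℕ) : ℤ)).reg c = ((m - 1 : ℕ) : ℤ) := by
        simp [State.setReg]
      rw [hro, hrc]
      have hcomm : ∀ w : ℤ, ((σ.setReg o x).setReg c ((m - 1 : ℕ) : ℤ)).setReg o w =
          (σ.setReg o w).setReg c ((m - 1 : ℕ) : ℤ) := by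
        intro w
        simp only [State.setReg]
        rw [Function.update_comm hco, Function.update_idem]
      split_ifs with hpos
      · have hmm : ((m - 1 : ℕ) : ℤ) + 1 = ((m : ℕ) : ℤ) := by push_cast [hp]; ring
        rw [hmm]
        refine ⟨m - 1, by omega, by omega, m, hm, by omega, fun _ => hpos, hcomm _, ?_⟩
        exact hb2.setReg _ (by rw [Nat.abs_cast]; exact_mod_cast (by omega : m ≤ X))
      · refine ⟨m - 1, by omega, by omega, x, hxY, ?_, h2, hcomm _, ?_⟩
        · intro hx y hy hy'
          by_cases h : y = m - 1
          · subst h; omega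
          · exact h1 hx y (by omega) hy'
        · exact hb2.setReg _ (by rw [Nat.abs_cast]; exact_mod_cast (by omega : x ≤ X))
  · rintro m σ' ⟨hm, x, hxY, h1, h2, rfl, hb'⟩ hp
    simp only [State.setReg, Function.update_self] at hp
    obtain rfl : m = 0 := by omega
    exact hQ x hxY (fun hx y hy => h1 hx y (by omega) hy) h2 (by simpa using hb')
  · refine ⟨le_rfl, 0, by omega, fun _ y _ _ => by omega, by omega, by simp, ?_⟩
    exact hb1.setReg c (by rw [Nat.abs_cast]; exact_mod_cast hYX)

end RAM

/-! ### Running a program as a subroutine on fresh memory -/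

namespace RAM

/-- A strict upper bound for the registers mentioned in a program. -/
def Prog.regBound : Prog → ℕ
  | .skip => 0
  | .const r _ => r + 1
  | .op _ r r₁ r₂ => r + r₁ + r₂ + 1
  | .load r _ a => r + a + 1
  | .store _ a r => r + a + 1
  | .seq P Q => P.regBound + Q.regBound
  | .ifPos r P Q => r + 1 + P.regBound + Q.regBound
  | .whilePos r P => r + 1 + P.regBound

/-- The program with register `r` renamed to `101 + r`, bank `b` renamed to `10 + b`, and all
addresses shifted by the content of register `9`; register `100` holds the shifted address. -/
def Prog.embed : Prog → Prog
  | .skip => .skip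
  | .const r x => .const (101 + r) x
  | .op o r r₁ r₂ => .op o (101 + r) (101 + r₁) (101 + r₂)
  | .load r b a => .seq (.op .add 100 9 (101 + a)) (.load (101 + r) (10 + b) 100)
  | .store b a r => .seq (.op .add 100 9 (101 + a)) (.store (10 + b) 100 (101 + r))
  | .seq P Q => .seq P.embed Q.embed
  | .ifPos r P Q => .ifPos (101 + r) P.embed Q.embed
  | .whilePos r P => .whilePos (101 + r) P.embed

/-- The configuration `σ` of the embedded program represents the configuration `s`, as far as the
registers below `m` and the addresses in `[-W, W]` are concerned. -/
structure Sim (m W : ℕ) (off : ℤ) (s σ : State) : Prop where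
  reg : ∀ r < m, σ.reg (101 + r) = s.reg r
  bound : ∀ r < m, |s.reg r| ≤ (W : ℤ)
  mem : ∀ b a, |a| ≤ (W : ℤ) → σ.mem (10 + b) (off + a) = s.mem b a
  off : σ.reg 9 = off

/-- What a run of an embedded program leaves alone: the visible registers, the banks below `10`, and
all addresses outside the window of radius `W` around `off`; it only writes words bounded by `B`. -/
structure Frame (B W : ℕ) (off : ℤ) (σ σ' : State) : Prop where
  reg : ∀ r < 100, σ'.reg r = σ.reg r
  low : ∀ b < 10, σ'.mem b = σ.mem b
  far : ∀ b a, (W : ℤ) < |a - off| → σ'.mem b a = σ.mem b a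
  small : ∀ b a, σ'.mem b a = σ.mem b a ∨ |σ'.mem b a| ≤ (B : ℤ)

theorem Frame.refl (B W : ℕ) (off : ℤ) (σ : State) : Frame B W off σ σ :=
  ⟨fun _ _ => rfl, fun _ _ => rfl, fun _ _ _ => rfl, fun _ _ => .inl rfl⟩

theorem Frame.trans {B W : ℕ} {off : ℤ} {σ τ ρ : State} (h : Frame B W off σ τ)
    (h' : Frame B W off τ ρ) : Frame B W off σ ρ where
  reg r hr := (h'.reg r hr).trans (h.reg r hr)
  low b hb := (h'.low b hb).trans (h.low b hb)
  far b a ha := (h'.far b a ha).trans (h.far b a ha)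
  small b a := by
    rcases h'.small b a with h1 | h1
    · rw [h1]; exact h.small b a
    · exact .inr h1

theorem Frame.setReg {B W : ℕ} {off : ℤ} {σ : State} {r : ℕ} (hr : 100 ≤ r) (x : ℤ) :
    Frame B W off σ (σ.setReg r x) where
  reg r' hr' := Function.update_of_ne (by omega) _ _
  low _ _ := rfl
  far _ _ _ := rfl
  small _ _ := .inl rfl

theorem Sim.setReg {m W : ℕ} {off : ℤ} {s σ : State} (h : Sim m W off s σ) (r : ℕ) {x : ℤ}
    (hx : |x| ≤ (W : ℤ)) : Sim m W off (s.setReg r x) (σ.setReg (101 + r) x) where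
  reg r' hr' := by
    by_cases hrr : r' = r
    · subst hrr; simp [State.setReg]
    · simpa [State.setReg, hrr] using h.reg r' hr'
  bound r' hr' := by
    by_cases hrr : r' = r
    · subst hrr; simpa [State.setReg] using hx
    · simpa [State.setReg, hrr] using h.bound r' hr'
  mem := h.mem
  off := (Function.update_of_ne (by omega) _ _).trans h.off

theorem Sim.setReg_addr {m W : ℕ} {off : ℤ} {s σ : State} (h : Sim m W off s σ) (x : ℤ) :
    Sim m W off s (σ.setReg 100 x) where
  reg r' hr' := (Function.update_of_ne (by omega) _ _).trans (h.reg r' hr')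
  bound := h.bound
  mem := h.mem
  off := by simpa [State.setReg] using h.off

/-- Every run of `P` is mirrored, with at most twice as many steps, by its embedded version. -/
theorem Exec.embed {B B' W m : ℕ} {off : ℤ} (hBW : B ≤ W) (hBB : B ≤ B')
    (hoff : ∀ x : ℤ, |x| ≤ (W : ℤ) → |off + x| ≤ (B' : ℤ)) {P : Prog} {s s' : State} {t : ℕ}
    (h : Exec B P s t s') (hm : P.regBound ≤ m) {σ : State} (hσ : Sim m W off s σ) :
    ∃ t' σ', Exec B' P.embed σ t' σ' ∧ t' ≤ 2 * t ∧ Sim m W off s' σ' ∧ Frame B W off σ σ' := by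
  have hW : ∀ {x : ℤ}, |x| ≤ (B : ℤ) → |x| ≤ (W : ℤ) := fun hx =>
    hx.trans (by exact_mod_cast hBW)
  have hB : ∀ {x : ℤ}, |x| ≤ (B : ℤ) → |x| ≤ (B' : ℤ) := fun hx =>
    hx.trans (by exact_mod_cast hBB)
  induction h generalizing σ with
  | skip s => exact ⟨1, σ, .skip σ, by omega, hσ, Frame.refl _ _ _ _⟩
  | const r x s hx =>
    exact ⟨1, _, .const _ x σ (hB hx), by omega, hσ.setReg r (hW hx), Frame.setReg (by omega) _⟩
  | op o r r₁ r₂ s hx =>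
    simp only [Prog.regBound] at hm
    have e1 := hσ.reg r₁ (by omega)
    have e2 := hσ.reg r₂ (by omega)
    have h1 : Exec B' (.op o (101 + r) (101 + r₁) (101 + r₂)) σ 1 _ :=
      .op o (101 + r) (101 + r₁) (101 + r₂) σ (by rw [e1, e2]; exact hB hx)
    rw [e1, e2] at h1
    exact ⟨1, _, h1, by omega, hσ.setReg r (hW hx), Frame.setReg (by omega) _⟩
  | load r b a s hx =>
    simp only [Prog.regBound] at hm
    have e1 := hσ.reg a (by omega)
    have hb := hσ.bound a (by omega)
    have h1 : Exec B' (.op .add 100 9 (101 + a)) σ 1 (σ.setReg 100 (off + s.reg a)) := by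
      have := Exec.op (B := B') .add 100 9 (101 + a) σ (by
        rw [e1, hσ.off]; exact hoff _ hb)
      rwa [e1, hσ.off] at this
    have hmem : (σ.setReg 100 (off + s.reg a)).mem (10 + b)
        ((σ.setReg 100 (off + s.reg a)).reg 100) = s.mem b (s.reg a) := by
      simpa [State.setReg] using hσ.mem b _ hb
    have h2 := Exec.load (B := B') (101 + r) (10 + b) 100 (σ.setReg 100 (off + s.reg a))
      (by rw [hmem]; exact hB hx)
    rw [hmem] at h2
    exact ⟨_, _, .seq h1 h2, by omega, (hσ.setReg_addr _).setReg r (hW hx),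
      (Frame.setReg le_rfl _).trans (Frame.setReg (by omega) _)⟩
  | store b a r s hx =>
    simp only [Prog.regBound] at hm
    have e1 := hσ.reg a (by omega)
    have e2 := hσ.reg r (by omega)
    have hb := hσ.bound a (by omega)
    have h1 : Exec B' (.op .add 100 9 (101 + a)) σ 1 (σ.setReg 100 (off + s.reg a)) := by
      have := Exec.op (B := B') .add 100 9 (101 + a) σ (by
        rw [e1, hσ.off]; exact hoff _ hb)
      rwa [e1, hσ.off] at this
    have hr : (σ.setReg 100 (off + s.reg a)).reg (101 + r) = s.reg r :=
      (Function.update_of_ne (by omega) _ _).trans e2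
    have h100 : (σ.setReg 100 (off + s.reg a)).reg 100 = off + s.reg a := by
      simp [State.setReg]
    have h2 := Exec.store (B := B') (10 + b) 100 (101 + r) (σ.setReg 100 (off + s.reg a))
      (by rw [hr]; exact hB hx)
    rw [hr, h100] at h2
    refine ⟨_, _, .seq h1 h2, by omega, ?_, (Frame.setReg le_rfl (off + s.reg a)).trans ?_⟩
    · have hs := hσ.setReg_addr (off + s.reg a)
      refine ⟨hs.reg, hs.bound, fun b' a' ha' => ?_, hs.off⟩
      have := hs.mem b' a' ha'
      simp only [State.setMem]
      by_cases hbb : b' = b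
      · subst hbb
        by_cases haa : a' = s.reg a
        · subst haa; simp
        · simpa [haa] using this
      · simpa [hbb] using this
    · refine ⟨fun _ _ => rfl, fun b' hb' => ?_, fun b' a' ha' => ?_, fun b' a' => ?_⟩
      · exact Function.update_of_ne (by omega) _ _
      · simp only [State.setMem]
        by_cases hbb : b' = 10 + b
        · subst hbb
          rw [Function.update_self, Function.update_of_ne]
          rintro rfl
          rw [add_sub_cancel_left] at ha'
          linarith
        · simp [hbb]
      · simp only [State.setMem]
        by_cases hbb : b' = 10 + b
        · subst hbb
          by_cases haa : a' = off + s.reg a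
          · subst haa; right; simpa using hx
          · left; simp [haa]
        · left; simp [hbb]
  | seq h₁ h₂ ih₁ ih₂ =>
    simp only [Prog.regBound] at hm
    obtain ⟨t1, σ1, a1, b1, c1, d1⟩ := ih₁ (by omega) hσ
    obtain ⟨t2, σ2, a2, b2, c2, d2⟩ := ih₂ (by omega) c1
    exact ⟨_, _, .seq a1 a2, by omega, c2, d1.trans d2⟩
  | ifPos_true hr h ih =>
    simp only [Prog.regBound] at hm
    obtain ⟨t1, σ1, a1, b1, c1, d1⟩ := ih (by omega) hσ
    exact ⟨_, _, .ifPos_true (by rwa [hσ.reg _ (by omega)]) a1, by omega, c1, d1⟩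
  | ifPos_false hr h ih =>
    simp only [Prog.regBound] at hm
    obtain ⟨t1, σ1, a1, b1, c1, d1⟩ := ih (by omega) hσ
    exact ⟨_, _, .ifPos_false (by rwa [hσ.reg _ (by omega)]) a1, by omega, c1, d1⟩
  | whilePos_true hr h₁ h₂ ih₁ ih₂ =>
    have hm' := hm
    simp only [Prog.regBound] at hm
    obtain ⟨t1, σ1, a1, b1, c1, d1⟩ := ih₁ (by omega) hσ
    obtain ⟨t2, σ2, a2, b2, c2, d2⟩ := ih₂ hm' c1
    exact ⟨_, _, .whilePos_true (by rwa [hσ.reg _ (by omega)]) a1 a2, by omega, c2, d1.trans d2⟩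
  | whilePos_false hr =>
    simp only [Prog.regBound] at hm
    exact ⟨1, σ, .whilePos_false (by rwa [hσ.reg _ (by omega)]), by omega, hσ, Frame.refl _ _ _ _⟩

/-- Set the registers `102, …, 101 + m` to `0`. -/
def zeroRegs : ℕ → Prog
  | 0 => .skip
  | m + 1 => .seq (zeroRegs m) (.const (102 + m) 0)

theorem exec_zeroRegs (B m : ℕ) (σ : State) : ∃ σ', Exec B (zeroRegs m) σ (m + 1) σ' ∧
    σ'.mem = σ.mem ∧ (∀ r < 102, σ'.reg r = σ.reg r) ∧ ∀ r < m, σ'.reg (102 + r) = 0 := by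
  induction m with
  | zero => exact ⟨σ, .skip σ, rfl, fun _ _ => rfl, fun _ h => by omega⟩
  | succ m ih =>
    obtain ⟨σ', h1, h2, h3, h4⟩ := ih
    refine ⟨_, .seq h1 (.const (102 + m) 0 σ' (by simp)), h2, fun r hr => ?_, fun r hr => ?_⟩
    · exact (Function.update_of_ne (by omega) _ _).trans (h3 r hr)
    · by_cases h : r = m
      · subst h; simp [State.setReg]
      · simpa [State.setReg, h] using h4 r (by omega)

/-- Call `P` on the graph with `e` vertices stored in banks `10` and `11` from the address in
register `9` on. -/
def call (e : Expr) (P : Prog) : Prog :=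
  .seq (e.comp 101) (.seq (zeroRegs P.regBound) P.embed)

/-- The rule for `call`: if the window of radius `W` around the address in register `9` holds the
input graph and is blank otherwise, then the call leaves there the final memory of `P`. -/
theorem Run.call {B X B₁ W : ℕ} (hX : 100 ≤ X) (hB : X ^ 100 ≤ B) {e : Expr} {P : Prog}
    (he : (e.good && decide (e.size ≤ 100)) = true) {σ : State} (hb : Bounded X σ)
    {q : ℕ} (hq : e.eval σ = q) (hqW : q ≤ W) (G : WDigraph (Fin q)) (hBW : B₁ ≤ W) (hBX : B₁ ≤ X)
    (hoff : ∀ x : ℤ, |x| ≤ (W : ℤ) → |σ.reg 9 + x| ≤ (X : ℤ))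
    (hmem : ∀ b a, |a| ≤ (W : ℤ) → σ.mem (10 + b) (σ.reg 9 + a) = (initState G).mem b a)
    {T : ℕ} {s' : State} (hP : ∃ t ≤ T, Exec B₁ P (initState G) t s') {Q : State → Prop}
    (hQ : ∀ μ : ℕ → ℤ → ℤ, (∀ b < 10, μ b = σ.mem b) →
      (∀ b a, |a| ≤ (W : ℤ) → μ (10 + b) (σ.reg 9 + a) = s'.mem b a) →
      (∀ b a, (W : ℤ) < |a - σ.reg 9| → μ b a = σ.mem b a) → Bounded X ⟨σ.reg, μ⟩ →
      Q ⟨σ.reg, μ⟩) :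
    Run B (RAM.call e P) (e.cost + P.regBound + 1 + 2 * T) σ Q := by
  simp only [Bool.and_eq_true, decide_eq_true_eq] at he
  obtain ⟨t, ht, hP⟩ := hP
  have hXB : X ≤ B := (Nat.le_self_pow (by norm_num) X).trans hB
  intro τ hτ
  obtain ⟨t1, τ1, e1, c1, m1, r1, v1⟩ := e.exec_comp hX he.1 101 (by omega) τ (hτ.bounded hb)
    ((Nat.pow_le_pow_right (by omega) he.2).trans hB)
  rw [Expr.eval_congr hτ e he.1, hq] at v1
  obtain ⟨τ2, e2, m2, r2, z2⟩ := exec_zeroRegs B P.regBound τ1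
  have hreg : ∀ r < 100, τ2.reg r = σ.reg r := fun r hr => by
    rw [r2 r (by omega), r1 r (by omega), hτ.1 r hr]
  have hmem2 : τ2.mem = σ.mem := m2.trans (m1.trans hτ.2)
  have hsim : Sim P.regBound W (σ.reg 9) (initState G) τ2 := by
    refine ⟨fun r hr => ?_, fun r hr => ?_, fun b a ha => ?_, hreg 9 (by omega)⟩
    · rcases Nat.eq_zero_or_pos r with rfl | h0
      · rw [r2 _ (by omega), v1]; simp [initState]
      · have := z2 (r - 1) (by omega)
        rw [show 102 + (r - 1) = 101 + r by omega] at this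
        rw [this]; simp [initState, h0.ne']
    · by_cases h0 : r = 0
      · simpa [initState, h0] using hqW
      · simp [initState, h0]
    · rw [hmem2]; exact hmem b a ha
  obtain ⟨t3, τ3, e3, c3, s3, f3⟩ := hP.embed hBW (hBX.trans hXB)
    (fun x hx => (hoff x hx).trans (by exact_mod_cast hXB)) le_rfl hsim
  refine ⟨_, τ3, ⟨σ.reg, τ3.mem⟩, .seq e1 (.seq e2 e3), by omega, ⟨fun r hr => ?_, rfl⟩, ?_⟩
  · exact (f3.reg r hr).trans (hreg r hr)
  · refine hQ τ3.mem (fun b hb => ?_) s3.mem (fun b a ha => ?_) ⟨hb.reg, fun b a => ?_⟩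
    · rw [f3.low b hb, hmem2]
    · rw [f3.far b a ha, hmem2]
    · rcases f3.small b a with h | h
      · rw [h, hmem2]; exact hb.mem b a
      · exact h.trans (by exact_mod_cast hBX)

end RAM

/-! ### Paths, and distances by repeated squaring -/

namespace WDigraph

variable {V : Type*} (G : WDigraph V)

variable {G} in
theorem IsPath.congr {p q : ℕ → V} {ℓ : ℕ} (h : G.IsPath p ℓ) (hpq : ∀ i ≤ ℓ, p i = q i) :
    G.IsPath q ℓ := fun i hi => by
  rw [← hpq i hi.le, ← hpq (i + 1) hi]; exact h i hi

theorem prefixWeight_congr {p q : ℕ → V} {ℓ : ℕ} (hpq : ∀ i ≤ ℓ, p i = q i) :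
    G.prefixWeight p ℓ = G.prefixWeight q ℓ :=
  Finset.sum_congr rfl fun i hi => by
    have := Finset.mem_range.1 hi
    rw [hpq i this.le, hpq (i + 1) this]

variable {G} in
theorem IsPath.take {p : ℕ → V} {ℓ : ℕ} (h : G.IsPath p ℓ) {a : ℕ} (ha : a ≤ ℓ) :
    G.IsPath p a := fun i hi => h i (by omega)

variable {G} in
theorem IsPath.drop {p : ℕ → V} {a b : ℕ} (h : G.IsPath p (a + b)) :
    G.IsPath (fun t => p (a + t)) b := fun i hi => h (a + i) (by omega)

theorem prefixWeight_add (p : ℕ → V) (a b : ℕ) :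
    G.prefixWeight p (a + b) = G.prefixWeight p a + G.prefixWeight (fun t => p (a + t)) b := by
  simp only [prefixWeight, Finset.sum_range_add]
  rfl

/-- The path `p` up to time `a`, then the path `q`. -/
def concat (p q : ℕ → V) (a : ℕ) : ℕ → V := fun t => if t < a then p t else q (t - a)

theorem concat_left {p q : ℕ → V} {a : ℕ} (h : p a = q 0) {i : ℕ} (hi : i ≤ a) :
    concat p q a i = p i := by
  rcases hi.lt_or_eq with hi | rfl
  · simp [concat, hi]
  · simp [concat, h]

theorem concat_right {p q : ℕ → V} {a : ℕ} (i : ℕ) : concat p q a (a + i) = q i := by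
  simp [concat]

variable {G} in
theorem IsPath.concat {p q : ℕ → V} {a b : ℕ} (hp : G.IsPath p a) (hq : G.IsPath q b)
    (h : p a = q 0) : G.IsPath (concat p q a) (a + b) := by
  intro i hi
  rcases lt_or_ge i a with h1 | h1
  · rw [concat_left h h1.le, concat_left h h1]; exact hp i h1
  · obtain ⟨j, rfl⟩ := Nat.exists_eq_add_of_le h1
    rw [add_assoc, concat_right, concat_right]; exact hq j (by omega)

theorem prefixWeight_concat {p q : ℕ → V} {a b : ℕ} (h : p a = q 0) :
    G.prefixWeight (concat p q a) (a + b) = G.prefixWeight p a + G.prefixWeight q b := by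
  rw [prefixWeight_add, G.prefixWeight_congr fun i hi => concat_left h hi]
  congr 1
  exact G.prefixWeight_congr fun i _ => concat_right i

variable {G} in
theorem abs_prefixWeight_le {M : ℕ} (hM : G.WeightsBoundedBy M) {p : ℕ → V} {ℓ : ℕ}
    (hp : G.IsPath p ℓ) : |G.prefixWeight p ℓ| ≤ (ℓ : ℤ) * M := by
  refine (Finset.abs_sum_le_sum_abs _ _).trans ?_
  have := Finset.sum_le_card_nsmul (Finset.range ℓ) (fun j => |G.weight (p j) (p (j + 1))|) (M : ℤ)
    fun i hi => hM _ _ (hp i (Finset.mem_range.1 hi))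
  simpa using this

/-- Without negative cycles, cutting out closed subpaths shortens every path to at most `n` edges
without increasing its weight. -/
theorem exists_short_path {n : ℕ} {G : WDigraph (Fin n)} (hG : G.NoNegativeCycle) (p : ℕ → Fin n)
    (ℓ : ℕ) (hp : G.IsPath p ℓ) : ∃ (q : ℕ → Fin n) (m : ℕ), m ≤ n ∧ q 0 = p 0 ∧ q m = p ℓ ∧
      G.IsPath q m ∧ G.prefixWeight q m ≤ G.prefixWeight p ℓ := by
  induction ℓ using Nat.strong_induction_on generalizing p with
  | _ ℓ ih =>
    rcases le_or_gt ℓ n with hl | hl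
    · exact ⟨p, ℓ, hl, rfl, rfl, hp, le_rfl⟩
    obtain ⟨i, j, hij, hjn, he⟩ : ∃ i j : ℕ, i < j ∧ j ≤ n ∧ p i = p j := by
      obtain ⟨x, y, hxy, he⟩ := Fintype.exists_ne_map_eq_of_card_lt
        (fun t : Fin (n + 1) => p t) (by simp)
      rcases lt_or_gt_of_ne hxy with h | h
      · exact ⟨x, y, h, by omega, he⟩
      · exact ⟨y, x, h, by omega, he.symm⟩
    obtain ⟨c, rfl⟩ := Nat.exists_eq_add_of_lt hij
    obtain ⟨d, rfl⟩ := Nat.exists_eq_add_of_le (hjn.trans hl.le)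
    have hadd : i + c + 1 = i + (c + 1) := rfl
    have hlink : p i = (fun t => p (i + c + 1 + t)) 0 := he
    have h1 : G.IsPath p i := hp.take (by omega)
    have h2 : G.IsPath (fun t => p (i + c + 1 + t)) d := hp.drop
    have h3 : G.IsPath (fun t => p (i + t)) (c + 1) :=
      IsPath.drop (hp.take (a := i + (c + 1)) (by omega))
    have h4 := hG _ _ h3 (by simpa [add_assoc] using he.symm)
    obtain ⟨q, m, hm, hq0, hqm, hq, hw⟩ := ih (i + d) (by omega) _ (h1.concat h2 hlink)
    refine ⟨q, m, hm, ?_, ?_, hq, hw.trans ?_⟩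
    · rw [hq0, concat_left hlink (by omega)]
    · rw [hqm, concat_right]
    · rw [G.prefixWeight_concat hlink, G.prefixWeight_add p (i + c + 1) d, hadd,
        G.prefixWeight_add p i (c + 1)]
      linarith

open scoped Classical in
/-- A graph on `Fin n` viewed as a graph on all natural numbers; the vertices from `n` on are
isolated. -/
noncomputable def pad {n : ℕ} (G : WDigraph (Fin n)) : WDigraph ℕ where
  Adj u v := ∃ (hu : u < n) (hv : v < n), G.Adj ⟨u, hu⟩ ⟨v, hv⟩
  weight u v := if h : u < n ∧ v < n then G.weight ⟨u, h.1⟩ ⟨v, h.2⟩ else 0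

section pad

variable {n : ℕ} {G : WDigraph (Fin n)}

theorem pad_adj (u v : Fin n) : G.pad.Adj u v ↔ G.Adj u v := by simp [pad]

theorem pad_weight (u v : Fin n) : G.pad.weight u v = G.weight u v := by simp [pad]

theorem isPath_pad {p : ℕ → Fin n} {ℓ : ℕ} : G.pad.IsPath (fun i => (p i : ℕ)) ℓ ↔ G.IsPath p ℓ := by
  simp [IsPath, pad_adj]

theorem prefixWeight_pad (p : ℕ → Fin n) (ℓ : ℕ) :
    G.pad.prefixWeight (fun i => (p i : ℕ)) ℓ = G.prefixWeight p ℓ := by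
  simp [prefixWeight, pad_weight]

theorem IsPath.exists_of_pad {q : ℕ → ℕ} {ℓ : ℕ} (h : G.pad.IsPath q ℓ) (h0 : q 0 < n) :
    ∃ p : ℕ → Fin n, (∀ i ≤ ℓ, q i = p i) ∧ G.IsPath p ℓ ∧
      G.pad.prefixWeight q ℓ = G.prefixWeight p ℓ := by
  have hlt : ∀ i ≤ ℓ, q i < n := by
    intro i hi
    rcases Nat.eq_zero_or_pos i with rfl | hi0
    · exact h0
    · obtain ⟨-, hv, -⟩ := h (i - 1) (by omega)
      rwa [Nat.sub_add_cancel hi0] at hv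
  let p : ℕ → Fin n := fun i => if hi : q i < n then ⟨q i, hi⟩ else ⟨q 0, h0⟩
  have hp : ∀ i ≤ ℓ, q i = p i := fun i hi => by simp [p, hlt i hi]
  exact ⟨p, hp, isPath_pad.1 (h.congr hp), by
    rw [G.pad.prefixWeight_congr hp, prefixWeight_pad]⟩

theorem NoNegativeCycle.pad (hG : G.NoNegativeCycle) : G.pad.NoNegativeCycle := by
  intro q ℓ hq hc
  rcases Nat.eq_zero_or_pos ℓ with rfl | h0
  · simp [prefixWeight]
  obtain ⟨h1, -, -⟩ := hq 0 h0
  obtain ⟨p, hp, hp', hw⟩ := hq.exists_of_pad h1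
  rw [hw]
  refine hG p ℓ hp' (Fin.ext ?_)
  rw [← hp ℓ le_rfl, ← hp 0 (by omega), hc]

theorem WeightsBoundedBy.pad {M : ℕ} (hM : G.WeightsBoundedBy M) : G.pad.WeightsBoundedBy M := by
  rintro u v ⟨hu, hv, h⟩
  simpa [WDigraph.pad, hu, hv] using hM _ _ h

theorem mem_pathWeights_pad {u v : Fin n} {x : ℤ} :
    x ∈ G.pad.pathWeights u v ↔ x ∈ G.pathWeights u v := by
  constructor
  · rintro ⟨q, ℓ, h0, hl, hq, rfl⟩
    obtain ⟨p, hp, hp', hw⟩ := hq.exists_of_pad (h0 ▸ u.2)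
    exact ⟨p, ℓ, Fin.ext ((hp 0 (by omega)).symm.trans h0),
      Fin.ext ((hp ℓ le_rfl).symm.trans hl), hp', hw.symm⟩
  · rintro ⟨p, ℓ, rfl, rfl, hp, rfl⟩
    exact ⟨fun i => p i, ℓ, rfl, rfl, isPath_pad.2 hp, prefixWeight_pad p ℓ⟩

end pad

/-- `D` approximates the distances in `H` between the vertices below `N`: its entries are at most
the weights of paths with at most `L` edges; and an entry is either the weight of some path or close
to `M`, the value that stands for infinity. -/
structure IsApproxDist (H : WDigraph ℕ) (W : ℕ) (M : ℤ) (N L : ℕ) (D : ℕ → ℕ → ℤ) : Prop where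
  attained : ∀ u < N, ∀ v < N, (D u v ∈ H.pathWeights u v ∧ |D u v| ≤ (L : ℤ) * W) ∨
    M - L * W ≤ D u v
  le_path : ∀ u < N, ∀ v < N, ∀ (p : ℕ → ℕ) (ℓ : ℕ), ℓ ≤ L → p 0 = u → p ℓ = v → H.IsPath p ℓ →
    D u v ≤ H.prefixWeight p ℓ
  le_max : ∀ u < N, ∀ v < N, D u v ≤ M

/-- `D'` is the (min,+) square of the `N × N` matrix `D`. -/
def IsMinPlusSq (N : ℕ) (D D' : ℕ → ℕ → ℤ) : Prop :=
  ∀ u < N, ∀ v < N, (∃ j < N, D' u v = D u j + D j v) ∧ ∀ j < N, D' u v ≤ D u j + D j v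

open scoped Classical in
/-- The initial distance matrix. -/
noncomputable def edgeDist (H : WDigraph ℕ) (M : ℤ) (u v : ℕ) : ℤ :=
  if u = v then 0 else if H.Adj u v then H.weight u v else M

theorem isApproxDist_edgeDist {H : WDigraph ℕ} (hH : H.NoNegativeCycle) {W : ℕ}
    (hW : H.WeightsBoundedBy W) {M : ℤ} (hM : (W : ℤ) ≤ M) (N : ℕ) :
    IsApproxDist H W M N 1 (H.edgeDist M) where
  attained u _ v _ := by
    unfold edgeDist
    split_ifs with h1 h2
    · subst h1
      exact .inl ⟨⟨fun _ => u, 0, rfl, rfl, fun i hi => by omega, by simp [prefixWeight]⟩, by simp⟩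
    · refine .inl ⟨⟨fun i => if i = 0 then u else v, 1, rfl, rfl, fun i hi => ?_, ?_⟩, ?_⟩
      · obtain rfl : i = 0 := by omega
        simpa using h2
      · simp [prefixWeight]
      · simpa using hW _ _ h2
    · right; simp
  le_path u _ v _ p ℓ hl h0 h1 hp := by
    unfold edgeDist
    split_ifs with h2 h3
    · exact hH p ℓ hp (by rw [h1, h0, h2])
    · obtain rfl : ℓ = 1 := by
        by_contra h
        obtain rfl : ℓ = 0 := by omega
        exact h2 (h0.symm.trans h1)
      simp [prefixWeight, h0, h1]
    · exfalso
      rcases Nat.lt_or_ge 0 ℓ with h | h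
      · obtain rfl : ℓ = 1 := by omega
        have := hp 0 (by omega)
        simp only [zero_add, h0, h1] at this
        exact h3 this
      · obtain rfl : ℓ = 0 := by omega
        exact h2 (h0.symm.trans h1)
  le_max u _ v _ := by
    unfold edgeDist
    split_ifs with h1 h2
    · exact le_trans (by positivity) hM
    · exact (le_abs_self _).trans ((hW _ _ h2).trans hM)
    · exact le_rfl

theorem IsApproxDist.abs_le {H : WDigraph ℕ} {W : ℕ} {M : ℤ} {N L : ℕ} {D : ℕ → ℕ → ℤ}
    (h : IsApproxDist H W M N L D) (hM : (L : ℤ) * W ≤ M) {u v : ℕ} (hu : u < N) (hv : v < N) :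
    |D u v| ≤ M := by
  have h1 := h.le_max u hu v hv
  rw [_root_.abs_le]
  rcases h.attained u hu v hv with ⟨-, h2⟩ | h2
  · rw [_root_.abs_le] at h2; constructor <;> linarith
  · have : (0 : ℤ) ≤ (L : ℤ) * W := by positivity
    constructor <;> linarith

/-- Squaring doubles the number of edges: a path is cut in the middle, and two paths are joined. -/
theorem IsApproxDist.sq {H : WDigraph ℕ} {W : ℕ} {M : ℤ} {N L : ℕ} {D D' : ℕ → ℕ → ℤ}
    (hN : ∀ u v, H.Adj u v → u < N ∧ v < N) (h : IsApproxDist H W M N L D)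
    (hM : 2 * ((L : ℤ) * W) ≤ M) (hD : IsMinPlusSq N D D') :
    IsApproxDist H W M N (2 * L) D' where
  attained u hu v hv := by
    obtain ⟨⟨j, hj, he⟩, -⟩ := hD u hu v hv
    have h0 : (0 : ℤ) ≤ (L : ℤ) * W := by positivity
    rw [he]
    push_cast
    rcases h.attained u hu j hj with ⟨⟨p, a, p0, p1, hp, pw⟩, h1⟩ | h1 <;>
      rcases h.attained j hj v hv with ⟨⟨q, b, q0, q1, hq, qw⟩, h2⟩ | h2
    · have hl : p a = q 0 := p1.trans q0.symm
      refine .inl ⟨⟨concat p q a, a + b, ?_, ?_, hp.concat hq hl, ?_⟩, ?_⟩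
      · rw [concat_left hl (by omega), p0]
      · rw [concat_right, q1]
      · rw [H.prefixWeight_concat hl, pw, qw]
      · exact (abs_add_le _ _).trans (by linarith)
    · right; rw [_root_.abs_le] at h1; linarith
    · right; rw [_root_.abs_le] at h2; linarith
    · right; linarith
  le_path u hu v hv p ℓ hl h0 h1 hp := by
    obtain ⟨-, hle⟩ := hD u hu v hv
    obtain ⟨a, b, rfl, ha, hb⟩ : ∃ a b, ℓ = a + b ∧ a ≤ L ∧ b ≤ L :=
      ⟨min ℓ L, ℓ - min ℓ L, by omega, by omega, by omega⟩
    have hj : p a < N := by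
      rcases Nat.eq_zero_or_pos a with rfl | ha0
      · rwa [h0]
      · have := (hN _ _ (hp (a - 1) (by omega))).2
        rwa [Nat.sub_add_cancel ha0] at this
    rw [H.prefixWeight_add]
    refine (hle _ hj).trans (add_le_add ?_ ?_)
    · exact h.le_path u hu _ hj p a ha h0 rfl (hp.take (by omega))
    · exact h.le_path _ hj v hv _ b hb rfl h1 hp.drop
  le_max u hu v hv := by
    obtain ⟨-, hle⟩ := hD u hu v hv
    have h1 := h.le_path v hv v hv (fun _ => v) 0 (by omega) rfl rfl (fun i hi => by omega)
    simp only [prefixWeight, Finset.range_zero, Finset.sum_empty] at h1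
    linarith [hle v hv, h.le_max u hu v hv]

/-- Once `L ≥ n`, the approximation is exact, and the entries for unreachable pairs are recognized
by their size. -/
theorem IsApproxDist.correct {n : ℕ} {G : WDigraph (Fin n)} (hG : G.NoNegativeCycle) {W : ℕ}
    (hW : G.WeightsBoundedBy W) {M : ℤ} {N L : ℕ} {D : ℕ → ℕ → ℤ}
    (h : IsApproxDist G.pad W M N L D) (hnL : n ≤ L) (hnN : n ≤ N) (hM : 2 * ((L : ℤ) * W) < M)
    (u v : Fin n) :
    (G.Reachable u v → 2 * D u v < M ∧ IsLeast (G.pathWeights u v) (D u v)) ∧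
      (¬ G.Reachable u v → M ≤ 2 * D u v) := by
  have hle : ∀ x ∈ G.pathWeights u v, D u v ≤ x := by
    rintro x ⟨p, ℓ, p0, p1, hp, rfl⟩
    obtain ⟨q, m, hm, q0, q1, hq, hw⟩ := exists_short_path hG p ℓ hp
    refine le_trans ?_ hw
    rw [← prefixWeight_pad]
    exact h.le_path u (by omega) v (by omega) _ m (by omega) (by simp [q0, p0]) (by simp [q1, p1])
      (isPath_pad.2 hq)
  have hatt := h.attained u (by omega) v (by omega)
  constructor
  · rintro ⟨p, ℓ, p0, p1, hp⟩
    obtain ⟨q, m, hm, q0, q1, hq, -⟩ := exists_short_path hG p ℓ hp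
    have h1 := hle _ ⟨q, m, q0.trans p0, q1.trans p1, hq, rfl⟩
    have h2 := (_root_.abs_le.1 (abs_prefixWeight_le hW hq)).2
    have h3 : (m : ℤ) * W ≤ (L : ℤ) * W :=
      mul_le_mul_of_nonneg_right (by exact_mod_cast hm.trans hnL) (by positivity)
    refine ⟨by linarith, ?_, hle⟩
    rcases hatt with ⟨h4, -⟩ | h4
    · exact mem_pathWeights_pad.1 h4
    · linarith
  · intro hr
    rcases hatt with ⟨h4, -⟩ | h4
    · obtain ⟨p, ℓ, p0, p1, hp, -⟩ := mem_pathWeights_pad.1 h4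
      exact absurd ⟨p, ℓ, p0, p1, hp⟩ hr
    · linarith

/-! ### The gadget graph -/

/-- The weights of the gadget graph.  Vertex `x * s + i` with `i < s` is vertex `i` of layer `x`;
the layers stand for the blocks `I`, `J`, `K`, `I` of indices. -/
def gadgetWeight (D U : ℕ → ℕ → ℤ) (M : ℤ) (s I J K u v : ℕ) : ℤ :=
  if u / s = 0 then M - D (I * s + u % s) (J * s + v % s)
  else if u / s = 1 then M - D (J * s + u % s) (K * s + v % s)
  else U (I * s + v % s) (K * s + u % s) - 1 - 2 * M

/-- The layered graph whose nonnegative prefix paths from the first to the last layer are the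
solutions of `D i j + D j k < U i k` in the given blocks of indices. -/
def gadget (D U : ℕ → ℕ → ℤ) (M : ℤ) (s I J K : ℕ) : WDigraph (Fin (4 * s)) where
  Adj u v := (v : ℕ) / s = u / s + 1
  weight u v := gadgetWeight D U M s I J K u v

theorem layer_div {s i : ℕ} (hi : i < s) (x : ℕ) : (x * s + i) / s = x := by
  rw [mul_comm, Nat.mul_add_div (by omega), Nat.div_eq_of_lt hi, add_zero]

theorem layer_mod {s i : ℕ} (hi : i < s) (x : ℕ) : (x * s + i) % s = i := by
  rw [mul_comm, Nat.mul_add_mod, Nat.mod_eq_of_lt hi]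

/-- Every edge leads to the next layer, so the path has exactly three edges; the summands `M` keep the
first two prefixes nonnegative, and the total weight is `U i k - 1 - D i j - D j k`. -/
theorem gadget_hasNonnegPrefixPath {D U : ℕ → ℕ → ℤ} {M : ℤ} {s I J K : ℕ}
    (h1 : ∀ i < s, ∀ j < s, |D (I * s + i) (J * s + j)| ≤ M)
    (h2 : ∀ j < s, ∀ k < s, |D (J * s + j) (K * s + k)| ≤ M) {i : ℕ} (hi : i < s) :
    (gadget D U M s I J K).HasNonnegPrefixPath ⟨i, by omega⟩ ⟨3 * s + i, by omega⟩ ↔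
      ∃ j < s, ∃ k < s, D (I * s + i) (J * s + j) + D (J * s + j) (K * s + k) <
        U (I * s + i) (K * s + k) := by
  have hs : 0 < s := by omega
  constructor
  · rintro ⟨p, ℓ, hl, p0, p1, hp, hw⟩
    have hlay : ∀ t ≤ ℓ, (p t : ℕ) / s = t := by
      intro t
      induction t with
      | zero => intro _; rw [p0]; exact Nat.div_eq_of_lt hi
      | succ t ih => intro ht; rw [hp t ht, ih (by omega)]
    have hl3 : ℓ = 3 := by
      rw [← hlay ℓ le_rfl, p1]; exact layer_div hi 3
    subst hl3
    have hw3 := hw 3 (by norm_num) le_rfl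
    simp only [prefixWeight, Finset.sum_range_succ, Finset.range_zero, Finset.sum_empty, gadget,
      gadgetWeight, hlay 1 (by norm_num), hlay 2 (by norm_num), p0, p1] at hw3
    norm_num [-Nat.div_eq_zero_iff, Nat.div_eq_of_lt hi, Nat.mod_eq_of_lt hi] at hw3
    exact ⟨_, Nat.mod_lt _ hs, _, Nat.mod_lt _ hs, by linarith⟩
  · rintro ⟨j, hj, k, hk, hlt⟩
    have e0 : i / s = 0 := Nat.div_eq_of_lt hi
    have e1 : (s + j) / s = 1 := by simpa using layer_div hj 1
    have e2 : (2 * s + k) / s = 2 := layer_div hk 2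
    have e3 : (3 * s + i) / s = 3 := layer_div hi 3
    have m0 : i % s = i := Nat.mod_eq_of_lt hi
    have m1 : (s + j) % s = j := by simpa using layer_mod hj 1
    have m2 : (2 * s + k) % s = k := layer_mod hk 2
    have m3 : (3 * s + i) % s = i := layer_mod hi 3
    refine ⟨fun t => if t = 0 then ⟨i, by omega⟩ else if t = 1 then ⟨s + j, by omega⟩ else
      if t = 2 then ⟨2 * s + k, by omega⟩ else ⟨3 * s + i, by omega⟩, 3, by norm_num, rfl, rfl,
      ?_, ?_⟩
    · intro t ht
      interval_cases t <;> simp [gadget, e0, e1, e2, e3]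
    · have a1 := (_root_.abs_le.1 (h1 i hi j hj)).2
      have a2 := (_root_.abs_le.1 (h2 j hj k hk)).2
      intro t ht ht'
      interval_cases t <;>
        simp [-Nat.div_eq_zero_iff, prefixWeight, Finset.sum_range_succ, gadget, gadgetWeight, e0, e1, e2, m0, m1,
          m2, m3] <;> linarith

end WDigraph

/-! ### One call of the oracle -/

namespace RAM

open WDigraph

/-- The data of the reduction: `n` vertices, padded to `N = s ^ 3`; `M` stands for infinity; the
oracle `P` runs within `[-B₁, B₁]` and time `Tc` on gadget graphs; `W` is the radius of the window
of addresses that a call may use; `X` bounds all visible words, `B` all words. -/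
structure Ctx where
  (n s M W X B B₁ Tc offMax : ℕ)
  P : Prog
  two_le_s : 2 ≤ s
  n_le : n ≤ s * s * s
  X_large : 100 ≤ X
  X_pow : X ^ 100 ≤ B
  sq_le_X : (s * s * s) * (s * s * s) ≤ X
  M_le_X : 20 * M ≤ X
  M_pos : 1 ≤ M
  off_le_X : offMax + 2 * W + 1 ≤ X
  le_W : 16 * (s * s) ≤ W
  B₁_le : B₁ ≤ W
  oracle : ∀ G : WDigraph (Fin (4 * s)), G.WeightsBoundedBy (20 * M) →
    ∃ t ≤ Tc, ∃ s', Exec B₁ P (initState G) t s' ∧ APNP.Correct G s'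

/-- The number of vertices after padding. -/
def Ctx.N (C : Ctx) : ℕ := C.s * C.s * C.s

/-- The part of the invariant that concerns the constants, and the memory still to be used by calls
of the oracle. -/
structure Base (C : Ctx) (σ : State) : Prop where
  r0 : σ.reg 0 = (C.n : ℤ)
  r1 : σ.reg 1 = (C.s : ℤ)
  r2 : σ.reg 2 = (C.N : ℤ)
  r3 : σ.reg 3 = ((C.N * C.N : ℕ) : ℤ)
  r4 : σ.reg 4 = (C.M : ℤ)
  r5 : σ.reg 5 = ((2 * C.W + 1 : ℕ) : ℤ)
  off_nonneg : 0 ≤ σ.reg 9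
  bounded : Bounded C.X σ
  fresh : ∀ b a, σ.reg 9 - C.W ≤ a → σ.mem (10 + b) a = 0

theorem Base.congr {C : Ctx} {σ σ' : State} (h : Base C σ) (hr : ∀ r < 6, σ'.reg r = σ.reg r)
    (h9 : σ'.reg 9 = σ.reg 9) (hb : Bounded C.X σ') (hm : ∀ b, σ'.mem (10 + b) = σ.mem (10 + b)) :
    Base C σ' where
  r0 := (hr 0 (by norm_num)).trans h.r0
  r1 := (hr 1 (by norm_num)).trans h.r1
  r2 := (hr 2 (by norm_num)).trans h.r2
  r3 := (hr 3 (by norm_num)).trans h.r3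
  r4 := (hr 4 (by norm_num)).trans h.r4
  r5 := (hr 5 (by norm_num)).trans h.r5
  off_nonneg := h9 ▸ h.off_nonneg
  bounded := hb
  fresh b a ha := by rw [hm]; exact h.fresh b a (h9 ▸ ha)

/-- The array `μ` holds the `N × N` matrix `D`. -/
def Mat (N : ℕ) (μ : ℤ → ℤ) (D : ℕ → ℕ → ℤ) : Prop :=
  ∀ u < N, ∀ v < N, μ ((u * N + v : ℕ) : ℤ) = D u v

theorem index_lt {N u v : ℕ} (hu : u < N) (hv : v < N) : u * N + v < N * N := by
  have : (u + 1) * N ≤ N * N := Nat.mul_le_mul_right _ hu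
  rw [add_mul] at this
  omega

theorem mat_of_forall {N : ℕ} {μ : ℤ → ℤ} {D : ℕ → ℕ → ℤ}
    (h : ∀ y : ℕ, y < N * N → μ (y : ℤ) = D (y / N) (y % N)) : Mat N μ D := fun u hu v hv => by
  rw [h _ (index_lt hu hv), layer_div hv, layer_mod hv]

theorem initState_mem_of_lt {q : ℕ} (G : WDigraph (Fin q)) (b : ℕ) {y : ℕ} (hy : y < q * q) :
    ∃ (hu : y / q < q) (hv : y % q < q), (initState G).mem b y =
      (initState G).mem b (((⟨y / q, hu⟩ : Fin q) : ℤ) * q + (⟨y % q, hv⟩ : Fin q)) := by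
  have hq : 0 < q := Nat.pos_of_ne_zero fun h => by simp [h] at hy
  refine ⟨Nat.div_lt_of_lt_mul hy, Nat.mod_lt _ hq, ?_⟩
  congr 1
  have := Nat.div_add_mod y q
  rw [mul_comm] at this
  exact_mod_cast this.symm

theorem initState_mem_eq_zero {q : ℕ} (G : WDigraph (Fin q)) (b : ℕ) {a : ℤ}
    (ha : ∀ y : ℕ, y < q * q → a ≠ y) : (initState G).mem b a = 0 := by
  simp only [initState]
  refine Finset.sum_eq_zero fun u _ => Finset.sum_eq_zero fun v _ => if_neg fun h => ?_
  refine ha (u * q + v) (index_lt u.2 v.2) ?_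
  rw [h.1]; push_cast; rfl

theorem initState_mem_high {q : ℕ} (G : WDigraph (Fin q)) {b : ℕ} (hb : 2 ≤ b) (a : ℤ) :
    (initState G).mem b a = 0 := by
  simp only [initState]
  refine Finset.sum_eq_zero fun u _ => Finset.sum_eq_zero fun v _ => ?_
  rw [if_neg (by omega : b ≠ 0), if_neg (by omega : b ≠ 1), ite_self]

/-- The first block of the block triple with number `b < s ^ 6`; there are `s ^ 2` blocks of `s`
indices each, and a triple of blocks is coded in base `s ^ 2`. -/
def blockI (s b : ℕ) : ℕ := b / (s * s * s * s)
/-- The second block of the block triple with number `b`. -/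
def blockJ (s b : ℕ) : ℕ := b / (s * s) % (s * s)
/-- The third block of the block triple with number `b`. -/
def blockK (s b : ℕ) : ℕ := b % (s * s)

theorem block_lt {s b : ℕ} (hs : 0 < s) (hb : b < (s * s * s) * (s * s * s)) :
    blockI s b < s * s ∧ blockJ s b < s * s ∧ blockK s b < s * s := by
  refine ⟨Nat.div_lt_of_lt_mul ?_, Nat.mod_lt _ (by positivity), Nat.mod_lt _ (by positivity)⟩
  calc b < _ := hb
    _ = _ := by ring

theorem exists_block {s x y z : ℕ} (hx : x < s * s * s) (hy : y < s * s * s)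
    (hz : z < s * s * s) : ∃ b < (s * s * s) * (s * s * s),
      x = blockI s b * s + x % s ∧ y = blockJ s b * s + y % s ∧ z = blockK s b * s + z % s := by
  have hs : 0 < s := Nat.pos_of_ne_zero fun h => by simp [h] at hx
  have hd : ∀ w, w < s * s * s → w / s < s * s := fun w hw =>
    Nat.div_lt_of_lt_mul (by rwa [mul_comm])
  have h1 := index_lt (hd _ hy) (hd _ hz)
  have h2 := index_lt (hd _ hx) (hd _ hx)
  refine ⟨(x / s) * (s * s * s * s) + ((y / s) * (s * s) + z / s), ?_, ?_, ?_, ?_⟩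
  · have : (x / s + 1) * (s * s * s * s) ≤ (s * s) * (s * s * s * s) :=
      Nat.mul_le_mul_right _ (hd _ hx)
    nlinarith
  · have : blockI s ((x / s) * (s * s * s * s) + ((y / s) * (s * s) + z / s)) = x / s :=
      layer_div (by linarith) _
    rw [this, mul_comm]; exact (Nat.div_add_mod x s).symm
  · have : blockJ s ((x / s) * (s * s * s * s) + ((y / s) * (s * s) + z / s)) = y / s := by
      unfold blockJ
      rw [show (x / s) * (s * s * s * s) + ((y / s) * (s * s) + z / s) =
        ((x / s) * (s * s) + y / s) * (s * s) + z / s by ring, layer_div (hd _ hz),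
        layer_mod (hd _ hy)]
    rw [this, mul_comm]; exact (Nat.div_add_mod y s).symm
  · have : blockK s ((x / s) * (s * s * s * s) + ((y / s) * (s * s) + z / s)) = z / s := by
      unfold blockK
      rw [show (x / s) * (s * s * s * s) + ((y / s) * (s * s) + z / s) =
        ((x / s) * (s * s) + y / s) * (s * s) + z / s by ring, layer_mod (hd _ hz)]
    rw [this, mul_comm]; exact (Nat.div_add_mod z s).symm

theorem inBlock_lt {s I i : ℕ} (hI : I < s * s) (hi : i < s) : I * s + i < s * s * s := by
  have : (I + 1) * s ≤ s * s * s := Nat.mul_le_mul_right _ hI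
  rw [add_mul] at this
  omega

open RAM.Expr in
/-- The first block of the block triple whose number is in register `8`. -/
def eI : Expr := reg 8 / (reg 1 * reg 1 * reg 1 * reg 1)
open RAM.Expr in
/-- The second block of the block triple whose number is in register `8`. -/
def eJ : Expr := reg 8 / (reg 1 * reg 1) % (reg 1 * reg 1)
open RAM.Expr in
/-- The third block of the block triple whose number is in register `8`. -/
def eK : Expr := reg 8 % (reg 1 * reg 1)

/-- The address of entry `(U * s + i, V * s + j)` of an `N × N` matrix. -/
def entryAddr (U i V j : Expr) : Expr := (U * .reg 1 + i) * .reg 2 + (V * .reg 1 + j)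

/-- The vertex of the gadget graph in whose row of the matrix the cell in register `10` lies. -/
def eRow : Expr := .reg 10 / (.const 4 * .reg 1)
/-- The vertex of the gadget graph in whose column of the matrix the cell in register `10` lies. -/
def eCol : Expr := .reg 10 % (.const 4 * .reg 1)

/-- Adjacency in the gadget graph; `1 - d * d` is positive exactly when `d = 0`. -/
def eAdj (a b : Expr) : Expr :=
  .cond (.const 1 - (eCol / .reg 1 - eRow / .reg 1 - .const 1) *
    (eCol / .reg 1 - eRow / .reg 1 - .const 1)) a b

/-- Weights in the gadget graph. -/
def eWeight : Expr :=
  .cond (.const 1 - eRow / .reg 1)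
    (.reg 4 - .ld 4 (entryAddr eI (eRow % .reg 1) eJ (eCol % .reg 1)))
    (.cond (.const 2 - eRow / .reg 1)
      (.reg 4 - .ld 4 (entryAddr eJ (eRow % .reg 1) eK (eCol % .reg 1)))
      (.ld 6 (entryAddr eI (eCol % .reg 1) eK (eRow % .reg 1)) - .const 1 - .const 2 * .reg 4))

theorem one_sub_sq_pos (d : ℤ) : 0 < 1 - d * d ↔ d = 0 := by
  constructor
  · intro h
    by_contra hd
    have := Int.one_le_abs hd
    nlinarith [abs_mul_abs_self d]
  · rintro rfl; norm_num

/-- Write down the gadget graph and call the oracle. -/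
def oracleCall (P : Prog) : Prog :=
  .seq (fill 10 10 (.reg 9) (.const 16 * (.reg 1 * .reg 1)) (eAdj (.const 1) (.const 0)))
    (.seq (fill 10 11 (.reg 9) (.const 16 * (.reg 1 * .reg 1)) (eAdj eWeight (.const 0)))
      (call (.const 4 * .reg 1) P))

section

variable {C : Ctx}

theorem gadgetWeight_bound {D U : ℕ → ℕ → ℤ} {b u v : ℕ}
    (hD : ∀ u < C.N, ∀ v < C.N, |D u v| ≤ (C.M : ℤ))
    (hU : ∀ u < C.N, ∀ v < C.N, |U u v| ≤ 7 * (C.M : ℤ))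
    (hb : b < C.N * C.N) : |gadgetWeight D U C.M C.s (blockI C.s b) (blockJ C.s b)
      (blockK C.s b) u v| ≤ 20 * (C.M : ℤ) := by
  have hs : 0 < C.s := by linarith [C.two_le_s]
  obtain ⟨hI, hJ, hK⟩ := block_lt hs hb
  have hM := C.M_pos
  have hM' : (1 : ℤ) ≤ C.M := by exact_mod_cast hM
  have h1 := hD _ (inBlock_lt hI (Nat.mod_lt u hs)) _ (inBlock_lt hJ (Nat.mod_lt v hs))
  have h2 := hD _ (inBlock_lt hJ (Nat.mod_lt u hs)) _ (inBlock_lt hK (Nat.mod_lt v hs))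
  have h3 := hU _ (inBlock_lt hI (Nat.mod_lt v hs)) _ (inBlock_lt hK (Nat.mod_lt u hs))
  rw [abs_le] at h1 h2 h3 ⊢
  unfold gadgetWeight
  split_ifs <;> constructor <;> linarith

/-- Bank `12` receives, in the cells for the pairs formed by vertex `i` of the first and of the last
layer, whether some pair `(i, k)` of the block triple is violated; the memory beyond the window
remains untouched. -/
theorem run_oracleCall {σ : State} (hσ : Base C σ) {D U : ℕ → ℕ → ℤ} (hD : Mat C.N (σ.mem 4) D)
    (hU : Mat C.N (σ.mem 6) U) (hDM : ∀ u < C.N, ∀ v < C.N, |D u v| ≤ (C.M : ℤ))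
    (hUM : ∀ u < C.N, ∀ v < C.N, |U u v| ≤ 7 * (C.M : ℤ)) {b : ℕ} (hb : b < C.N * C.N)
    (h8 : σ.reg 8 = (b : ℤ)) (hoff : σ.reg 9 ≤ C.offMax) {Q : State → Prop}
    (hQ : ∀ μ : ℕ → ℤ → ℤ, (∀ b < 10, μ b = σ.mem b) →
      (∀ i : ℕ, i < C.s → (0 < μ 12 (σ.reg 9 + (i * (4 * C.s) + (3 * C.s + i))) ↔
        ∃ j < C.s, ∃ k < C.s, D (blockI C.s b * C.s + i) (blockJ C.s b * C.s + j) +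
          D (blockJ C.s b * C.s + j) (blockK C.s b * C.s + k) <
          U (blockI C.s b * C.s + i) (blockK C.s b * C.s + k))) →
      (∀ b a, σ.reg 9 + C.W < a → μ (10 + b) a = 0) →
      Bounded C.X ⟨Function.update σ.reg 10 0, μ⟩ →
      Q ⟨Function.update σ.reg 10 0, μ⟩) :
    Run C.B (oracleCall C.P) (2 * C.Tc + C.P.regBound + 100000 * (C.s * C.s)) σ Q := by
  have hs2 := C.two_le_s
  have hs : 0 < C.s := by linarith
  obtain ⟨hI, hJ, hK⟩ := block_lt hs hb
  have hlW := C.le_W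
  have hoX := C.off_le_X
  have hMX := C.M_le_X
  have hss : 4 * C.s * (4 * C.s) = 16 * (C.s * C.s) := by ring
  set G := gadget D U C.M C.s (blockI C.s b) (blockJ C.s b) (blockK C.s b) with hG
  have hadj : ∀ y : ℕ, 0 < 1 - ((y : ℤ) % (4 * C.s) / C.s - (y : ℤ) / (4 * C.s) / C.s - 1) *
      ((y : ℤ) % (4 * C.s) / C.s - (y : ℤ) / (4 * C.s) / C.s - 1) ↔
      (y % (4 * C.s)) / C.s = (y / (4 * C.s)) / C.s + 1 := by
    intro y
    rw [one_sub_sq_pos]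
    have h1 : (y : ℤ) % (4 * C.s) / C.s = ((y % (4 * C.s) / C.s : ℕ) : ℤ) := by push_cast; rfl
    have h2 : (y : ℤ) / (4 * C.s) / C.s = ((y / (4 * C.s) / C.s : ℕ) : ℤ) := by push_cast; rfl
    rw [h1, h2]
    omega
  have hT : 2 * C.Tc + C.P.regBound + 100000 * (C.s * C.s) ≥
      ((Expr.const 16 * (.reg 1 * .reg 1)).cost + 3 + (16 * (C.s * C.s)) *
        ((Expr.reg 9).cost + (eAdj (.const 1) (.const 0)).cost + 11)) +
      (((Expr.const 16 * (.reg 1 * .reg 1)).cost + 3 + (16 * (C.s * C.s)) *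
        ((Expr.reg 9).cost + (eAdj eWeight (.const 0)).cost + 11)) +
      ((Expr.const 4 * .reg 1).cost + C.P.regBound + 1 + 2 * C.Tc)) := by
    have e1 : (Expr.const 16 * (.reg 1 * .reg 1)).cost ≤ 10 := by decide
    have e2 : (Expr.reg 9).cost + (eAdj (.const 1) (.const 0)).cost ≤ 1000 := by decide
    have e3 : (Expr.reg 9).cost + (eAdj eWeight (.const 0)).cost ≤ 1000 := by decide
    have e4 : (Expr.const 4 * .reg 1).cost ≤ 10 := by decide
    have h1 : 1 ≤ C.s * C.s := Nat.mul_pos hs hs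
    have := Nat.mul_le_mul_left (16 * (C.s * C.s)) e2
    have := Nat.mul_le_mul_left (16 * (C.s * C.s)) e3
    linarith
  refine Run.mono ?_ hT fun _ h => h
  have hYX : 16 * (C.s * C.s) ≤ C.X := by omega
  refine Run.seq (Run.fill C.X_large C.X_pow (by norm_num) (by decide) (by decide) (by decide)
    hσ.bounded (16 * (C.s * C.s)) (by simp [hσ.r1]) hYX (σ.reg 9) (by intro μ x; simp)
    (fun y => if (y % (4 * C.s)) / C.s = (y / (4 * C.s)) / C.s + 1 then 1 else 0) ?_ ?_ ?_)
  · intro y _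
    have : (1 : ℤ) ≤ C.X := by exact_mod_cast (by linarith [C.X_large] : 1 ≤ C.X)
    split_ifs <;> simp [this]
  · intro y hy μ _
    simp only [eAdj, eRow, eCol, Expr.eval_cond, Expr.eval_sub, Expr.eval_mul, Expr.eval_div,
      Expr.eval_mod, Expr.eval_const, Expr.eval_reg, Function.update_self, ne_eq,
      OfNat.one_ne_ofNat, not_false_eq_true, Function.update_of_ne, hσ.r1, hadj]
  intro μ₁ hμ₁ hμ₁' hb₁
  refine Run.seq (Run.fill C.X_large C.X_pow (by norm_num) (by decide) (by decide) (by decide)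
    hb₁ (16 * (C.s * C.s)) (by simp [hσ.r1]) hYX (σ.reg 9) (by intro μ x; simp)
    (fun y => if (y % (4 * C.s)) / C.s = (y / (4 * C.s)) / C.s + 1 then
      gadgetWeight D U C.M C.s (blockI C.s b) (blockJ C.s b) (blockK C.s b)
        (y / (4 * C.s)) (y % (4 * C.s)) else 0) ?_ ?_ ?_)
  · intro y _
    split_ifs
    · exact (gadgetWeight_bound hDM hUM hb).trans (by exact_mod_cast hMX)
    · simp
  · intro y hy μ _
    have m1 := hD _ (inBlock_lt hI (Nat.mod_lt (y / (4 * C.s)) hs)) _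
      (inBlock_lt hJ (Nat.mod_lt (y % (4 * C.s)) hs))
    have m2 := hD _ (inBlock_lt hJ (Nat.mod_lt (y / (4 * C.s)) hs)) _
      (inBlock_lt hK (Nat.mod_lt (y % (4 * C.s)) hs))
    have m3 := hU _ (inBlock_lt hI (Nat.mod_lt (y % (4 * C.s)) hs)) _
      (inBlock_lt hK (Nat.mod_lt (y / (4 * C.s)) hs))
    have c0 : 0 < 1 - (y : ℤ) / (4 * C.s) / C.s ↔ y / (4 * C.s) / C.s = 0 := by
      have h2 : (y : ℤ) / (4 * C.s) / C.s = ((y / (4 * C.s) / C.s : ℕ) : ℤ) := by push_cast; rfl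
      rw [h2]; generalize y / (4 * C.s) / C.s = w; omega
    have c1 : 0 < 2 - (y : ℤ) / (4 * C.s) / C.s ↔ y / (4 * C.s) / C.s ≤ 1 := by
      have h2 : (y : ℤ) / (4 * C.s) / C.s = ((y / (4 * C.s) / C.s : ℕ) : ℤ) := by push_cast; rfl
      rw [h2]; generalize y / (4 * C.s) / C.s = w; omega
    simp only [blockI, blockJ, blockK] at m1 m2 m3 ⊢
    push_cast at m1 m2 m3
    simp only [eAdj, eRow, eCol, eWeight, entryAddr, eI, eJ, eK, Expr.eval_cond, Expr.eval_sub,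
      Expr.eval_mul, Expr.eval_div, Expr.eval_mod, Expr.eval_const, Expr.eval_reg, Expr.eval_add,
      Expr.eval_ld, Function.update_self, ne_eq, Nat.reduceEqDiff, 
      not_false_eq_true, Function.update_of_ne, Function.update_idem, hσ.r1, hσ.r2, hσ.r4, h8,
      hadj, c0, c1, m1, m2, m3, gadgetWeight]
    generalize y / (4 * C.s) / C.s = w
    split_ifs <;> first | rfl | omega
  intro μ₂ hμ₂ hμ₂' hb₂
  have hμ₂' : ∀ a, (∀ y : ℕ, y < 16 * (C.s * C.s) → a ≠ σ.reg 9 + y) → μ₂ a = σ.mem 11 a :=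
    fun a ha => (hμ₂' a (by simpa using ha)).trans (by simp)
  have hW0 : ∀ a : ℤ, |a| ≤ (C.W : ℤ) → σ.reg 9 - C.W ≤ σ.reg 9 + a := fun a ha => by
    linarith [(abs_le.1 ha).1]
  have hGw : G.WeightsBoundedBy (20 * C.M) := by
    intro u v _
    exact_mod_cast gadgetWeight_bound hDM hUM hb
  obtain ⟨t, ht, s', hex, hcor⟩ := C.oracle G hGw
  refine Run.call C.X_large C.X_pow (by decide) hb₂ (q := 4 * C.s) (by simp [hσ.r1])
    (W := C.W) (by nlinarith) G C.B₁_le (by linarith [C.B₁_le]) ?_ ?_ ⟨t, ht, hex⟩ ?_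
  · intro x hx
    have h0 := hσ.off_nonneg
    have hoX' : (C.offMax : ℤ) + 2 * C.W + 1 ≤ C.X := by exact_mod_cast hoX
    rw [abs_le] at hx ⊢
    simp
    constructor <;> linarith
  · intro k a ha
    have hf := hσ.fresh k _ (hW0 a ha)
    rcases Nat.lt_or_ge k 2 with hk | hk
    · by_cases hy : ∃ y : ℕ, y < 4 * C.s * (4 * C.s) ∧ a = y
      · obtain ⟨y, hy, rfl⟩ := hy
        obtain ⟨hu, hv, he⟩ := initState_mem_of_lt G k hy
        rw [he, initState_mem]
        rw [hss] at hy
        have hA : G.Adj ⟨y / (4 * C.s), hu⟩ ⟨y % (4 * C.s), hv⟩ ↔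
          (y % (4 * C.s)) / C.s = (y / (4 * C.s)) / C.s + 1 := Iff.rfl
        interval_cases k
        · simp [hμ₁ y hy, hA]
        · simp only [Nat.reduceAdd, Function.update_self, ne_eq, Nat.reduceEqDiff, not_false_eq_true,
            Function.update_of_ne, hμ₂ y hy, hA]
          rfl
      · push Not at hy
        rw [initState_mem_eq_zero G k hy]
        have hne : ∀ y : ℕ, y < 16 * (C.s * C.s) → σ.reg 9 + a ≠ σ.reg 9 + y := fun y hy' h =>
          hy y (by rwa [hss]) (by linarith)
        interval_cases k
        · simpa [hμ₁' _ hne] using hf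
        · simpa [hμ₂' _ hne] using hf
    · rw [initState_mem_high G hk]
      have e1 : (10 + k) ≠ 10 := by omega
      have e2 : (10 + k) ≠ 11 := by omega
      simp only [Function.update_of_ne e1, Function.update_of_ne e2]
      simpa using hf
  · intro μ hlow hout hfar hbd
    simp only [Function.update_idem] at hlow hout hfar hbd ⊢
    refine hQ μ (fun b' hb' => ?_) (fun i hi => ?_) (fun k a ha => ?_) hbd
    · rw [hlow b' hb', Function.update_of_ne (by omega), Function.update_of_ne (by omega)]
    · have hidx : i * (4 * C.s) + (3 * C.s + i) < 4 * C.s * (4 * C.s) :=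
        index_lt (by omega) (by omega)
      have h1 := hout 2 (i * (4 * C.s) + (3 * C.s + i) : ℕ) (by
        rw [Nat.abs_cast]; exact_mod_cast (by omega))
      have h2 := hcor ⟨i, by omega⟩ ⟨3 * C.s + i, by omega⟩
      simp only [State.matrix] at h2
      push_cast at h1 h2
      simp only [ne_eq, Nat.reduceEqDiff, not_false_eq_true,
        Function.update_of_ne] at h1
      rw [show (12 : ℕ) = 10 + 2 from rfl, h1, h2]
      rw [← gadget_hasNonnegPrefixPath (fun i hi j hj => hDM _ (inBlock_lt hI hi) _ (inBlock_lt hJ hj))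
        (fun i hi j hj => hDM _ (inBlock_lt hJ hi) _ (inBlock_lt hK hj)) hi]
      split_ifs with h3
      · simpa using h3
      · simpa using h3
    · have h9 : (Function.update (Function.update σ.reg 10 0) 10 0 : ℕ → ℤ) 9 = σ.reg 9 := by simp
      have hne : ∀ y : ℕ, y < 16 * (C.s * C.s) → a ≠ σ.reg 9 + y := fun y hy => by
        have : (y : ℤ) < C.W := by exact_mod_cast (by omega)
        linarith
      rw [hfar (10 + k) a (by
        simp only [ne_eq, Nat.reduceEqDiff, not_false_eq_true,
          Function.update_of_ne]
        exact lt_of_lt_of_le (by linarith) (le_abs_self _))]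
      have hf := hσ.fresh k a (by linarith [(Nat.cast_nonneg C.W : (0 : ℤ) ≤ C.W)])
      by_cases e2 : k = 1
      · subst e2
        simpa [hμ₂' _ hne] using hf
      · rw [Function.update_of_ne (by omega)]
        by_cases e1 : k = 0
        · subst e1
          simpa [hμ₁' _ hne] using hf
        · rw [Function.update_of_ne (by omega)]
          exact hf

end

end RAM

/-! ### One step of the search for violated pairs -/

namespace RAM

open WDigraph

/-- Positive if the oracle found a solution through vertex `i` of the first block, where register
`10` holds `i`. -/
def eScan : Expr :=
  .ld 12 (.reg 9 + (.reg 10 * (.const 4 * .reg 1) + (.const 3 * .reg 1 + .reg 10)))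

/-- `U i k - D i j - D j k`, where register `11` holds `i + 1` and register `10` holds
`j * s + k`. -/
def eFind : Expr :=
  .ld 6 (entryAddr eI (.reg 11 - .const 1) eK (.reg 10 % .reg 1)) -
    (.ld 4 (entryAddr eI (.reg 11 - .const 1) eJ (.reg 10 / .reg 1)) +
      .ld 4 (entryAddr eJ (.reg 10 / .reg 1) eK (.reg 10 % .reg 1)))

/-- Examine the block triple whose number is in register `8`: if the oracle reports a violated pair,
find it and mark it with the value `-2 * M`; otherwise go on to the next block triple.  In both
cases move the window to fresh memory. -/
def iter (P : Prog) : Prog :=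
  .seq (oracleCall P) (.seq (search 10 11 (.reg 1) eScan)
    (.seq (.ifPos 11
      (.seq (search 10 12 (.reg 1 * .reg 1) eFind)
        (put 6 (entryAddr eI (.reg 11 - .const 1) eK ((.reg 12 - .const 1) % .reg 1))
          (.const (-2) * .reg 4)))
      (assign 8 (.reg 8 + .const 1)))
    (assign 9 (.reg 9 + .reg 5))))

variable {C : Ctx}

/-- A bound for the running time of one step. -/
def Ctx.cost (C : Ctx) : ℕ := 2 * C.Tc + C.P.regBound + 1000000 * (C.s * C.s)

/-- Each step either certifies that a block triple has no violated pair, or marks a pair that was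
unmarked before. -/
theorem run_iter {σ : State} (hσ : Base C σ) {D U : ℕ → ℕ → ℤ} (hD : Mat C.N (σ.mem 4) D)
    (hU : Mat C.N (σ.mem 6) U) (hDM : ∀ u < C.N, ∀ v < C.N, |D u v| ≤ (C.M : ℤ))
    (hUM : ∀ u < C.N, ∀ v < C.N, |U u v| ≤ 7 * (C.M : ℤ)) {b : ℕ} (hb : b < C.N * C.N)
    (h8 : σ.reg 8 = (b : ℤ)) (hoff : σ.reg 9 ≤ C.offMax) :
    Run C.B (iter C.P) C.cost σ fun σ' => Base C σ' ∧
      σ'.mem 4 = σ.mem 4 ∧ σ'.mem 5 = σ.mem 5 ∧ σ'.reg 6 = σ.reg 6 ∧ σ'.reg 7 = σ.reg 7 ∧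
      σ'.reg 9 = σ.reg 9 + ((2 * C.W + 1 : ℕ) : ℤ) ∧
      ((σ'.reg 8 = ((b + 1 : ℕ) : ℤ) ∧ σ'.mem 6 = σ.mem 6 ∧
        ∀ i < C.s, ∀ j < C.s, ∀ k < C.s,
          U (blockI C.s b * C.s + i) (blockK C.s b * C.s + k) ≤
            D (blockI C.s b * C.s + i) (blockJ C.s b * C.s + j) +
              D (blockJ C.s b * C.s + j) (blockK C.s b * C.s + k)) ∨
       (σ'.reg 8 = (b : ℤ) ∧ ∃ x < C.N, ∃ z < C.N, (∃ y < C.N, D x y + D y z < U x z) ∧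
          Mat C.N (σ'.mem 6) fun u v => if u = x ∧ v = z then -2 * (C.M : ℤ) else U u v)) := by
  have hs2 := C.two_le_s
  have hs : 0 < C.s := by linarith
  have hlW := C.le_W
  have hoX := C.off_le_X
  have hMX := C.M_le_X
  have hX := C.X_large
  have hoX' : (C.offMax : ℤ) + 2 * C.W + 1 ≤ C.X := by exact_mod_cast hoX
  have hMX' : 20 * (C.M : ℤ) ≤ C.X := by exact_mod_cast hMX
  have h9 := hσ.off_nonneg
  obtain ⟨hI, hJ, hK⟩ := block_lt hs hb
  have hNX : C.N * C.N ≤ C.X := C.sq_le_X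
  have hsX : C.s * C.s ≤ C.X := by omega
  have hss : C.s ≤ C.s * C.s := Nat.le_mul_of_pos_left _ hs
  have hT : C.cost ≥
      (2 * C.Tc + C.P.regBound + 100000 * (C.s * C.s)) +
      (((Expr.reg 1).cost + 6 + C.s * (eScan.cost + 20)) +
      (((((Expr.reg 1 * .reg 1).cost + 6 + (C.s * C.s) * (eFind.cost + 20)) +
        ((entryAddr eI (.reg 11 - .const 1) eK ((.reg 12 - .const 1) % .reg 1)).cost +
          (Expr.const (-2) * .reg 4).cost + 1)) + 1) + ((Expr.reg 9 + .reg 5).cost + 2))) := by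
    have e1 : (Expr.reg 1).cost ≤ 10 := by decide
    have e2 : eScan.cost ≤ 1000 := by decide
    have e3 : (Expr.reg 1 * .reg 1).cost ≤ 10 := by decide
    have e4 : eFind.cost ≤ 1000 := by decide
    have e5 : (entryAddr eI (.reg 11 - .const 1) eK ((.reg 12 - .const 1) % .reg 1)).cost +
          (Expr.const (-2) * .reg 4).cost + 1 ≤ 1000 := by decide
    have e6 : (Expr.reg 9 + .reg 5).cost ≤ 10 := by decide
    have h1 : 1 ≤ C.s * C.s := Nat.mul_pos hs hs
    have := Nat.mul_le_mul_left (C.s * C.s) e4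
    have := Nat.mul_le_mul hss e2
    unfold Ctx.cost
    linarith
  refine Run.mono ?_ hT fun _ h => h
  refine Run.seq (run_oracleCall hσ hD hU hDM hUM hb h8 hoff ?_)
  intro μ hlow hout hfresh hbd
  have hD' : Mat C.N (μ 4) D := by rwa [hlow 4 (by norm_num)]
  have hU' : Mat C.N (μ 6) U := by rwa [hlow 6 (by norm_num)]
  -- moving the window restores the invariant
  have hfin : ∀ τ : State, Bounded C.X τ → (∀ r < 8, τ.reg r = σ.reg r) → τ.reg 9 = σ.reg 9 →
      (∀ b, τ.mem (10 + b) = μ (10 + b)) → τ.mem 4 = σ.mem 4 → τ.mem 5 = σ.mem 5 →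
      ((τ.reg 8 = ((b + 1 : ℕ) : ℤ) ∧ τ.mem 6 = σ.mem 6 ∧
        ∀ i < C.s, ∀ j < C.s, ∀ k < C.s,
          U (blockI C.s b * C.s + i) (blockK C.s b * C.s + k) ≤
            D (blockI C.s b * C.s + i) (blockJ C.s b * C.s + j) +
              D (blockJ C.s b * C.s + j) (blockK C.s b * C.s + k)) ∨
       (τ.reg 8 = (b : ℤ) ∧ ∃ x < C.N, ∃ z < C.N, (∃ y < C.N, D x y + D y z < U x z) ∧
          Mat C.N (τ.mem 6) fun u v => if u = x ∧ v = z then -2 * (C.M : ℤ) else U u v)) →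
      Run C.B (RAM.assign 9 (.reg 9 + .reg 5)) ((Expr.reg 9 + .reg 5).cost + 2) τ fun σ' =>
      Base C σ' ∧
      σ'.mem 4 = σ.mem 4 ∧ σ'.mem 5 = σ.mem 5 ∧ σ'.reg 6 = σ.reg 6 ∧ σ'.reg 7 = σ.reg 7 ∧
      σ'.reg 9 = σ.reg 9 + ((2 * C.W + 1 : ℕ) : ℤ) ∧
      ((σ'.reg 8 = ((b + 1 : ℕ) : ℤ) ∧ σ'.mem 6 = σ.mem 6 ∧
        ∀ i < C.s, ∀ j < C.s, ∀ k < C.s,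
          U (blockI C.s b * C.s + i) (blockK C.s b * C.s + k) ≤
            D (blockI C.s b * C.s + i) (blockJ C.s b * C.s + j) +
              D (blockJ C.s b * C.s + j) (blockK C.s b * C.s + k)) ∨
       (σ'.reg 8 = (b : ℤ) ∧ ∃ x < C.N, ∃ z < C.N, (∃ y < C.N, D x y + D y z < U x z) ∧
          Mat C.N (σ'.mem 6) fun u v => if u = x ∧ v = z then -2 * (C.M : ℤ) else U u v)) := by
    intro τ hτb hr hr9 hm10 hm4 hm5 hcase
    refine Run.assign C.X_large C.X_pow (by norm_num) (by decide) hτb ?_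
    have hev : (Expr.reg 9 + .reg 5).eval τ = σ.reg 9 + ((2 * C.W + 1 : ℕ) : ℤ) := by
      simp only [Expr.eval_add, Expr.eval_reg, hr9, hr 5 (by norm_num), hσ.r5]
    rw [hev]
    have hne : ∀ r, r ≠ 9 → (τ.setReg 9 (σ.reg 9 + ((2 * C.W + 1 : ℕ) : ℤ))).reg r = τ.reg r :=
      fun r hr' => by simp [State.setReg, hr']
    have h9' : (τ.setReg 9 (σ.reg 9 + ((2 * C.W + 1 : ℕ) : ℤ))).reg 9 =
      σ.reg 9 + ((2 * C.W + 1 : ℕ) : ℤ) := by simp [State.setReg]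
    refine ⟨⟨?_, ?_, ?_, ?_, ?_, ?_, ?_, ?_, ?_⟩, hm4, hm5, ?_, ?_, h9', ?_⟩
    · rw [hne 0 (by norm_num), hr 0 (by norm_num), hσ.r0]
    · rw [hne 1 (by norm_num), hr 1 (by norm_num), hσ.r1]
    · rw [hne 2 (by norm_num), hr 2 (by norm_num), hσ.r2]
    · rw [hne 3 (by norm_num), hr 3 (by norm_num), hσ.r3]
    · rw [hne 4 (by norm_num), hr 4 (by norm_num), hσ.r4]
    · rw [hne 5 (by norm_num), hr 5 (by norm_num), hσ.r5]
    · rw [h9']; positivity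
    · refine hτb.setReg _ ?_
      rw [abs_of_nonneg (by positivity)]
      push_cast
      linarith
    · intro k a ha
      rw [h9'] at ha
      push_cast at ha
      have : (τ.setReg 9 (σ.reg 9 + ((2 * C.W + 1 : ℕ) : ℤ))).mem (10 + k) = τ.mem (10 + k) := rfl
      rw [this, hm10]
      exact hfresh k a (by linarith)
    · rw [hne 6 (by norm_num), hr 6 (by norm_num)]
    · rw [hne 7 (by norm_num), hr 7 (by norm_num)]
    · rw [hne 8 (by norm_num)]
      exact hcase
  set f : ℕ → ℤ := fun i => μ 12 (σ.reg 9 + (i * (4 * C.s) + (3 * C.s + i))) with hf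
  refine Run.seq (Run.search C.X_large C.X_pow (by norm_num) (by norm_num) (by norm_num) (by decide)
    (by decide) hbd C.s (by simp [State.setReg, hσ.r1]) (by omega) f ?_ ?_)
  · intro y x _
    simp [eScan, State.setReg, hσ.r1, hf]
  intro x hxs hx0 hx1 hbd1
  refine Run.seq (Run.ifPos (by norm_num) ?_ ?_)
  · intro hxpos
    replace hxpos : 0 < x := by simpa [State.setReg] using hxpos
    obtain ⟨i, rfl⟩ := Nat.exists_eq_add_of_le' hxpos
    have hi : i < C.s := by omega
    obtain ⟨j, hj, k, hk, hjk⟩ := (hout i hi).1 (by simpa [hf] using hx1 (by omega))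
    set g : ℕ → ℤ := fun y => U (blockI C.s b * C.s + i) (blockK C.s b * C.s + y % C.s) -
      (D (blockI C.s b * C.s + i) (blockJ C.s b * C.s + y / C.s) +
        D (blockJ C.s b * C.s + y / C.s) (blockK C.s b * C.s + y % C.s)) with hg
    refine Run.seq (Run.search C.X_large C.X_pow (by norm_num) (by norm_num) (by norm_num)
      (by decide) (by decide) hbd1 (C.s * C.s) (by simp [State.setReg, hσ.r1]) hsX g ?_ ?_)
    · intro y w hy
      have hy1 : y / C.s < C.s := Nat.div_lt_of_lt_mul hy
      have hy2 : y % C.s < C.s := Nat.mod_lt _ hs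
      have m1 := hU' _ (inBlock_lt hI hi) _ (inBlock_lt hK hy2)
      have m2 := hD' _ (inBlock_lt hI hi) _ (inBlock_lt hJ hy1)
      have m3 := hD' _ (inBlock_lt hJ hy1) _ (inBlock_lt hK hy2)
      simp only [hg, blockI, blockJ, blockK] at m1 m2 m3 ⊢
      push_cast at m1 m2 m3
      simp [eFind, entryAddr, eI, eJ, eK, State.setReg, hσ.r1, hσ.r2, h8, m1, m2, m3]
    · intro y hys hy0 hy1 hbd2
      have hypos : 0 < y := by
        by_contra h
        have := hy0 (by omega) (j * C.s + k) (index_lt hj hk)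
        simp only [hg, layer_div hk, layer_mod hk] at this
        linarith
      obtain ⟨w, rfl⟩ := Nat.exists_eq_add_of_le' hypos
      have hw := hy1 (by omega)
      simp only [Nat.add_sub_cancel, hg] at hw
      have hw1 : w / C.s < C.s := Nat.div_lt_of_lt_mul hys
      have hw2 : w % C.s < C.s := Nat.mod_lt _ hs
      refine (Run.put C.X_large C.X_pow (by decide) (by decide) hbd2 ?_)
      set u := blockI C.s b * C.s + i with hu
      set v := blockK C.s b * C.s + w % C.s with hv
      have huN : u < C.N := inBlock_lt hI hi
      have hvN : v < C.N := inBlock_lt hK hw2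
      set τ := ((((⟨Function.update σ.reg 10 0, μ⟩ : State).setReg 11 ((i + 1 : ℕ) : ℤ)).setReg 10
        0).setReg 12 ((w + 1 : ℕ) : ℤ)).setReg 10 0 with hτ
      have hva : (entryAddr eI (.reg 11 - .const 1) eK ((.reg 12 - .const 1) % .reg 1)).eval τ =
          ((u * C.N + v : ℕ) : ℤ) := by
        simp only [hu, hv, blockI, blockK]
        push_cast
        simp [hτ, entryAddr, eI, eK, State.setReg, hσ.r1, hσ.r2, h8]
      have hve : (Expr.const (-2) * .reg 4).eval τ = -2 * (C.M : ℤ) := by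
        simp [hτ, State.setReg, hσ.r4]
      rw [hva, hve]
      refine hfin _ (hbd2.setMem _ _ ?_) ?_ ?_ ?_ ?_ ?_ (.inr ⟨?_, u, huN, v, hvN, ?_, ?_⟩)
      · rw [abs_mul, Nat.abs_cast]; norm_num; linarith
      · intro r hr
        simp only [hτ, State.setReg, State.setMem]
        iterate 5 rw [Function.update_of_ne (by omega)]
      · simp [hτ, State.setReg, State.setMem]
      · intro b'
        simp only [hτ, State.setReg, State.setMem]
        rw [Function.update_of_ne (by omega)]
      · simp [hτ, State.setReg, State.setMem, hlow]
      · simp [hτ, State.setReg, State.setMem, hlow]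
      · simpa [hτ, State.setReg, State.setMem] using h8
      · exact ⟨_, inBlock_lt hJ hw1, by linarith⟩
      · intro u' hu' v' hv'
        simp only [hτ, State.setReg, State.setMem, Function.update_self]
        by_cases h : u' = u ∧ v' = v
        · rw [if_pos h, h.1, h.2, Function.update_self]
        · rw [if_neg h, Function.update_of_ne, hU' u' hu' v' hv']
          intro he
          refine h ⟨?_, ?_⟩
          · rw [← layer_div hv' u', ← layer_div hvN u, Nat.cast_injective he]
          · rw [← layer_mod hv' u', ← layer_mod hvN u, Nat.cast_injective he]
  · intro hxle
    replace hxle : x = 0 := by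
      have : (x : ℤ) ≤ 0 := by simpa [State.setReg] using hxle
      omega
    subst hxle
    have hT2 : ((Expr.reg 8 + .const 1).cost + 2) ≤
      (((Expr.reg 1 * .reg 1).cost + 6 + (C.s * C.s) * (eFind.cost + 20)) +
        ((entryAddr eI (.reg 11 - .const 1) eK ((.reg 12 - .const 1) % .reg 1)).cost +
          (Expr.const (-2) * .reg 4).cost + 1)) := by
      have e1 : (Expr.reg 8 + .const 1).cost + 2 ≤ (Expr.reg 1 * .reg 1).cost + 6 := by decide
      omega
    refine Run.mono (Run.assign C.X_large C.X_pow (by norm_num) (by decide) hbd1 ?_) hT2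
      fun _ h => h
    have hev : (Expr.reg 8 + .const 1).eval (((⟨Function.update σ.reg 10 0, μ⟩ : State).setReg 11
        ((0 : ℕ) : ℤ)).setReg 10 0) = ((b + 1 : ℕ) : ℤ) := by
      simp [State.setReg, h8]
    rw [hev]
    refine hfin _ (hbd1.setReg _ ?_) ?_ ?_ ?_ ?_ ?_ (.inl ⟨?_, ?_, ?_⟩)
    · rw [Nat.abs_cast]; exact_mod_cast (by omega)
    · intro r hr
      simp only [State.setReg]
      iterate 4 rw [Function.update_of_ne (by omega)]
    · simp [State.setReg]
    · intro b'; rfl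
    · simp [State.setReg, hlow]
    · simp [State.setReg, hlow]
    · simp [State.setReg]
    · simp [State.setReg, hlow]
    · intro i hi j hj k hk
      by_contra h
      have := (hout i hi).2 ⟨j, hj, k, hk, by linarith⟩
      have h' := hx0 rfl i hi
      simp only [hf] at h'
      linarith

end RAM

/-! ### Binary search for the (min,+) square -/

namespace RAM

open WDigraph

/-- The binary search brackets: the minimum of `D u j + D j v` over `j` lies in
`[T u v, T u v + h)`. -/
def Bracket (N : ℕ) (D T : ℕ → ℕ → ℤ) (h : ℤ) : Prop :=
  ∀ u < N, ∀ v < N, (∀ j < N, T u v ≤ D u j + D j v) ∧ ∃ j < N, D u j + D j v < T u v + h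

/-- One round of the binary search, which halves the width of all brackets; register `7` holds the
new width. -/
def round (P : Prog) : Prog :=
  .seq (fill 10 6 (.const 0) (.reg 3) (.ld 5 (.reg 10) + .reg 7))
    (.seq (assign 8 (.const 0)) (.seq (whileExpr 13 (.reg 3 - .reg 8) (iter P))
      (fill 10 5 (.const 0) (.reg 3)
        (.cond (.ld 6 (.reg 10) + .const 2 * .reg 4) (.ld 5 (.reg 10) + .reg 7) (.ld 5 (.reg 10))))))

/-- Fresh memory used by one round. -/
def Ctx.roundOff (C : Ctx) : ℕ := 2 * (C.N * C.N) * (2 * C.W + 1)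

variable {C : Ctx}

theorem Ctx.N_pos (C : Ctx) : 0 < C.N := by
  have := C.two_le_s
  unfold Ctx.N
  positivity

/-- The unmarked pairs. -/
def unmarked (N : ℕ) (U : ℕ → ℕ → ℤ) (M : ℤ) : Finset (ℕ × ℕ) :=
  (Finset.range N ×ˢ Finset.range N).filter fun p => U p.1 p.2 ≠ -2 * M

theorem card_unmarked_le (N : ℕ) (U : ℕ → ℕ → ℤ) (M : ℤ) :
    (unmarked N U M).card ≤ N * N :=
  (Finset.card_filter_le _ _).trans (by simp)

theorem card_unmarked_update_lt {N : ℕ} {U : ℕ → ℕ → ℤ} {M : ℤ} {x z : ℕ} (hx : x < N) (hz : z < N)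
    (h : U x z ≠ -2 * M) :
    (unmarked N (fun u v => if u = x ∧ v = z then -2 * M else U u v) M).card <
      (unmarked N U M).card := by
  refine Finset.card_lt_card (Finset.ssubset_iff_subset_ne.2 ⟨fun p hp => ?_, fun he => ?_⟩)
  · simp only [unmarked, Finset.mem_filter] at hp ⊢
    refine ⟨hp.1, fun h' => hp.2 ?_⟩
    split_ifs
    · rfl
    · exact h'
  · have : (x, z) ∈ unmarked N U M := by
      simpa [unmarked, hx, hz] using h
    rw [← he] at this
    simp [unmarked] at this

theorem fill_index {N : ℕ} (hN : 0 < N) {y : ℕ} (hy : y < N * N) :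
    y / N < N ∧ y % N < N ∧ ((y / N * N + y % N : ℕ) : ℤ) = y :=
  ⟨Nat.div_lt_of_lt_mul hy, Nat.mod_lt _ hN, by
    have := Nat.div_add_mod y N
    rw [mul_comm] at this
    exact_mod_cast this⟩

/-- Fill bank `b` with an `N × N` matrix. -/
theorem run_fillMat {σ : State} (hσ : Base C σ) {b : ℕ} (hb : b < 10) {e : Expr}
    (he : (e.good && decide (e.size ≤ 100)) = true) (F : ℕ → ℕ → ℤ)
    (hF : ∀ u < C.N, ∀ v < C.N, |F u v| ≤ (C.X : ℤ))
    (hev : ∀ u < C.N, ∀ v < C.N, ∀ μ : ℤ → ℤ,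
      μ ((u * C.N + v : ℕ) : ℤ) = σ.mem b ((u * C.N + v : ℕ) : ℤ) →
      e.eval ⟨Function.update σ.reg 10 ((u * C.N + v : ℕ) : ℤ), Function.update σ.mem b μ⟩ = F u v)
    {Q : State → Prop}
    (hQ : ∀ μ : ℤ → ℤ, Mat C.N μ F → Base C ⟨Function.update σ.reg 10 0, Function.update σ.mem b μ⟩ →
      Q ⟨Function.update σ.reg 10 0, Function.update σ.mem b μ⟩) :
    Run C.B (fill 10 b (.const 0) (.reg 3) e) (5 + C.N * C.N * (e.cost + 12)) σ Q := by
  refine Run.mono (Run.fill C.X_large C.X_pow (by norm_num) (by decide) (by decide) he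
    hσ.bounded (C.N * C.N) (by simp only [Expr.eval_reg, hσ.r3]) C.sq_le_X 0 (by intro μ x; rfl)
    (fun y => F (y / C.N) (y % C.N)) ?_ ?_ (Q := Q) ?_) ?_ fun _ h => h
  · intro y hy
    obtain ⟨h1, h2, -⟩ := fill_index C.N_pos hy
    exact hF _ h1 _ h2
  · intro y hy μ hμ
    obtain ⟨h1, h2, h3⟩ := fill_index C.N_pos hy
    have := hev _ h1 _ h2 μ (hμ _ (by rw [h3]; simp))
    rwa [h3] at this
  · intro μ h1 _ hbd
    refine hQ μ (mat_of_forall fun y hy => by simpa using h1 y hy) (hσ.congr ?_ ?_ hbd ?_)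
    · intro r hr
      exact Function.update_of_ne (by omega) _ _
    · simp
    · intro k
      have hkb : 10 + k ≠ b := by omega
      exact Function.update_of_ne hkb _ _
  · have e1 : (Expr.reg 3).cost = 2 := rfl
    have e2 : (Expr.const 0).cost = 1 := rfl
    rw [e1, e2]
    apply le_of_eq
    ring

theorem Base.setReg {σ : State} (hσ : Base C σ) {r : ℕ} (hr : 6 ≤ r) (hr9 : r ≠ 9) {x : ℤ}
    (hx : |x| ≤ (C.X : ℤ)) : Base C (σ.setReg r x) :=
  hσ.congr (fun r' hr' => Function.update_of_ne (by omega) _ _)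
    (Function.update_of_ne hr9.symm _ _) (hσ.bounded.setReg r hx) fun _ => rfl

/-- A round needs at most `2 * N ^ 2` steps: each step advances the block number, of which there are
`s ^ 6 = N ^ 2`, or marks one of the `N ^ 2` pairs. -/
theorem run_round {σ : State} (hσ : Base C σ) {D T : ℕ → ℕ → ℤ} (hD : Mat C.N (σ.mem 4) D)
    (hT : Mat C.N (σ.mem 5) T) (hDM : ∀ u < C.N, ∀ v < C.N, |D u v| ≤ (C.M : ℤ)) {h : ℕ}
    (h7 : σ.reg 7 = (h : ℤ)) (h1 : 1 ≤ h) (hM : h ≤ 4 * C.M + 1)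
    (hTM : ∀ u < C.N, ∀ v < C.N, -2 * (C.M : ℤ) ≤ T u v) (hbr : Bracket C.N D T (2 * h))
    (hoff : σ.reg 9 + C.roundOff ≤ C.offMax) :
    Run C.B (round C.P) (3 * (C.N * C.N) * C.cost) σ fun σ' => Base C σ' ∧
      σ'.mem 4 = σ.mem 4 ∧ σ'.reg 6 = σ.reg 6 ∧ σ'.reg 7 = σ.reg 7 ∧
      σ'.reg 9 ≤ σ.reg 9 + C.roundOff ∧ ∃ T', Mat C.N (σ'.mem 5) T' ∧
        (∀ u < C.N, ∀ v < C.N, -2 * (C.M : ℤ) ≤ T' u v) ∧ Bracket C.N D T' h := by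
  have hM1 : (1 : ℤ) ≤ C.M := by exact_mod_cast C.M_pos
  have hMX : 20 * (C.M : ℤ) ≤ C.X := by exact_mod_cast C.M_le_X
  have hNX : C.N * C.N ≤ C.X := C.sq_le_X
  have hh1 : (1 : ℤ) ≤ h := by exact_mod_cast h1
  have hhM : (h : ℤ) ≤ 4 * C.M + 1 := by exact_mod_cast hM
  have hTM' : ∀ u < C.N, ∀ v < C.N, T u v ≤ 2 * C.M := fun u hu v hv => by
    have := (hbr u hu v hv).1 0 C.N_pos
    have a1 := (abs_le.1 (hDM u hu 0 C.N_pos)).2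
    have a2 := (abs_le.1 (hDM 0 C.N_pos v hv)).2
    linarith
  have hcost : 1000000 ≤ C.cost := by
    have : 1 ≤ C.s * C.s := Nat.mul_pos (by linarith [C.two_le_s]) (by linarith [C.two_le_s])
    unfold Ctx.cost
    omega
  have hN1 : 1 ≤ C.N * C.N := Nat.mul_pos C.N_pos C.N_pos
  have hTm : 3 * (C.N * C.N) * C.cost ≥
      (5 + C.N * C.N * ((Expr.ld 5 (.reg 10) + .reg 7).cost + 12)) +
      ((1 + 2) + (((Expr.reg 3 - .reg 8).cost + 2 +
        ((2 * (C.N * C.N)) * (C.cost + ((Expr.reg 3 - .reg 8).cost + 2) + 1) + 1)) +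
      (5 + C.N * C.N * ((Expr.cond (.ld 6 (.reg 10) + .const 2 * .reg 4) (.ld 5 (.reg 10) + .reg 7)
        (.ld 5 (.reg 10))).cost + 12)))) := by
    have e1 : (Expr.ld 5 (.reg 10) + .reg 7).cost = 6 := by decide
    have e2 : (Expr.reg 3 - .reg 8).cost = 5 := by decide
    have e3 : (Expr.cond (.ld 6 (.reg 10) + .const 2 * .reg 4) (.ld 5 (.reg 10) + .reg 7)
        (.ld 5 (.reg 10))).cost ≤ 100 := by decide
    rw [e1, e2]
    have := Nat.mul_le_mul_left (C.N * C.N) e3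
    have := Nat.mul_le_mul_left (C.N * C.N) hcost
    nlinarith
  refine Run.mono ?_ hTm fun _ h => h
  refine Run.seq (run_fillMat hσ (by norm_num) (by decide) (fun u v => T u v + h) ?_ ?_ ?_)
  · intro u hu v hv
    have := hTM u hu v hv
    have := hTM' u hu v hv
    rw [abs_le]
    constructor <;> linarith
  · intro u hu v hv μ hμ
    simpa [h7] using hT u hu v hv
  intro μ hμ hσ1
  set σ1 : State := ⟨Function.update σ.reg 10 0, Function.update σ.mem 6 μ⟩ with hσ1d
  refine Run.seq (Run.assign C.X_large C.X_pow (by norm_num) (by decide) hσ1.bounded ?_)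
  set σ2 := σ1.setReg 8 ((Expr.const 0).eval σ1) with hσ2d
  have hσ2 : Base C σ2 := hσ1.setReg (by norm_num) (by norm_num) (by simp)
  -- `m` bounds the number of unmarked pairs plus the number of block triples still to be examined
  let I : ℕ → State → Prop := fun m τ => Base C τ ∧ τ.mem 4 = σ.mem 4 ∧ τ.mem 5 = σ.mem 5 ∧
    τ.reg 6 = σ.reg 6 ∧ τ.reg 7 = σ.reg 7 ∧ ∃ b ≤ C.N * C.N, τ.reg 8 = (b : ℤ) ∧
    ∃ U, Mat C.N (τ.mem 6) U ∧
      (∀ x < C.N, ∀ z < C.N, U x z = T x z + h ∨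
        (U x z = -2 * (C.M : ℤ) ∧ ∃ j < C.N, D x j + D j z < T x z + h)) ∧
      (∀ b' < b, ∀ i < C.s, ∀ j < C.s, ∀ k < C.s,
          U (blockI C.s b' * C.s + i) (blockK C.s b' * C.s + k) ≤
            D (blockI C.s b' * C.s + i) (blockJ C.s b' * C.s + j) +
              D (blockJ C.s b' * C.s + j) (blockK C.s b' * C.s + k)) ∧
      (unmarked C.N U C.M).card + (C.N * C.N - b) ≤ m ∧
      τ.reg 9 + (m * (2 * C.W + 1) : ℕ) ≤ σ.reg 9 + C.roundOff
  refine Run.seq (Run.whileExpr C.X_large C.X_pow (by norm_num) (by decide) (I := I) ?_ ?_ ?_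
    (2 * (C.N * C.N)) σ2 ?_)
  · rintro m τ ⟨hτ, hm4, hm5, h6, h7', b, hb, h8, hrest⟩
    have hev : (Expr.reg 3 - .reg 8).eval τ = ((C.N * C.N - b : ℕ) : ℤ) := by
      simp only [Expr.eval_sub, Expr.eval_reg, hτ.r3, h8]
      push_cast [hb]
      rfl
    have hX : |(Expr.reg 3 - .reg 8).eval τ| ≤ (C.X : ℤ) := by
      rw [hev, Nat.abs_cast]; exact_mod_cast (by omega)
    refine ⟨hτ.bounded, hX, ⟨hτ.setReg (by norm_num) (by norm_num) hX, hm4, hm5, ?_, ?_, b, hb, ?_,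
      ?_⟩, ?_⟩
    · simpa [State.setReg] using h6
    · simpa [State.setReg] using h7'
    · simpa [State.setReg] using h8
    · simpa [State.setReg] using hrest
    · simp [State.setReg]
  · rintro m τ ⟨hτ, hm4, hm5, h6, h7', b, hb, h8, U, hU, hUT, hclean, hm, ho⟩ - hpos
    have hbN : b < C.N * C.N := by
      simp only [Expr.eval_sub, Expr.eval_reg, hτ.r3, h8] at hpos
      omega
    have hUM : ∀ u < C.N, ∀ v < C.N, |U u v| ≤ 7 * (C.M : ℤ) := by
      intro u hu v hv
      have := hTM u hu v hv
      have := hTM' u hu v hv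
      rw [abs_le]
      rcases hUT u hu v hv with h' | ⟨h', -⟩ <;> rw [h'] <;> constructor <;> linarith
    have hm1 : 1 ≤ m := by omega
    refine Run.mono (run_iter hτ (by rwa [hm4]) hU hDM hUM hbN h8 ?_) le_rfl ?_
    · linarith [(Nat.cast_nonneg (m * (2 * C.W + 1)) : (0 : ℤ) ≤ _)]
    rintro τ' ⟨hτ', g4, g5, g6, g7, g9, hcase⟩
    have ho' : τ'.reg 9 + ((m - 1) * (2 * C.W + 1) : ℕ) ≤ σ.reg 9 + C.roundOff := by
      obtain ⟨m', rfl⟩ := Nat.exists_eq_add_of_le' hm1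
      rw [g9]
      simp only [Nat.add_sub_cancel]
      push_cast at ho ⊢
      linarith
    refine ⟨m - 1, by omega, hτ', g4.trans hm4, g5.trans hm5, g6.trans h6, g7.trans h7', ?_⟩
    rcases hcase with ⟨g8, gm6, hcl⟩ | ⟨g8, x, hx, z, hz, ⟨y, hy, hxyz⟩, hU'⟩
    · refine ⟨b + 1, hbN, g8, U, by rwa [gm6], hUT, fun b' hb' => ?_, by omega, ho'⟩
      rcases Nat.lt_succ_iff_lt_or_eq.1 hb' with h' | rfl
      · exact hclean b' h'
      · exact hcl
    · have hne : U x z ≠ -2 * (C.M : ℤ) := by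
        intro he
        have a1 := (abs_le.1 (hDM x hx y hy)).1
        have a2 := (abs_le.1 (hDM y hy z hz)).1
        linarith
      have hlt := card_unmarked_update_lt hx hz hne
      refine ⟨b, hb, g8, _, hU', ?_, ?_, by omega, ho'⟩
      · intro u hu v hv
        by_cases huv : u = x ∧ v = z
        · rw [if_pos huv]
          refine .inr ⟨rfl, ?_⟩
          rcases hUT x hx z hz with h' | ⟨h', -⟩
          · rw [huv.1, huv.2]; exact ⟨y, hy, by rw [← h']; exact hxyz⟩
          · exact absurd h' hne
        · rw [if_neg huv]; exact hUT u hu v hv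
      · intro b' hb' i hi j hj k hk
        refine le_trans ?_ (hclean b' hb' i hi j hj k hk)
        split_ifs with huv
        · have hb'N : b' < C.N * C.N := by omega
          obtain ⟨hI, -, hK⟩ := block_lt (by omega) hb'N
          rcases hUT _ (inBlock_lt hI hi) _ (inBlock_lt hK hk) with h' | ⟨h', -⟩
          · rw [h']; linarith [hTM _ (inBlock_lt hI hi) _ (inBlock_lt hK hk)]
          · rw [h']
        · exact le_rfl
  · rintro m τ ⟨hτ, hm4, hm5, h6, h7', b, hb, h8, U, hU, hUT, hclean, hm, ho⟩ - hpos
    have hbN : b = C.N * C.N := by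
      simp only [Expr.eval_sub, Expr.eval_reg, hτ.r3, h8] at hpos
      omega
    subst hbN
    have hall : ∀ x < C.N, ∀ y < C.N, ∀ z < C.N, U x z ≤ D x y + D y z := by
      intro x hx y hy z hz
      have hs : 0 < C.s := by linarith [C.two_le_s]
      obtain ⟨b', hb', e1, e2, e3⟩ := exists_block hx hy hz
      have := hclean b' hb' (x % C.s) (Nat.mod_lt _ hs) (y % C.s) (Nat.mod_lt _ hs) (z % C.s)
        (Nat.mod_lt _ hs)
      rwa [← e1, ← e2, ← e3] at this
    have hT5 : Mat C.N (τ.mem 5) T := by rwa [hm5]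
    refine run_fillMat hτ (by norm_num) (by decide)
      (fun u v => if U u v = -2 * (C.M : ℤ) then T u v else T u v + h) ?_ ?_ ?_
    · intro u hu v hv
      have := hTM u hu v hv
      have := hTM' u hu v hv
      rw [abs_le]
      split_ifs <;> constructor <;> linarith
    · intro u hu v hv μ' hμ'
      have a1 := hT5 u hu v hv
      have a2 := hU u hu v hv
      rw [a1] at hμ'
      have hc : 0 < U u v + 2 * (C.M : ℤ) ↔ ¬ U u v = -2 * (C.M : ℤ) := by
        rcases hUT u hu v hv with h' | ⟨h', -⟩
        · rw [h']
          have := hTM u hu v hv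
          constructor
          · intro _; linarith
          · intro _; linarith
        · rw [h']; constructor
          · intro; linarith
          · intro hh; exact absurd rfl hh
      simp only [Expr.eval_cond, Expr.eval_add, Expr.eval_ld, Expr.eval_reg, Expr.eval_mul,
        Expr.eval_const, Function.update_self, ne_eq, Nat.reduceEqDiff, not_false_eq_true,
        Function.update_of_ne, hμ', a2, hτ.r4, h7', h7, hc]
      by_cases hh : U u v = -2 * (C.M : ℤ) <;> simp [hh]
    · intro μ' hμ' hB
      refine ⟨hB, ?_, ?_, ?_, ?_, _, by simpa using hμ', ?_, ?_⟩
      · simpa using hm4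
      · simpa using h6
      · simpa using h7'
      · have : (0 : ℤ) ≤ ((m * (2 * C.W + 1) : ℕ) : ℤ) := Nat.cast_nonneg _
        simp only [ne_eq, Nat.reduceEqDiff, not_false_eq_true, Function.update_of_ne]
        linarith
      · intro u hu v hv
        have := hTM u hu v hv
        split_ifs <;> linarith
      · intro u hu v hv
        obtain ⟨b1, j, hj, b2⟩ := hbr u hu v hv
        dsimp only
        split_ifs with hc
        · refine ⟨b1, ?_⟩
          rcases hUT u hu v hv with h' | ⟨-, h'⟩
          · exfalso
            have := hTM u hu v hv
            linarith
          · exact h'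
        · have hUe : U u v = T u v + h := by
            rcases hUT u hu v hv with h' | ⟨h', -⟩
            · exact h'
            · exact absurd h' hc
          refine ⟨fun j hj => ?_, j, hj, by linarith⟩
          rw [← hUe]; exact hall u hu j hj v hv
  · refine ⟨hσ2, ?_, ?_, ?_, ?_, 0, by omega, ?_, fun u v => T u v + h, ?_, fun x _ z _ => .inl rfl,
      fun b' hb' => by omega, ?_, ?_⟩
    · simp [hσ2d, hσ1d, State.setReg]
    · simp [hσ2d, hσ1d, State.setReg]
    · simp [hσ2d, hσ1d, State.setReg]
    · simp [hσ2d, hσ1d, State.setReg]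
    · simp [hσ2d, State.setReg]
    · simpa [hσ2d, hσ1d, State.setReg] using hμ
    · have := card_unmarked_le C.N (fun u v => T u v + h) C.M
      omega
    · have : σ2.reg 9 = σ.reg 9 := by simp [hσ2d, hσ1d, State.setReg]
      rw [this]
      unfold Ctx.roundOff
      exact le_rfl

/-- Replace the matrix in bank `4` by its (min,+) square. -/
def square (P : Prog) : Prog :=
  .seq (fill 10 5 (.const 0) (.reg 3) (.const (-2) * .reg 4))
    (.seq (assign 7 (.const 4 * .reg 4 + .const 1))
      (.seq (whileExpr 13 (.reg 7 - .const 1)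
          (.seq (assign 7 ((.reg 7 + .const 1) / .const 2)) (round P)))
        (fill 10 4 (.const 0) (.reg 3) (.ld 5 (.reg 10)))))

/-- The binary search starts from brackets of width `4 * M + 1` and takes `p` rounds. -/
theorem run_square {σ : State} (hσ : Base C σ) {D : ℕ → ℕ → ℤ} (hD : Mat C.N (σ.mem 4) D)
    (hDM : ∀ u < C.N, ∀ v < C.N, |D u v| ≤ (C.M : ℤ)) {p : ℕ} (hp : 4 * C.M + 1 ≤ 2 ^ p)
    (hoff : σ.reg 9 + (p * C.roundOff : ℕ) ≤ C.offMax) :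
    Run C.B (square C.P) ((p + 1) * (4 * (C.N * C.N) * C.cost)) σ fun σ' => Base C σ' ∧
      σ'.reg 6 = σ.reg 6 ∧ σ'.reg 9 ≤ σ.reg 9 + (p * C.roundOff : ℕ) ∧
      ∃ D', Mat C.N (σ'.mem 4) D' ∧ IsMinPlusSq C.N D D' := by
  have hM1 : (1 : ℤ) ≤ C.M := by exact_mod_cast C.M_pos
  have hMX : 20 * (C.M : ℤ) ≤ C.X := by exact_mod_cast C.M_le_X
  have hcost : 1000000 ≤ C.cost := by
    have : 1 ≤ C.s * C.s := Nat.mul_pos (by linarith [C.two_le_s]) (by linarith [C.two_le_s])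
    unfold Ctx.cost
    omega
  have hN1 : 1 ≤ C.N * C.N := Nat.mul_pos C.N_pos C.N_pos
  have hTm : (p + 1) * (4 * (C.N * C.N) * C.cost) ≥
      (5 + C.N * C.N * ((Expr.const (-2) * .reg 4).cost + 12)) +
      (((Expr.const 4 * .reg 4 + .const 1).cost + 2) + (((Expr.reg 7 - .const 1).cost + 2 +
        (p * ((((Expr.reg 7 + .const 1) / .const 2).cost + 2 + 3 * (C.N * C.N) * C.cost) +
          ((Expr.reg 7 - .const 1).cost + 2) + 1) + 1)) +
      (5 + C.N * C.N * ((Expr.ld 5 (.reg 10)).cost + 12)))) := by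
    have e1 : (Expr.const (-2) * .reg 4).cost = 4 := by decide
    have e2 : (Expr.const 4 * .reg 4 + .const 1).cost = 6 := by decide
    have e3 : (Expr.reg 7 - .const 1).cost = 4 := by decide
    have e4 : ((Expr.reg 7 + .const 1) / .const 2).cost = 6 := by decide
    have e5 : (Expr.ld 5 (.reg 10)).cost = 3 := by decide
    rw [e1, e2, e3, e4, e5]
    have h1 := Nat.mul_le_mul_left (C.N * C.N) hcost
    have h2 : p * 1000000 ≤ p * (C.N * C.N * C.cost) := Nat.mul_le_mul_left _ (by omega)
    nlinarith
  refine Run.mono ?_ hTm fun _ h => h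
  refine Run.seq (run_fillMat hσ (by norm_num) (by decide) (fun u v => -2 * (C.M : ℤ)) ?_ ?_ ?_)
  · intro u hu v hv
    rw [abs_le]
    constructor <;> linarith
  · intro u hu v hv μ hμ
    simp [hσ.r4]
  intro μ hμ hσ1
  set σ1 : State := ⟨Function.update σ.reg 10 0, Function.update σ.mem 5 μ⟩ with hσ1d
  refine Run.seq (Run.assign C.X_large C.X_pow (by norm_num) (by decide) hσ1.bounded ?_)
  have hev : (Expr.const 4 * .reg 4 + .const 1).eval σ1 = ((4 * C.M + 1 : ℕ) : ℤ) := by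
    simp [hσ1d, hσ.r4]
  rw [hev]
  set σ2 := σ1.setReg 7 ((4 * C.M + 1 : ℕ) : ℤ) with hσ2d
  have hσ2 : Base C σ2 := hσ1.setReg (by norm_num) (by norm_num) (by
    rw [Nat.abs_cast]; push_cast; linarith)
  let I : ℕ → State → Prop := fun m τ => Base C τ ∧ τ.mem 4 = σ.mem 4 ∧
    τ.reg 6 = σ.reg 6 ∧ ∃ h : ℕ, τ.reg 7 = (h : ℤ) ∧ 1 ≤ h ∧ h ≤ 4 * C.M + 1 ∧ h ≤ 2 ^ m ∧
    τ.reg 9 + (m * C.roundOff : ℕ) ≤ σ.reg 9 + (p * C.roundOff : ℕ) ∧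
    ∃ T, Mat C.N (τ.mem 5) T ∧ (∀ u < C.N, ∀ v < C.N, -2 * (C.M : ℤ) ≤ T u v) ∧ Bracket C.N D T h
  refine Run.seq (Run.whileExpr C.X_large C.X_pow (by norm_num) (by decide) (I := I) ?_ ?_ ?_
    p σ2 ?_)
  · rintro m τ ⟨hτ, hm4, h6, h, h7, h1, hM, hm, hrest⟩
    have hX : |(Expr.reg 7 - .const 1).eval τ| ≤ (C.X : ℤ) := by
      have : (h : ℤ) ≤ 4 * C.M + 1 := by exact_mod_cast hM
      have : (1 : ℤ) ≤ h := by exact_mod_cast h1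
      simp only [Expr.eval_sub, Expr.eval_reg, Expr.eval_const, h7]
      rw [abs_le]
      constructor <;> linarith
    refine ⟨hτ.bounded, hX, ⟨hτ.setReg (by norm_num) (by norm_num) hX, hm4, ?_, h, ?_, h1, hM, hm,
      ?_⟩, ?_⟩
    · simpa [State.setReg] using h6
    · simpa [State.setReg] using h7
    · simpa [State.setReg] using hrest
    · simp [State.setReg]
  · rintro m τ ⟨hτ, hm4, h6, h, h7, h1, hM, hm, ho, T, hT, hTM, hbr⟩ - hpos
    have hh2 : 2 ≤ h := by
      simp only [Expr.eval_sub, Expr.eval_reg, Expr.eval_const, h7] at hpos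
      omega
    have hm1 : 1 ≤ m := by
      by_contra hm0
      obtain rfl : m = 0 := by omega
      simp at hm
      omega
    obtain ⟨m', rfl⟩ := Nat.exists_eq_add_of_le' hm1
    refine Run.seq (Run.assign C.X_large C.X_pow (by norm_num) (by decide) hτ.bounded ?_)
    have hev : ((Expr.reg 7 + .const 1) / .const 2).eval τ = (((h + 1) / 2 : ℕ) : ℤ) := by
      simp [h7]
    rw [hev]
    have hX : |(((h + 1) / 2 : ℕ) : ℤ)| ≤ (C.X : ℤ) := by
      rw [Nat.abs_cast]
      have : (h + 1) / 2 ≤ C.X := by have := C.M_le_X; omega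
      exact_mod_cast this
    have hbr' : Bracket C.N D T (2 * ((h + 1) / 2 : ℕ)) := by
      intro u hu v hv
      obtain ⟨b1, j, hj, b2⟩ := hbr u hu v hv
      refine ⟨b1, j, hj, lt_of_lt_of_le b2 ?_⟩
      have : h ≤ 2 * ((h + 1) / 2) := by omega
      have : (h : ℤ) ≤ 2 * ((h + 1) / 2 : ℕ) := by exact_mod_cast this
      linarith
    have ho9 : (τ.setReg 7 (((h + 1) / 2 : ℕ) : ℤ)).reg 9 = τ.reg 9 := by simp [State.setReg]
    push_cast at ho hoff
    have hmr : (0 : ℤ) ≤ m' * C.roundOff := by positivity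
    refine Run.mono (run_round (hτ.setReg (by norm_num) (by norm_num) hX) (D := D) (T := T) ?_ hT
      hDM (h := (h + 1) / 2) ?_ (by omega) (by omega) hTM hbr' ?_) le_rfl ?_
    · simpa [State.setReg, hm4] using hD
    · simp [State.setReg]
    · rw [ho9]
      linarith
    rintro τ' ⟨hτ', g4, g6, g7, g9, T', hT', hTM', hbr''⟩
    rw [ho9] at g9
    refine ⟨m', by omega, hτ', ?_, ?_, (h + 1) / 2, ?_, by omega, by omega, ?_, ?_, T', hT', hTM',
      hbr''⟩
    · simpa [State.setReg, hm4] using g4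
    · simpa [State.setReg, h6] using g6
    · simpa [State.setReg] using g7
    · rw [pow_succ] at hm; omega
    · push_cast
      linarith
  · rintro m τ ⟨hτ, hm4, h6, h, h7, h1, hM, hm, ho, T, hT, hTM, hbr⟩ - hpos
    have hh1 : h = 1 := by
      simp only [Expr.eval_sub, Expr.eval_reg, Expr.eval_const, h7] at hpos
      omega
    subst hh1
    refine run_fillMat hτ (by norm_num) (by decide) T ?_ ?_ ?_
    · intro u hu v hv
      have a0 := hTM u hu v hv
      have := (hbr u hu v hv).1 0 C.N_pos
      have a1 := (abs_le.1 (hDM u hu 0 C.N_pos)).2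
      have a2 := (abs_le.1 (hDM 0 C.N_pos v hv)).2
      rw [abs_le]
      constructor <;> linarith
    · intro u hu v hv μ' _
      simpa using hT u hu v hv
    · intro μ' hμ' hB
      refine ⟨hB, ?_, ?_, T, by simpa using hμ', ?_⟩
      · simpa using h6
      · have : (0 : ℤ) ≤ ((m * C.roundOff : ℕ) : ℤ) := Nat.cast_nonneg _
        simp only [ne_eq, Nat.reduceEqDiff, not_false_eq_true, Function.update_of_ne]
        linarith
      · intro u hu v hv
        obtain ⟨b1, j, hj, b2⟩ := hbr u hu v hv
        exact ⟨⟨j, hj, le_antisymm (b1 j hj) (by push_cast at b2; omega)⟩, b1⟩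
  · refine ⟨hσ2, ?_, ?_, 4 * C.M + 1, ?_, by omega, le_rfl, hp, ?_, fun _ _ => -2 * (C.M : ℤ), ?_,
      fun _ _ _ _ => le_rfl, ?_⟩
    · simp [hσ2d, hσ1d, State.setReg]
    · simp [hσ2d, hσ1d, State.setReg]
    · simp [hσ2d, State.setReg]
    · have : σ2.reg 9 = σ.reg 9 := by simp [hσ2d, hσ1d, State.setReg]
      rw [this]
    · simpa [hσ2d, hσ1d, State.setReg] using hμ
    · intro u hu v hv
      have key : ∀ j < C.N, -2 * (C.M : ℤ) ≤ D u j + D j v ∧ D u j + D j v ≤ 2 * C.M := by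
        intro j hj
        have a1 := abs_le.1 (hDM u hu j hj)
        have a2 := abs_le.1 (hDM j hj v hv)
        constructor <;> linarith [a1.1, a1.2, a2.1, a2.2]
      refine ⟨fun j hj => (key j hj).1, 0, C.N_pos, ?_⟩
      push_cast
      linarith [(key 0 C.N_pos).2]

end RAM

/-! ### The program for shortest paths -/

namespace RAM

open WDigraph

/-- Raise the value of `e` to the power `m`. -/
def power (r : ℕ) (e : Expr) : ℕ → Prog
  | 0 => assign r (.const 1)
  | m + 1 => .seq (power r e m) (assign r (.reg r * e))

theorem run_power {B X : ℕ} (hX : 100 ≤ X) (hB : X ^ 100 ≤ B) {r : ℕ} (hr : r < 100) {e : Expr}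
    (he : (e.good && decide (e.size ≤ 99)) = true) {σ : State} (hb : Bounded X σ) {v : ℕ}
    (hv : ∀ x, e.eval (σ.setReg r x) = v) (m : ℕ) (hm : v ^ m ≤ X) (hv0 : 1 ≤ v)
    {Q : State → Prop} (hQ : Q (σ.setReg r ((v ^ m : ℕ) : ℤ))) :
    Run B (power r e m) (3 + m * (e.cost + 5)) σ Q := by
  induction m generalizing Q with
  | zero =>
    refine Run.mono (Run.assign hX hB hr (by decide) hb ?_) (by simp [Expr.cost]) fun _ h => h
    simpa using hQ
  | succ m ih =>
    have hm' : v ^ m ≤ X := (Nat.pow_le_pow_right hv0 (by omega)).trans hm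
    have hT : (3 + m * (e.cost + 5)) + ((Expr.reg r * e).cost + 2) ≤
        3 + (m + 1) * (e.cost + 5) := by
      have : (Expr.reg r * e).cost = 2 + e.cost + 1 := rfl
      rw [this, add_mul]
      omega
    refine Run.mono (Run.seq (ih hm' ?_)) hT fun _ h => h
    refine Run.assign hX hB hr ?_ (hb.setReg r (by rw [Nat.abs_cast]; exact_mod_cast hm')) ?_
    · simp only [Bool.and_eq_true, decide_eq_true_eq] at he ⊢
      refine ⟨by simp [Expr.good, hr, he.1], ?_⟩
      have : (Expr.reg r * e).size = 1 + e.size := rfl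
      omega
    · rw [Expr.eval_mul, hv]
      have : (σ.setReg r ((v ^ m : ℕ) : ℤ)).setReg r
          ((Expr.reg r).eval (σ.setReg r ((v ^ m : ℕ) : ℤ)) * v) =
          σ.setReg r ((v ^ (m + 1) : ℕ) : ℤ) := by
        simp [State.setReg, pow_succ]
      rw [this]
      exact hQ

/-- Compute the constants in the registers `1, …, 5`. -/
def setup (c k : ℕ) : Prog :=
  .seq (assign 1 (.const 2))
    (.seq (whileExpr 13 (.reg 0 - .reg 1 * .reg 1 * .reg 1) (assign 1 (.reg 1 + .const 1)))
      (.seq (assign 2 (.reg 1 * .reg 1 * .reg 1)) (.seq (assign 3 (.reg 2 * .reg 2))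
        (.seq (power 4 (.reg 2) (c + 3)) (.seq (power 5 (.const 4 * .reg 1 + .const 2) (k + 2))
          (assign 5 (.const 2 * .reg 5 + .const 1)))))))

/-- The initial distance matrix. -/
def eInit : Expr :=
  .cond (.const 1 - (.reg 10 / .reg 2 - .reg 10 % .reg 2) * (.reg 10 / .reg 2 - .reg 10 % .reg 2))
    (.const 0)
    (.cond (.reg 0 - .reg 10 / .reg 2) (.cond (.reg 0 - .reg 10 % .reg 2)
      (.cond (.ld 0 (.reg 10 / .reg 2 * .reg 0 + .reg 10 % .reg 2))
        (.ld 1 (.reg 10 / .reg 2 * .reg 0 + .reg 10 % .reg 2)) (.reg 4)) (.reg 4)) (.reg 4))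

/-- The entry of the `N × N` matrix in bank `4` for the cell of an `n × n` matrix with its number in
register `10`. -/
def eOut : Expr := .ld 4 (.reg 10 / .reg 0 * .reg 2 + .reg 10 % .reg 0)

/-- Write the output matrices; an entry above `M / 2` means that there is no path. -/
def output : Prog :=
  .seq (fill 10 2 (.const 0) (.reg 0 * .reg 0)
      (.cond (.reg 4 - .const 2 * eOut) (.const 1) (.const 0)))
    (fill 10 3 (.const 0) (.reg 0 * .reg 0) eOut)

/-- All-pairs shortest paths by repeated squaring. -/
def apsp (P : Prog) (c k : ℕ) : Prog :=
  .seq (setup c k) (.seq (fill 10 4 (.const 0) (.reg 3) eInit) (.seq (assign 6 (.const 1))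
    (.seq (whileExpr 13 (.reg 2 - .reg 6) (.seq (square P) (assign 6 (.const 2 * .reg 6))))
      output)))

variable {C : Ctx}

theorem bounded_initState {n X : ℕ} {G : WDigraph (Fin n)} {w : ℕ} (hG : G.WeightsBoundedBy w)
    (hn : n ≤ X) (hw : w ≤ X) (hX : 1 ≤ X) : Bounded X (initState G) := by
  constructor
  · intro r _
    simp only [initState]
    split_ifs
    · rw [Nat.abs_cast]; exact_mod_cast hn
    · simp
  · intro b a
    by_cases hy : ∃ y : ℕ, y < n * n ∧ a = y
    · obtain ⟨y, hy, rfl⟩ := hy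
      obtain ⟨hu, hv, he⟩ := initState_mem_of_lt G b hy
      rw [he, initState_mem]
      split_ifs with h1 h2 h3
      · rw [abs_one]; exact_mod_cast hX
      · exact (hG _ _ h1).trans (by exact_mod_cast hw)
      · simp
      · simp
    · push Not at hy
      rw [initState_mem_eq_zero G b hy]
      simp

theorem run_setup {G : WDigraph (Fin C.n)} {c k : ℕ}
    (hmin : ∀ s', 2 ≤ s' → s' < C.s → s' * s' * s' < C.n) (hM : C.M = C.N ^ (c + 3))
    (hW : C.W = (4 * C.s + 2) ^ (k + 2)) (hb : Bounded C.X (initState G)) :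
    Run C.B (setup c k) ((c + k + 10) * (100 * C.s)) (initState G) fun σ' => Base C σ' ∧
      σ'.reg 9 = 0 ∧ σ'.mem = (initState G).mem := by
  have hs2 := C.two_le_s
  have hX := C.X_large
  have hNX : C.N * C.N ≤ C.X := C.sq_le_X
  have hN : C.N ≤ C.N * C.N := Nat.le_mul_of_pos_left _ C.N_pos
  have hsN : C.s ≤ C.N := by unfold Ctx.N; nlinarith [Nat.mul_le_mul hs2 hs2]
  have hn : C.n ≤ C.N := C.n_le
  have hMX := C.M_le_X
  have hWX := C.off_le_X
  set σ0 := initState G with hσ0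
  have hr0 : σ0.reg 0 = (C.n : ℤ) := by simp [hσ0, initState]
  have hr : ∀ r, r ≠ 0 → σ0.reg r = 0 := fun r hr => by simp [hσ0, initState, hr]
  have hT : (c + k + 10) * (100 * C.s) ≥ (1 + 2) +
    ((Expr.reg 0 - .reg 1 * .reg 1 * .reg 1).cost + 2 + (C.s *
      ((Expr.reg 1 + .const 1).cost + 2 + ((Expr.reg 0 - .reg 1 * .reg 1 * .reg 1).cost + 2) + 1)
        + 1) +
    (((Expr.reg 1 * .reg 1 * .reg 1).cost + 2) + (((Expr.reg 2 * .reg 2).cost + 2) +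
    ((3 + (c + 3) * ((Expr.reg 2).cost + 5)) +
    ((3 + (k + 2) * ((Expr.const 4 * .reg 1 + .const 2).cost + 5)) +
    ((Expr.const 2 * .reg 5 + .const 1).cost + 2)))))) := by
    have e1 : (Expr.reg 0 - .reg 1 * .reg 1 * .reg 1).cost = 11 := by decide
    have e2 : (Expr.reg 1 + .const 1).cost = 4 := by decide
    have e3 : (Expr.reg 1 * .reg 1 * .reg 1).cost = 8 := by decide
    have e4 : (Expr.reg 2 * .reg 2).cost = 5 := by decide
    have e5 : (Expr.reg 2).cost = 2 := by decide
    have e6 : (Expr.const 4 * .reg 1 + .const 2).cost = 6 := by decide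
    have e7 : (Expr.const 2 * .reg 5 + .const 1).cost = 6 := by decide
    rw [e1, e2, e3, e4, e5, e6, e7]
    nlinarith [Nat.zero_le (c * C.s), Nat.zero_le (k * C.s), Nat.mul_le_mul_left c hs2,
      Nat.mul_le_mul_left k hs2]
  refine Run.mono ?_ hT fun _ h => h
  refine Run.seq (Run.assign C.X_large C.X_pow (by norm_num) (by decide) hb ?_)
  let I : ℕ → State → Prop := fun m τ => Bounded C.X τ ∧ τ.mem = σ0.mem ∧
    (∀ r, r ≠ 1 → r ≠ 13 → τ.reg r = σ0.reg r) ∧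
    ∃ s' : ℕ, τ.reg 1 = (s' : ℤ) ∧ 2 ≤ s' ∧ s' + m = C.s
  have hI0 : I (C.s - 2) (σ0.setReg 1 ((Expr.const 2).eval σ0)) := by
    refine ⟨hb.setReg _ (by simp; linarith), rfl, fun r h1 _ => by simp [State.setReg, h1], 2, ?_,
      le_rfl, by omega⟩
    simp [State.setReg]
  refine Run.seq ?_
  refine Run.mono (Run.whileExpr C.X_large C.X_pow (by norm_num) (by decide) (I := I) ?_ ?_ ?_
    (C.s - 2) _ hI0) (by gcongr; omega) fun _ h => h
  · rintro m τ ⟨hτ, hmem, hreg, s', h1, h2, hm⟩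
    have hc : s' * s' * s' ≤ C.N := by
      have : s' ≤ C.s := by omega
      exact Nat.mul_le_mul (Nat.mul_le_mul this this) this
    have hev : |(Expr.reg 0 - .reg 1 * .reg 1 * .reg 1).eval τ| ≤ (C.X : ℤ) := by
      simp only [Expr.eval_sub, Expr.eval_mul, Expr.eval_reg, h1, hreg 0 (by norm_num)
        (by norm_num), hr0]
      have a1 : ((s' * s' * s' : ℕ) : ℤ) ≤ C.X := by exact_mod_cast (by omega)
      have a2 : (C.n : ℤ) ≤ C.X := by exact_mod_cast (by omega)
      push_cast at a1
      have a3 : (0 : ℤ) ≤ (s' : ℤ) * s' * s' := by positivity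
      rw [abs_le]
      constructor <;> linarith
    refine ⟨hτ, hev, ⟨hτ.setReg _ hev, hmem, fun r a b => ?_, s', ?_, h2, hm⟩, ?_⟩
    · simpa [State.setReg, b] using hreg r a b
    · simpa [State.setReg] using h1
    · simp [State.setReg]
  · rintro m τ ⟨hτ, hmem, hreg, s', h1, h2, hm⟩ - hpos
    have hlt : s' * s' * s' < C.n := by
      simp only [Expr.eval_sub, Expr.eval_mul, Expr.eval_reg, h1, hreg 0 (by norm_num)
        (by norm_num), hr0] at hpos
      zify
      linarith
    have hne : s' ≠ C.s := by
      rintro rfl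
      exact absurd C.n_le (by omega)
    refine Run.assign C.X_large C.X_pow (by norm_num) (by decide) hτ ⟨m - 1, by omega, ?_, hmem,
      fun r a b => ?_, s' + 1, ?_, by omega, by omega⟩
    · refine hτ.setReg _ ?_
      simp only [Expr.eval_add, Expr.eval_reg, Expr.eval_const, h1]
      rw [abs_of_nonneg (by positivity)]
      exact_mod_cast (by omega : s' + 1 ≤ C.X)
    · simpa [State.setReg, a] using hreg r a b
    · simp [State.setReg, h1]
  · rintro m τ ⟨hτ, hmem, hreg, s', h1, h2, hm⟩ - hpos
    have hle : C.n ≤ s' * s' * s' := by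
      simp only [Expr.eval_sub, Expr.eval_mul, Expr.eval_reg, h1, hreg 0 (by norm_num)
        (by norm_num), hr0] at hpos
      zify
      linarith
    obtain rfl : s' = C.s := by
      by_contra hne
      exact absurd (hmin s' h2 (by omega)) (by omega)
    refine Run.seq (Run.assign C.X_large C.X_pow (by norm_num) (by decide) hτ ?_)
    have ev2 : (Expr.reg 1 * .reg 1 * .reg 1).eval τ = ((C.N : ℕ) : ℤ) := by
      simp [h1, Ctx.N]
    rw [ev2]
    have hb2 : Bounded C.X (τ.setReg 2 (C.N : ℤ)) :=
      hτ.setReg _ (by rw [Nat.abs_cast]; exact_mod_cast (by omega))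
    refine Run.seq (Run.assign C.X_large C.X_pow (by norm_num) (by decide) hb2 ?_)
    have ev3 : (Expr.reg 2 * .reg 2).eval (τ.setReg 2 (C.N : ℤ)) = ((C.N * C.N : ℕ) : ℤ) := by
      simp [State.setReg]
    rw [ev3]
    have hb3 := hb2.setReg 3 (x := ((C.N * C.N : ℕ) : ℤ))
      (by rw [Nat.abs_cast]; exact_mod_cast hNX)
    refine Run.seq (run_power C.X_large C.X_pow (by norm_num) (by decide) hb3 (v := C.N)
      (by intro x; simp [State.setReg]) (c + 3) (by rw [← hM]; omega) C.N_pos ?_)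
    rw [← hM]
    have hb4 := hb3.setReg 4 (x := (C.M : ℤ))
      (by rw [Nat.abs_cast]; exact_mod_cast (by omega : C.M ≤ C.X))
    refine Run.seq (run_power C.X_large C.X_pow (by norm_num) (by decide) hb4 (v := 4 * C.s + 2)
      (by intro x; simp [State.setReg, h1]) (k + 2) (by rw [← hW]; omega) (by omega) ?_)
    rw [← hW]
    have hb5 := hb4.setReg 5 (x := (C.W : ℤ))
      (by rw [Nat.abs_cast]; exact_mod_cast (by omega : C.W ≤ C.X))
    refine Run.assign C.X_large C.X_pow (by norm_num) (by decide) hb5 ?_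
    have ev5 : (Expr.const 2 * .reg 5 + .const 1).eval ((((τ.setReg 2 (C.N : ℤ)).setReg 3
      ((C.N * C.N : ℕ) : ℤ)).setReg 4 (C.M : ℤ)).setReg 5 (C.W : ℤ)) =
        ((2 * C.W + 1 : ℕ) : ℤ) := by simp [State.setReg]
    rw [ev5]
    have h9 : τ.reg 9 = 0 := by rw [hreg 9 (by norm_num) (by norm_num), hr 9 (by norm_num)]
    have h0 : τ.reg 0 = (C.n : ℤ) := by rw [hreg 0 (by norm_num) (by norm_num), hr0]
    refine ⟨⟨?_, ?_, ?_, ?_, ?_, ?_, ?_, ?_, ?_⟩, ?_, hmem⟩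
    · simpa [State.setReg] using h0
    · simpa [State.setReg] using h1
    · simp [State.setReg]
    · simp [State.setReg]
    · simp [State.setReg]
    · simp [State.setReg]
    · simp [State.setReg, h9]
    · exact hb5.setReg _ (by rw [Nat.abs_cast]; exact_mod_cast (by omega : 2 * C.W + 1 ≤ C.X))
    · intro b a _
      have : ∀ a, τ.mem (10 + b) a = 0 := fun a => by
        rw [hmem]; exact initState_mem_high G (by omega) a
      exact this a
    · simpa [State.setReg] using h9

theorem eval_eInit {G : WDigraph (Fin C.n)} {σ : State} (hσ : Base C σ)
    (hmem : σ.mem = (initState G).mem) {u v : ℕ} (hv : v < C.N) (μ : ℤ → ℤ) :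
    eInit.eval ⟨Function.update σ.reg 10 ((u * C.N + v : ℕ) : ℤ), Function.update σ.mem 4 μ⟩ =
      G.pad.edgeDist C.M u v := by
  have e1 : ((u * C.N + v : ℕ) : ℤ) / (C.N : ℤ) = u := by
    rw [← Int.natCast_div, layer_div hv]
  have e2 : ((u * C.N + v : ℕ) : ℤ) % (C.N : ℤ) = v := by
    rw [← Int.natCast_mod, layer_mod hv]
  simp only [eInit, Expr.eval_cond, Expr.eval_sub, Expr.eval_mul, Expr.eval_div, Expr.eval_mod,
    Expr.eval_const, Expr.eval_reg, Expr.eval_add, Expr.eval_ld, Function.update_self, ne_eq,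
    OfNat.zero_ne_ofNat, OfNat.one_ne_ofNat, Nat.reduceEqDiff, not_false_eq_true,
    Function.update_of_ne, hσ.r0, hσ.r2, hσ.r4, e1, e2, one_sub_sq_pos, hmem, edgeDist]
  by_cases huv : u = v
  · rw [if_pos (by rw [huv]; ring), if_pos huv]
  rw [if_neg (by omega), if_neg huv]
  by_cases hu : u < C.n
  swap
  · rw [if_neg (by omega), if_neg]
    rintro ⟨h, -, -⟩
    exact hu h
  rw [if_pos (by omega)]
  by_cases hv' : v < C.n
  swap
  · rw [if_neg (by omega), if_neg]
    rintro ⟨-, h, -⟩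
    exact hv' h
  rw [if_pos (by omega)]
  have h0 := initState_mem G 0 ⟨u, hu⟩ ⟨v, hv'⟩
  have h1 := initState_mem G 1 ⟨u, hu⟩ ⟨v, hv'⟩
  simp only at h0 h1
  rw [h0, h1]
  by_cases hA : G.Adj ⟨u, hu⟩ ⟨v, hv'⟩
  · simp [hA, pad, hu, hv']
  · have : ¬ G.pad.Adj u v := fun ⟨_, _, h⟩ => hA h
    simp [hA, this]

theorem apsp_cost_le (C : Ctx) (c k p q : ℕ) :
    (c + k + 100 + q * (p + 2)) * (4 * (C.N * C.N) * C.cost) ≥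
    (c + k + 10) * (100 * C.s) + ((5 + C.N * C.N * (eInit.cost + 12)) + ((1 + 2) +
    (((Expr.reg 2 - .reg 6).cost + 2 + (q * (((p + 1) * (4 * (C.N * C.N) * C.cost) +
      ((Expr.const 2 * .reg 6).cost + 2)) + ((Expr.reg 2 - .reg 6).cost + 2) + 1) + 1)) +
    (500 * (C.N * C.N))))) := by
  have hs2 := C.two_le_s
  have hN1 : 1 ≤ C.N := C.N_pos
  have hNN : 1 ≤ C.N * C.N := Nat.mul_pos hN1 hN1
  have hss : C.s ≤ C.s * C.s := Nat.le_mul_of_pos_left _ (by omega)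
  have hcost : 1000000 * C.s ≤ C.cost := by
    unfold Ctx.cost
    omega
  have e1 : eInit.cost ≤ 200 := by decide
  have e2 : (Expr.reg 2 - .reg 6).cost = 5 := by decide
  have e3 : (Expr.const 2 * .reg 6).cost = 4 := by decide
  rw [e2, e3]
  have h3 := Nat.mul_le_mul_left (C.N * C.N) e1
  have h4 : C.N * C.N * 1000000 ≤ C.N * C.N * C.cost := Nat.mul_le_mul_left _ (by omega)
  have h5 : C.cost ≤ C.N * C.N * C.cost := Nat.le_mul_of_pos_left _ (by omega)
  set R := C.N * C.N * C.cost with hR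
  have h6 : (c + k + 10) * (100 * C.s) ≤ (c + k + 10) * (4 * R) :=
    Nat.mul_le_mul_left _ (by omega)
  have h7 : q * 100 ≤ q * (4 * R) := Nat.mul_le_mul_left _ (by omega)
  have h8 : 4 * (C.N * C.N) * C.cost = 4 * R := by rw [hR]; ring
  rw [h8]
  nlinarith

theorem run_output {G : WDigraph (Fin C.n)} {τ : State} (hτ : Base C τ) (hn : 1 ≤ C.n)
    {D : ℕ → ℕ → ℤ} (hD : Mat C.N (τ.mem 4) D)
    (hDM : ∀ u < C.N, ∀ v < C.N, |D u v| ≤ (C.M : ℤ))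
    (hcor : ∀ u v : Fin C.n,
      (G.Reachable u v → 2 * D u v < C.M ∧ IsLeast (G.pathWeights u v) (D u v)) ∧
      (¬ G.Reachable u v → C.M ≤ 2 * D u v)) :
    Run C.B output (500 * (C.N * C.N)) τ fun σ' => APSP.Correct G σ' := by
  have hX := C.X_large
  have hnN : C.n ≤ C.N := C.n_le
  have hNX : C.N * C.N ≤ C.X := C.sq_le_X
  have hN1 : 1 ≤ C.N * C.N := Nat.mul_pos C.N_pos C.N_pos
  have hnn : C.n * C.n ≤ C.N * C.N := Nat.mul_le_mul hnN hnN
  have hT : 500 * (C.N * C.N) ≥ ((Expr.reg 0 * .reg 0).cost + 3 + C.n * C.n *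
      ((Expr.const 0).cost +
        (Expr.cond (.reg 4 - .const 2 * eOut) (.const 1) (.const 0)).cost + 11)) +
    ((Expr.reg 0 * .reg 0).cost + 3 + C.n * C.n * ((Expr.const 0).cost + eOut.cost + 11)) := by
    have e4 : (Expr.reg 0 * .reg 0).cost = 5 := by decide
    have e5 : (Expr.const 0).cost +
      (Expr.cond (.reg 4 - .const 2 * eOut) (.const 1) (.const 0)).cost + 11 ≤ 200 := by decide
    have e6 : (Expr.const 0).cost + eOut.cost + 11 ≤ 200 := by decide
    rw [e4]
    have h1 := Nat.mul_le_mul hnn e5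
    have h2 := Nat.mul_le_mul hnn e6
    omega
  refine Run.mono ?_ hT fun _ h => h
  have hidx : ∀ y : ℕ, y < C.n * C.n → y / C.n < C.N ∧ y % C.n < C.N := fun y hy => by
    obtain ⟨a, b, -⟩ := fill_index (by omega) hy
    exact ⟨by omega, by omega⟩
  have hout : ∀ ν : ℕ → ℤ → ℤ, ν 4 = τ.mem 4 → ∀ ρ : ℕ → ℤ, ρ 0 = (C.n : ℤ) →
      ρ 2 = (C.N : ℤ) → ∀ y : ℕ, y < C.n * C.n →
      eOut.eval ⟨Function.update ρ 10 (y : ℤ), ν⟩ = D (y / C.n) (y % C.n) := by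
    intro ν hν ρ h0 h2 y hy
    have := hD _ (hidx y hy).1 _ (hidx y hy).2
    push_cast at this
    simp [eOut, h0, h2, hν, this]
  refine Run.seq (Run.fill C.X_large C.X_pow (by norm_num) (by decide) (by decide) (by decide)
    hτ.bounded (C.n * C.n) (by simp [hτ.r0]) (by omega) 0 (by intro μ x; rfl)
    (fun y => if 2 * D (y / C.n) (y % C.n) < C.M then 1 else 0) ?_ ?_ ?_)
  · intro y _
    have : (1 : ℤ) ≤ C.X := by exact_mod_cast (by omega)
    split_ifs
    · simpa using this
    · simp
  · intro y hy μ' _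
    have := hout (Function.update τ.mem 2 μ') (by simp) τ.reg hτ.r0 hτ.r2 y hy
    simp only [Expr.eval_cond, Expr.eval_sub, Expr.eval_mul, Expr.eval_reg, Expr.eval_const,
      this, ne_eq, Nat.reduceEqDiff, not_false_eq_true, Function.update_of_ne, hτ.r4, sub_pos]
  intro μ2 hμ2 _ hbd2
  refine Run.fill C.X_large C.X_pow (by norm_num) (by decide) (by decide) (by decide)
    hbd2 (C.n * C.n) (by simp [hτ.r0]) (by omega) 0 (by intro μ x; rfl)
    (fun y => D (y / C.n) (y % C.n)) ?_ ?_ ?_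
  · intro y hy
    have := hDM _ (hidx y hy).1 _ (hidx y hy).2
    have hMX' : 20 * (C.M : ℤ) ≤ C.X := by exact_mod_cast C.M_le_X
    linarith [(Nat.cast_nonneg C.M : (0 : ℤ) ≤ C.M)]
  · intro y hy μ' _
    exact hout _ (by simp) _ (by simp [hτ.r0]) (by simp [hτ.r2]) y hy
  intro μ3 hμ3 _ _ u v
  have hi := index_lt u.2 v.2
  have a2 := hμ2 _ hi
  have a3 := hμ3 _ hi
  rw [layer_div v.2, layer_mod v.2] at a2 a3
  rw [zero_add] at a2 a3
  push_cast at a2 a3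
  simp only [State.matrix, Function.update_self, ne_eq, Nat.reduceEqDiff, not_false_eq_true,
    Function.update_of_ne, a2, a3]
  refine ⟨fun h => ?_, fun h => ?_⟩
  · obtain ⟨c1, c2⟩ := (hcor u v).1 h
    exact ⟨if_pos c1, c2⟩
  · have := (hcor u v).2 h
    exact if_neg (by linarith)

/-- Correctness and running time of the reduction: `q` squarings of at most `p` rounds each. -/
theorem run_apsp {G : WDigraph (Fin C.n)} {c k w p q : ℕ} (hn : 1 ≤ C.n)
    (hmin : ∀ s', 2 ≤ s' → s' < C.s → s' * s' * s' < C.n) (hM : C.M = C.N ^ (c + 3))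
    (hW : C.W = (4 * C.s + 2) ^ (k + 2)) (hG : G.NoNegativeCycle) (hw : G.WeightsBoundedBy w)
    (hwM : 4 * (C.N * w) < C.M) (hp : 4 * C.M + 1 ≤ 2 ^ p) (hq : C.N ≤ 2 ^ q)
    (hoff : q * (p * C.roundOff) ≤ C.offMax) :
    Run C.B (apsp C.P c k) ((c + k + 100 + q * (p + 2)) * (4 * (C.N * C.N) * C.cost)) (initState G)
      fun σ' => APSP.Correct G σ' := by
  have hs2 := C.two_le_s
  have hX := C.X_large
  have hNX : C.N * C.N ≤ C.X := C.sq_le_X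
  have hN2 : 2 ≤ C.N := by unfold Ctx.N; nlinarith [Nat.mul_le_mul hs2 hs2]
  have hN : 2 * C.N ≤ C.N * C.N := Nat.mul_le_mul_right _ hN2
  have hnN : C.n ≤ C.N := C.n_le
  have hMX := C.M_le_X
  have hMX' : 20 * (C.M : ℤ) ≤ C.X := by exact_mod_cast hMX
  have hwM' : 4 * ((C.N : ℤ) * w) < C.M := by exact_mod_cast hwM
  have hwN : w ≤ C.N * w := Nat.le_mul_of_pos_left _ C.N_pos
  have hb : Bounded C.X (initState G) :=
    bounded_initState hw (by omega) (by omega) (by omega)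
  refine Run.mono ?_ (apsp_cost_le C c k p q) fun _ h => h
  refine Run.seq (Run.mono (run_setup hmin hM hW hb) le_rfl ?_)
  rintro σ ⟨hσ, h9, hmem⟩
  have hWM : (w : ℤ) ≤ C.M := by
    have : w ≤ C.M := by omega
    exact_mod_cast this
  have hinit := isApproxDist_edgeDist hG.pad hw.pad hWM C.N
  have hadjN : ∀ u v, G.pad.Adj u v → u < C.N ∧ v < C.N := fun u v ⟨h1, h2, _⟩ =>
    ⟨by omega, by omega⟩
  have hLw : ∀ L : ℕ, L ≤ 2 * C.N → 2 * ((L : ℤ) * w) < C.M := fun L hL => by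
    have : L * w ≤ 2 * C.N * w := Nat.mul_le_mul_right _ hL
    have : 2 * (L * w) < C.M := by nlinarith
    exact_mod_cast this
  have hLw0 : ∀ L : ℕ, 0 ≤ (L : ℤ) * w := fun L => by positivity
  refine Run.seq (run_fillMat hσ (by norm_num) (by decide) (G.pad.edgeDist C.M) ?_ ?_ ?_)
  · intro u hu v hv
    have h1 := hLw 1 (by omega)
    push_cast at h1
    have h2 : (0 : ℤ) ≤ w := by positivity
    have := hinit.abs_le (by push_cast; linarith) hu hv
    linarith [(Nat.cast_nonneg C.M : (0 : ℤ) ≤ C.M)]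
  · intro u hu v hv μ _
    exact eval_eInit hσ hmem hv μ
  intro μ hμ hσ1
  set σ1 : State := ⟨Function.update σ.reg 10 0, Function.update σ.mem 4 μ⟩ with hσ1d
  refine Run.seq (Run.assign C.X_large C.X_pow (by norm_num) (by decide) hσ1.bounded ?_)
  let I : ℕ → State → Prop := fun m τ => Base C τ ∧ ∃ L : ℕ, τ.reg 6 = (L : ℤ) ∧ 1 ≤ L ∧
    L ≤ 2 * C.N ∧ C.N ≤ L * 2 ^ m ∧ τ.reg 9 + (m * (p * C.roundOff) : ℕ) ≤ C.offMax ∧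
    ∃ D, Mat C.N (τ.mem 4) D ∧ IsApproxDist G.pad w C.M C.N L D
  refine Run.seq (Run.whileExpr C.X_large C.X_pow (by norm_num) (by decide) (I := I) ?_ ?_ ?_ q _ ?_)
  · rintro m τ ⟨hτ, L, h6, hL1, hL2, hrest⟩
    have hev : |(Expr.reg 2 - .reg 6).eval τ| ≤ (C.X : ℤ) := by
      simp only [Expr.eval_sub, Expr.eval_reg, hτ.r2, h6]
      have a1 : (C.N : ℤ) ≤ C.X := by exact_mod_cast (by omega)
      have a2 : (L : ℤ) ≤ C.X := by exact_mod_cast (by omega)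
      rw [abs_le]
      constructor <;> linarith [(Nat.cast_nonneg L : (0 : ℤ) ≤ L),
        (Nat.cast_nonneg C.N : (0 : ℤ) ≤ C.N)]
    refine ⟨hτ.bounded, hev, ⟨hτ.setReg (by norm_num) (by norm_num) hev, L, ?_, hL1, hL2, ?_⟩, ?_⟩
    · simpa [State.setReg] using h6
    · simpa [State.setReg] using hrest
    · simp [State.setReg]
  · rintro m τ ⟨hτ, L, h6, hL1, hL2, hLm, ho, D, hD, hDa⟩ - hpos
    have hLN : L < C.N := by
      simp only [Expr.eval_sub, Expr.eval_reg, hτ.r2, h6] at hpos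
      omega
    have hm1 : 1 ≤ m := by
      by_contra hm0
      obtain rfl : m = 0 := by omega
      simp at hLm
      omega
    obtain ⟨m', rfl⟩ := Nat.exists_eq_add_of_le' hm1
    have hL := hLw (2 * L) (by omega)
    push_cast at hL ho
    have hpos' : (0 : ℤ) ≤ (L : ℤ) * w := by positivity
    have hmr : (0 : ℤ) ≤ m' * (p * C.roundOff) := by positivity
    refine Run.seq (Run.mono (run_square hτ hD (fun u hu v hv => hDa.abs_le (by linarith) hu hv) hp
      (by push_cast; linarith)) le_rfl ?_)
    rintro τ' ⟨hτ', g6, g9, D', hD', hsq⟩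
    push_cast at g9
    refine Run.assign C.X_large C.X_pow (by norm_num) (by decide) hτ'.bounded ?_
    have hev : (Expr.const 2 * .reg 6).eval τ' = ((2 * L : ℕ) : ℤ) := by simp [g6, h6]
    rw [hev]
    refine ⟨m', by omega, hτ'.setReg (by norm_num) (by norm_num) ?_, 2 * L, ?_, by omega, by omega,
      ?_, ?_, D', hD', hDa.sq hadjN (by linarith) hsq⟩
    · rw [Nat.abs_cast]; exact_mod_cast (by omega)
    · simp [State.setReg]
    · rw [pow_succ] at hLm; linarith
    · have : (τ'.setReg 6 ((2 * L : ℕ) : ℤ)).reg 9 = τ'.reg 9 := by simp [State.setReg]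
      rw [this]
      push_cast
      linarith
  · rintro m τ ⟨hτ, L, h6, hL1, hL2, hLm, ho, D, hD, hDa⟩ - hpos
    have hLN : C.N ≤ L := by
      simp only [Expr.eval_sub, Expr.eval_reg, hτ.r2, h6] at hpos
      omega
    have hcor := hDa.correct hG hw (by omega) hnN (hLw L hL2)
    exact run_output hτ (by omega) hD (fun u hu v hv => hDa.abs_le (by linarith [hLw L hL2, hLw0 L]) hu hv) hcor
  · have hev : (Expr.const 1).eval σ1 = ((1 : ℕ) : ℤ) := by simp
    rw [hev]
    refine ⟨hσ1.setReg (by norm_num) (by norm_num) ?_, 1, ?_, le_rfl, by omega, by simpa using hq,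
      ?_, _, hμ, hinit⟩
    · rw [Nat.abs_cast]; exact_mod_cast (by omega)
    · simp [State.setReg]
    · have : (σ1.setReg 6 ((1 : ℕ) : ℤ)).reg 9 = 0 := by simp [State.setReg, hσ1d, h9]
      rw [this, zero_add]
      exact_mod_cast hoff

end RAM

/-! ### Size parameters and running time -/

/-- The padded graphs have `s ^ 3` vertices, where `s` is the least integer with `2 ≤ s` and
`n ≤ s ^ 3`. -/
theorem exists_cube_root {n : ℕ} (hn : 1 ≤ n) : ∃ s, 2 ≤ s ∧ n ≤ s * s * s ∧ s ≤ n + 1 ∧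
    s * s * s ≤ 8 * n ∧ ∀ s', 2 ≤ s' → s' < s → s' * s' * s' < n := by
  have hex : ∃ s, 2 ≤ s ∧ n ≤ s * s * s := ⟨n + 1, by omega, by nlinarith [Nat.zero_le (n * n)]⟩
  classical
  obtain ⟨h1, h2⟩ := Nat.find_spec hex
  have hmin : ∀ s', 2 ≤ s' → s' < Nat.find hex → s' * s' * s' < n := fun s' h h' => by
    have := Nat.find_min hex h'
    push Not at this
    exact this h
  refine ⟨Nat.find hex, h1, h2, Nat.find_min' hex ⟨by omega, by nlinarith [Nat.zero_le (n * n)]⟩,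
    ?_, hmin⟩
  rcases h1.lt_or_eq with h | h
  · obtain ⟨r, hr⟩ := Nat.exists_eq_add_of_le' (show 1 ≤ Nat.find hex by omega)
    have h3 := hmin r (by omega) (by omega)
    rw [hr]
    have h4 : r + 1 ≤ 2 * r := by omega
    calc (r + 1) * (r + 1) * (r + 1) ≤ (2 * r) * (2 * r) * (2 * r) := by gcongr
      _ = 8 * (r * r * r) := by ring
      _ ≤ 8 * n := by omega
  · rw [← h]; omega

/-- The running time, up to a constant factor: the polylogarithmic number of rounds is absorbed by
half of the gain in the exponent. -/
theorem time_le {δ : ℝ} (hδ : 0 < δ) (hδ1 : δ ≤ 1) (A b C₀ : ℝ) (hA : 0 ≤ A) (hb : 0 ≤ b)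
    (hC₀ : 0 ≤ C₀) : ∃ K : ℝ, ∀ n s : ℕ, 1 ≤ n → 2 ≤ s → s * s * s ≤ 8 * n → ∀ Tc : ℝ,
      Tc ≤ C₀ * ((4 * s : ℕ) : ℝ) ^ (3 - δ) →
      A * ((Nat.log 2 s + 1 : ℕ) : ℝ) ^ 2 * (4 * ((s * s * s * (s * s * s) : ℕ) : ℝ) *
        (2 * Tc + b * (s * s : ℕ))) ≤ K * (n : ℝ) ^ (3 - δ / 6) := by
  set e := δ / 4 with he
  have hepos : 0 < e := by positivity
  refine ⟨A * (2 / e + 1) ^ 2 * (4 * (128 * C₀ + b)) * 512, fun n s hn hs hsn Tc hTc => ?_⟩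
  have hs1 : (1 : ℝ) ≤ s := by exact_mod_cast (by omega)
  have hs0 : (0 : ℝ) < s := by linarith
  have hn0 : (0 : ℝ) < n := by exact_mod_cast hn
  have hse : 1 ≤ (s : ℝ) ^ e := Real.one_le_rpow hs1 hepos.le
  have hlog : ((Nat.log 2 s + 1 : ℕ) : ℝ) ≤ (2 / e + 1) * (s : ℝ) ^ e := by
    have h1 : (2 : ℝ) ^ Nat.log 2 s ≤ s := by exact_mod_cast Nat.pow_log_le_self 2 (by omega)
    have h2 : (Nat.log 2 s : ℝ) * Real.log 2 ≤ Real.log s := by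
      rw [← Real.log_pow]
      exact Real.log_le_log (by positivity) h1
    have h3 := Real.log_le_rpow_div hs0.le hepos
    have h4 := Real.log_two_gt_d9
    have h5 : (Nat.log 2 s : ℝ) ≤ 2 / e * (s : ℝ) ^ e := by
      have h6 : 2 / e * (s : ℝ) ^ e = 2 * ((s : ℝ) ^ e / e) := by ring
      rw [h6]
      nlinarith [(Nat.cast_nonneg (Nat.log 2 s) : (0 : ℝ) ≤ _)]
    push_cast
    linarith
  have hlog2 : ((Nat.log 2 s + 1 : ℕ) : ℝ) ^ 2 ≤ (2 / e + 1) ^ 2 * (s : ℝ) ^ (δ / 2) := by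
    have h1 : (s : ℝ) ^ (δ / 2) = ((s : ℝ) ^ e) ^ 2 := by
      rw [← Real.rpow_natCast, ← Real.rpow_mul hs0.le, he]
      congr 1
      push_cast
      ring
    rw [h1, ← mul_pow]
    exact pow_le_pow_left₀ (by positivity) hlog 2
  have hTc' : 2 * Tc + b * (s * s : ℕ) ≤ (128 * C₀ + b) * (s : ℝ) ^ (3 - δ) := by
    have h1 : ((4 * s : ℕ) : ℝ) ^ (3 - δ) ≤ 64 * (s : ℝ) ^ (3 - δ) := by
      push_cast
      rw [Real.mul_rpow (by norm_num) hs0.le]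
      have : (4 : ℝ) ^ (3 - δ) ≤ (4 : ℝ) ^ (3 : ℝ) :=
        Real.rpow_le_rpow_of_exponent_le (by norm_num) (by linarith)
      norm_num at this
      exact mul_le_mul_of_nonneg_right this (by positivity)
    have h2 : ((s * s : ℕ) : ℝ) ≤ (s : ℝ) ^ (3 - δ) := by
      have h3 : ((s * s : ℕ) : ℝ) = (s : ℝ) ^ (2 : ℝ) := by
        push_cast
        rw [← sq]
        exact_mod_cast (Real.rpow_natCast (s : ℝ) 2).symm
      rw [h3]
      exact Real.rpow_le_rpow_of_exponent_le hs1 (by linarith)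
    have h3 := mul_le_mul_of_nonneg_left h1 hC₀
    have h4 := mul_le_mul_of_nonneg_left h2 hb
    linarith
  have hpow : (s : ℝ) ^ (δ / 2) * (((s * s * s * (s * s * s) : ℕ) : ℝ) * (s : ℝ) ^ (3 - δ)) ≤
      512 * (n : ℝ) ^ (3 - δ / 6) := by
    have h6 : ((s * s * s * (s * s * s) : ℕ) : ℝ) = (s : ℝ) ^ (6 : ℝ) := by
      have : (s : ℝ) ^ (6 : ℝ) = (s : ℝ) ^ (6 : ℕ) := by exact_mod_cast Real.rpow_natCast (s : ℝ) 6
      rw [this]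
      push_cast
      ring
    have h3 : ((s * s * s : ℕ) : ℝ) = (s : ℝ) ^ (3 : ℝ) := by
      have : (s : ℝ) ^ (3 : ℝ) = (s : ℝ) ^ (3 : ℕ) := by exact_mod_cast Real.rpow_natCast (s : ℝ) 3
      rw [this]
      push_cast
      ring
    rw [h6, ← Real.rpow_add hs0, ← Real.rpow_add hs0]
    have h7 : δ / 2 + (6 + (3 - δ)) = 3 * (3 - δ / 6) := by ring
    rw [h7, Real.rpow_mul hs0.le, ← h3]
    have h8 : ((s * s * s : ℕ) : ℝ) ≤ 8 * n := by exact_mod_cast hsn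
    calc ((s * s * s : ℕ) : ℝ) ^ (3 - δ / 6) ≤ (8 * (n : ℝ)) ^ (3 - δ / 6) :=
          Real.rpow_le_rpow (by positivity) h8 (by linarith)
      _ = 8 ^ (3 - δ / 6) * (n : ℝ) ^ (3 - δ / 6) := Real.mul_rpow (by norm_num) hn0.le
      _ ≤ 512 * (n : ℝ) ^ (3 - δ / 6) := by
          have : (8 : ℝ) ^ (3 - δ / 6) ≤ (8 : ℝ) ^ (3 : ℝ) :=
            Real.rpow_le_rpow_of_exponent_le (by norm_num) (by linarith)
          norm_num at this
          exact mul_le_mul_of_nonneg_right this (by positivity)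
  calc A * ((Nat.log 2 s + 1 : ℕ) : ℝ) ^ 2 * (4 * ((s * s * s * (s * s * s) : ℕ) : ℝ) *
        (2 * Tc + b * (s * s : ℕ)))
      ≤ A * ((2 / e + 1) ^ 2 * (s : ℝ) ^ (δ / 2)) * (4 * ((s * s * s * (s * s * s) : ℕ) : ℝ) *
        ((128 * C₀ + b) * (s : ℝ) ^ (3 - δ))) := by
        refine mul_le_mul_of_nonneg (mul_le_mul_of_nonneg_left hlog2 hA)
          (mul_le_mul_of_nonneg_left hTc' (by positivity)) (by positivity) (by positivity)
    _ = A * (2 / e + 1) ^ 2 * (4 * (128 * C₀ + b)) *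
        ((s : ℝ) ^ (δ / 2) * (((s * s * s * (s * s * s) : ℕ) : ℝ) * (s : ℝ) ^ (3 - δ))) := by ring
    _ ≤ A * (2 / e + 1) ^ 2 * (4 * (128 * C₀ + b)) * (512 * (n : ℝ) ^ (3 - δ / 6)) :=
        mul_le_mul_of_nonneg_left hpow (by positivity)
    _ = _ := by ring

namespace RAM

/-- The data of the reduction for a given solver of APNP and a given number of vertices. -/
theorem exists_ctx {P : Prog} {c k : ℕ} {n s Tc : ℕ} (hn : 1 ≤ n) (hs : 2 ≤ s)
    (hns : n ≤ s * s * s) (hsn : s ≤ n + 1)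
    (hP : ∀ G : WDigraph (Fin (4 * s)), G.WeightsBoundedBy ((4 * s) ^ (3 * c + 12)) →
      ∃ t ≤ Tc, ∃ s', Exec ((4 * s + 2) ^ k) P (initState G) t s' ∧ APNP.Correct G s') :
    ∃ C : Ctx, C.n = n ∧ C.s = s ∧ C.P = P ∧ C.Tc = Tc ∧
      C.B = (n + 2) ^ (300 * (3 * c + k + 40)) ∧ C.M = C.N ^ (c + 3) ∧
      C.W = (4 * C.s + 2) ^ (k + 2) ∧ 4 * (C.N * n ^ c) < C.M ∧
      4 * C.M + 1 ≤ 2 ^ ((Nat.log 2 s + 1) * (3 * c + 12)) ∧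
      C.N ≤ 2 ^ (3 * (Nat.log 2 s + 1)) ∧
      3 * (Nat.log 2 s + 1) * ((Nat.log 2 s + 1) * (3 * c + 12) * C.roundOff) ≤ C.offMax := by
  set ℓ := Nat.log 2 s + 1 with hℓ
  set N := s * s * s with hN
  set S := 4 * s + 2 with hS
  set W := S ^ (k + 2) with hW
  set M := N ^ (c + 3) with hM
  have hS10 : 10 ≤ S := by omega
  have hpow : ∀ {a b : ℕ}, a ≤ b → S ^ a ≤ S ^ b := fun h => Nat.pow_le_pow_right (by omega) h
  have hsS : s ≤ S := by omega
  have hℓs : ℓ ≤ s := Nat.log_lt_self 2 (by omega)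
  have hS2 : 100 ≤ S ^ 2 := by nlinarith
  have hNs : N = s ^ 3 := by rw [hN]; ring
  have hN8 : 8 ≤ N := by
    have : 2 ^ 3 ≤ s ^ 3 := Nat.pow_le_pow_left hs 3
    omega
  have hNS : N ≤ S ^ 3 := by rw [hNs]; exact Nat.pow_le_pow_left hsS 3
  have hMs : M = s ^ (3 * c + 9) := by rw [hM, hNs, ← pow_mul]; rfl
  have hMS : 20 * M ≤ S ^ (3 * c + 11) := by
    have : M ≤ S ^ (3 * c + 9) := by rw [hMs]; exact Nat.pow_le_pow_left hsS _
    calc 20 * M ≤ S ^ 2 * S ^ (3 * c + 9) := Nat.mul_le_mul (by omega) this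
      _ = S ^ (3 * c + 11) := by rw [← pow_add]; congr 1; omega
  have hstep : 2 * W + 1 ≤ S ^ (k + 3) := by
    have h1 : 1 ≤ W := Nat.one_le_pow _ _ (by omega)
    have : S ^ (k + 3) = W * S := pow_succ _ _
    nlinarith
  have hround : 2 * (N * N) * (2 * W + 1) ≤ S ^ (k + 10) := by
    calc 2 * (N * N) * (2 * W + 1) ≤ S ^ 1 * (S ^ 3 * S ^ 3) * S ^ (k + 3) :=
          Nat.mul_le_mul (Nat.mul_le_mul (by rw [pow_one]; omega) (Nat.mul_le_mul hNS hNS)) hstep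
      _ = S ^ (k + 10) := by rw [← pow_add, ← pow_add, ← pow_add]; congr 1; ring
  have hc12 : 3 * c + 12 ≤ S ^ (c + 2) := by
    have h1 : c + 1 ≤ S ^ c := (Nat.lt_pow_self (by omega) : c < S ^ c)
    rw [pow_add]
    nlinarith
  have hoff : 3 * ℓ * (ℓ * (3 * c + 12) * (2 * (N * N) * (2 * W + 1))) ≤ S ^ (c + k + 15) := by
    calc 3 * ℓ * (ℓ * (3 * c + 12) * (2 * (N * N) * (2 * W + 1)))
        ≤ S ^ 1 * S ^ 1 * (S ^ 1 * S ^ (c + 2) * S ^ (k + 10)) :=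
          Nat.mul_le_mul (Nat.mul_le_mul (by rw [pow_one]; omega) (by rw [pow_one]; omega))
            (Nat.mul_le_mul (Nat.mul_le_mul (by rw [pow_one]; omega) hc12) hround)
      _ = S ^ (c + k + 15) := by simp only [← pow_add]; congr 1; ring
  have hM1 : 1 ≤ M := Nat.one_le_pow _ _ (by omega)
  have hM4 : 20 * M ≤ (4 * s) ^ (3 * c + 12) := by
    have h1 : M ≤ (4 * s) ^ (3 * c + 9) := by rw [hMs]; exact Nat.pow_le_pow_left (by omega) _
    have h2 : 20 ≤ (4 * s) ^ 3 := by
      have : 8 ^ 3 ≤ (4 * s) ^ 3 := Nat.pow_le_pow_left (by omega) 3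
      omega
    calc 20 * M ≤ (4 * s) ^ 3 * (4 * s) ^ (3 * c + 9) := Nat.mul_le_mul h2 h1
      _ = (4 * s) ^ (3 * c + 12) := by rw [← pow_add]; congr 1; ring
  have hs2ℓ : s ≤ 2 ^ ℓ := (Nat.lt_pow_succ_log_self (by norm_num) s).le
  have x1 : 100 ≤ S ^ (3 * c + k + 40) := hS2.trans (hpow (by omega))
  have x2 : (S ^ (3 * c + k + 40)) ^ 100 ≤ (n + 2) ^ (300 * (3 * c + k + 40)) := by
    have h1 : S ≤ (n + 2) ^ 3 := by
      have h2 : (n + 2) ^ 3 = n * n * n + 6 * (n * n) + 12 * n + 8 := by ring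
      rw [h2]
      omega
    have h3 : 300 * (3 * c + k + 40) = 3 * ((3 * c + k + 40) * 100) := by ring
    rw [h3, pow_mul (n + 2), ← pow_mul]
    exact Nat.pow_le_pow_left h1 _
  have x3 : N * N ≤ S ^ (3 * c + k + 40) := by
    have h1 : S ^ 3 * S ^ 3 = S ^ 6 := by rw [← pow_add]
    have h2 : S ^ 6 ≤ S ^ (3 * c + k + 40) := hpow (by omega)
    exact (Nat.mul_le_mul hNS hNS).trans (h1.le.trans h2)
  have x4 : 20 * M ≤ S ^ (3 * c + k + 40) := hMS.trans (hpow (by omega))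
  have x5 : 3 * ℓ * (ℓ * (3 * c + 12) * (2 * (N * N) * (2 * W + 1))) + 2 * W + 1 ≤
      S ^ (3 * c + k + 40) := by
    have h1 : 2 * W + 1 ≤ S ^ (c + k + 15) := hstep.trans (hpow (by omega))
    have h2 : S ^ (c + k + 16) = S ^ (c + k + 15) * S := pow_succ _ _
    have h3 : S ^ (c + k + 16) ≤ S ^ (3 * c + k + 40) := hpow (by omega)
    have h4 : S ^ (c + k + 15) * 2 ≤ S ^ (c + k + 15) * S := Nat.mul_le_mul_left _ (by omega)
    omega
  have x6 : 16 * (s * s) ≤ W := by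
    have h1 : 16 * (s * s) ≤ S * S := by
      have : (4 * s) * (4 * s) ≤ S * S := Nat.mul_le_mul (by omega) (by omega)
      linarith
    have h2 : S ^ 2 ≤ W := hpow (by omega)
    exact h1.trans ((sq S).symm.le.trans h2)
  have x7 : S ^ k ≤ W := hpow (by omega)
  let C : Ctx :=
    { n := n, s := s, M := M, W := W, X := S ^ (3 * c + k + 40)
      B := (n + 2) ^ (300 * (3 * c + k + 40)), B₁ := S ^ k, Tc := Tc
      offMax := 3 * ℓ * (ℓ * (3 * c + 12) * (2 * (N * N) * (2 * W + 1)))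
      P := P
      two_le_s := hs
      n_le := hns
      X_large := x1
      X_pow := x2
      sq_le_X := x3
      M_le_X := x4
      M_pos := hM1
      off_le_X := x5
      le_W := x6
      B₁_le := x7
      oracle := fun G hG => hP G fun u v h => (hG u v h).trans (by exact_mod_cast hM4) }
  refine ⟨C, rfl, rfl, rfl, rfl, rfl, rfl, rfl, ?_, ?_, ?_, le_rfl⟩
  · change 4 * (N * n ^ c) < N ^ (c + 3)
    have h1 : n ^ c ≤ N ^ c := Nat.pow_le_pow_left hns c
    have h2 : 1 ≤ N ^ c := Nat.one_le_pow _ _ (by omega)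
    have h3 : N ^ (c + 3) = N * N ^ c * (N * N) := by ring
    have h4 : N * n ^ c ≤ N * N ^ c := Nat.mul_le_mul_left _ h1
    have h5 : 1 ≤ N * N ^ c := Nat.mul_pos (by omega) h2
    have h6 : N * N ^ c * 8 ≤ N * N ^ c * (N * N) :=
      Nat.mul_le_mul_left _ (hN8.trans (Nat.le_mul_of_pos_left _ (by omega)))
    rw [h3]
    omega
  · change 4 * M + 1 ≤ 2 ^ (ℓ * (3 * c + 12))
    have h1 : M ≤ (2 ^ ℓ) ^ (3 * c + 9) := by rw [hMs]; exact Nat.pow_le_pow_left hs2ℓ _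
    have h2 : 8 ≤ (2 ^ ℓ) ^ 3 := by
      have : 2 ≤ 2 ^ ℓ := hs.trans hs2ℓ
      calc 8 = 2 ^ 3 := by norm_num
        _ ≤ _ := Nat.pow_le_pow_left this 3
    calc 4 * M + 1 ≤ 8 * M := by omega
      _ ≤ (2 ^ ℓ) ^ 3 * (2 ^ ℓ) ^ (3 * c + 9) := Nat.mul_le_mul h2 h1
      _ = 2 ^ (ℓ * (3 * c + 12)) := by rw [← pow_add, ← pow_mul]; congr 1; ring
  · change N ≤ 2 ^ (3 * ℓ)
    rw [hNs, mul_comm, pow_mul]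
    exact Nat.pow_le_pow_left hs2ℓ 3

end RAM

open RAM in
/-- A truly subcubic algorithm for nonnegative prefix paths yields one for shortest paths. -/
theorem APSP_solvable_of_APNP {ε δ : ℝ} (hδ : 0 < δ) (hδ1 : δ ≤ 1) (hδε : δ ≤ ε)
    (h : APNP.SolvableInTime fun n => (n : ℝ) ^ (3 - ε)) :
    APSP.SolvableInTime fun n => (n : ℝ) ^ (3 - δ / 6) := by
  intro c
  obtain ⟨P, k, C₀, hP⟩ := h (3 * c + 12)
  obtain ⟨K, hK⟩ := time_le hδ hδ1 ((c + k + 100 + 3 * (3 * c + 14) : ℕ) : ℝ)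
    ((P.regBound + 1000000 : ℕ) : ℝ) |C₀| (by positivity) (by positivity) (abs_nonneg _)
  refine ⟨apsp P c k, 300 * (3 * c + k + 40), K, fun n hn G hG hw => ?_⟩
  obtain ⟨s, hs, hns, hsn, hs8, hmin⟩ := exists_cube_root hn
  set Tc := ⌊C₀ * ((4 * s : ℕ) : ℝ) ^ (3 - ε)⌋₊ with hTc
  have hs1 : (1 : ℝ) ≤ ((4 * s : ℕ) : ℝ) := by exact_mod_cast (by omega)
  have hTc' : (Tc : ℝ) ≤ |C₀| * ((4 * s : ℕ) : ℝ) ^ (3 - δ) := by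
    have h1 : ((4 * s : ℕ) : ℝ) ^ (3 - ε) ≤ ((4 * s : ℕ) : ℝ) ^ (3 - δ) :=
      Real.rpow_le_rpow_of_exponent_le hs1 (by linarith)
    have h2 : C₀ * ((4 * s : ℕ) : ℝ) ^ (3 - ε) ≤ |C₀| * ((4 * s : ℕ) : ℝ) ^ (3 - δ) :=
      mul_le_mul (le_abs_self _) h1 (by positivity) (abs_nonneg _)
    exact (Nat.cast_le.2 (Nat.floor_le_floor h2)).trans (Nat.floor_le (by positivity))
  obtain ⟨C, rfl, rfl, rfl, hCT, hCB, hCM, hCW, hwM, hp, hq, hoff⟩ :=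
    exists_ctx (P := P) (c := c) (k := k) (Tc := Tc) hn hs hns hsn fun G' hG' => by
      obtain ⟨t, s', h1, h2, h3⟩ := hP (4 * s) (by omega) G' trivial hG'
      exact ⟨t, Nat.le_floor h2, s', h1, h3⟩
  obtain ⟨t, τ, σ, hex, ht, hvis, hcor⟩ :=
    run_apsp hn hmin hCM hCW hG hw hwM hp hq hoff (initState G) (Vis.refl _)
  refine ⟨t, τ, by rwa [hCB] at hex, ?_, ?_⟩
  · refine le_trans ?_ (hK C.n C.s hn hs hs8 Tc hTc')
    have hℓ1 : 1 ≤ Nat.log 2 C.s + 1 := by omega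
    set ℓ := Nat.log 2 C.s + 1
    have h1 : c + k + 100 + 3 * ℓ * (ℓ * (3 * c + 12) + 2) ≤
        (c + k + 100 + 3 * (3 * c + 14)) * ℓ ^ 2 := by
      have h2 : ℓ ≤ ℓ ^ 2 := Nat.le_self_pow (by norm_num) ℓ
      have h3 : c + k + 100 ≤ (c + k + 100) * ℓ ^ 2 := Nat.le_mul_of_pos_right _ (by omega)
      have h4 : 3 * ℓ * (ℓ * (3 * c + 12) + 2) = 3 * (3 * c + 12) * ℓ ^ 2 + 6 * ℓ := by ring
      have h5 : (c + k + 100 + 3 * (3 * c + 14)) * ℓ ^ 2 =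
        (c + k + 100) * ℓ ^ 2 + 3 * (3 * c + 12) * ℓ ^ 2 + 6 * ℓ ^ 2 := by ring
      rw [h4, h5]
      linarith
    have h2 : C.cost ≤ 2 * Tc + (C.P.regBound + 1000000) * (C.s * C.s) := by
      unfold Ctx.cost
      rw [hCT, add_mul]
      have : C.P.regBound ≤ C.P.regBound * (C.s * C.s) :=
        Nat.le_mul_of_pos_right _ (Nat.mul_pos (by omega) (by omega))
      omega
    have h3 : t ≤ ((c + k + 100 + 3 * (3 * c + 14)) * ℓ ^ 2) *
        (4 * (C.N * C.N) * (2 * Tc + (C.P.regBound + 1000000) * (C.s * C.s))) :=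
      ht.trans (Nat.mul_le_mul h1 (Nat.mul_le_mul_left _ h2))
    have h4 : (t : ℝ) ≤ ((((c + k + 100 + 3 * (3 * c + 14)) * ℓ ^ 2) *
        (4 * (C.N * C.N) * (2 * Tc + (C.P.regBound + 1000000) * (C.s * C.s))) : ℕ) : ℝ) := by
      exact_mod_cast h3
    refine h4.trans (le_of_eq ?_)
    unfold Ctx.N
    push_cast
    ring
  · intro u v
    have := hcor u v
    simpa only [State.matrix, hvis.2] using this

theorem mainTheorem5 (hAPSP : APSPHypothesis) :
    ∀ ε : ℝ, 0 < ε → ¬ APNP.SolvableInTime (fun n => (n : ℝ) ^ (3 - ε)) := by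
  intro ε hε h
  have hδ : 0 < min ε 1 := lt_min hε one_pos
  exact hAPSP (min ε 1 / 6) (by positivity)
    (APSP_solvable_of_APNP hδ (min_le_right _ _) (min_le_left _ _) h)
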